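/- **The model.** Let $\alpha\in(0,1)$, $\beta\in(0,1-\alpha)$, $p\in(0,1]$ be constants, and let $m\ge 1$ be an integer, which may depend on $n$. Let $S=[0,1]^m$ with opposite faces identified, with the torus metric derived from the $\ell_\infty$ norm. Consider the following Markov chain on triples consisting of $n$ nodes placed in $S$, a ranking of the nodes (a bijection to $\{1,\dots,n\}$), and a graph on the nodes. The influence region of a node of rank $r$ is the ball around it of volume $r^{-\alpha}n^{-\beta}$. In each step a new node $v$ is placed uniformly at random in $S$; independently for each existing node $u$ whose influence region contains $v$, the edge $uv$ is created with probability $p$; a uniformly random one of the $n$ existing nodes is deleted with all its edges; and $v$ receives a uniformly random rank $R\in\{1,\dots,n\}$, while the surviving nodes keep their relative order on the remaining ranks. $\mathrm{GEO\text{-}P}(\alpha,\beta,m,p)$ is the random graph on $n$ nodes under the stationary distribution of this chain. For a graph $G=(V,E)$ put $c(v)=e(N(v))/\binom{\deg v}{2}$, where $e(N(v))$ is the number of edges between neighbours of $v$ (and $c(v)=0$ if $\deg v\le 1$); the clustering coefficient is $c(G)=\frac1{|V|}\sum_{v\in V}c(v)$. An event holds *with extreme probability* (wep) if there is a constant $c>0$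 such that its probability is at least $1-\exp(-c\log^2 n)$ for all large $n$. **Theorem 3.4.** Let $K=K(n)$ be the largest even integer that is at most $\left(n^{1-\alpha-\beta}/\log^3 n\right)^{1/m}$, and suppose that $K\ge 2$ for all large $n$ (which is automatic when $m$ is constant). Then, as $n\to\infty$, wep the graph $G$ sampled from $\mathrm{GEO\text{-}P}(\alpha,\beta,m,p)$ satisfies $$c(G)\ \ge\ (1+o(1))\left(\frac34\Big(1-\frac{2}{3K}\Big)\right)^m\frac{1-\alpha}{1+\alpha}\,p ,$$ and $\left(\frac34\big(1-\frac{2}{3K}\big)\right)^m=e^{-f}\left(\frac34\right)^m$ for all large $n$, for some $f=f(n)=\Theta(m/K)$. Moreover, if $m\le(1-\alpha-\beta)\frac{\log n}{\log\log n}\left(1-\frac1{\log\log n}\right)$ for all large $n$, then $K/m\to\infty$, wep $$c(G)\ \ge\ (1+o(1))\left(\frac34\right)^m\frac{1-\alpha}{1+\alpha}\,p ,$$ and the expected clustering coefficient of the binomial random graph $G(n,d/n)$, where $d$ is the expected average degree of $\mathrm{GEO\text{-}P}(\alpha,\beta,m,p)$, is $o\left(\left(\frac34\right)^m\frac{1-\alpha}{1+\alpha}\,p\right)$.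 -/

import Mathlib

open MeasureTheory ProbabilityTheory Filter Topology

/-! ### Clustering coefficient and average degree of a finite graph -/

/-- The clustering coefficient of a vertex: the number of edges with both ends in the
neighbourhood of `v`, divided by `deg v` choose `2`. It is `0` when `deg v ≤ 1`, because the
denominator is then `0`. -/
noncomputable def localClustering {V : Type*} (G : SimpleGraph V) (v : V) : ℝ :=
  ({e ∈ G.edgeSet | ∀ w ∈ e, w ∈ G.neighborSet v}.ncard : ℝ) /
    (((G.neighborSet v).ncard.choose 2 : ℕ) : ℝ)

/-- The clustering coefficient of a finite graph: the average over its vertices. -/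
noncomputable def clusteringCoeff {V : Type*} [Fintype V] (G : SimpleGraph V) : ℝ :=
  (∑ v, localClustering G v) / (Fintype.card V : ℝ)

/-- The average degree `2 |E| / |V|`. -/
noncomputable def averageDegree {V : Type*} [Fintype V] (G : SimpleGraph V) : ℝ :=
  2 * (G.edgeSet.ncard : ℝ) / (Fintype.card V : ℝ)

/-! ### The geo-protean Markov chain -/

namespace GeoP

/-- The unit hypercube with opposite faces identified, that is `(ℝ / ℤ) ^ m`. Its `dist` is the
torus metric derived from the sup norm, and its `volume` is the uniform probability measure. -/
abbrev Torus (m : ℕ) : Type := Fin m → UnitAddCircle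

/-- The volume `r ^ (-α) * n ^ (-β)` of the influence region of a node of rank `r`. -/
noncomputable def influenceVolume (α β : ℝ) (n r : ℕ) : ℝ :=
  (r : ℝ) ^ (-α) * (n : ℝ) ^ (-β)

/-- The influence region of a node of rank `r` at the point `x`: the ball around `x` of volume
`influenceVolume α β n r`, i.e. the cube whose side is the `m`-th root of that volume
(see `volume_influenceRegion`). -/
noncomputable def influenceRegion (α β : ℝ) (n m r : ℕ) (x : Torus m) : Set (Torus m) :=
  Metric.closedBall x (influenceVolume α β n r ^ (1 / (m : ℝ)) / 2)

theorem volume_influenceRegion {α β : ℝ} (hα : 0 ≤ α) (hβ : 0 ≤ β) {n m r : ℕ}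
    (hn : 1 ≤ n) (hm : 1 ≤ m) (hr : 1 ≤ r) (x : Torus m) :
    volume (influenceRegion α β n m r x) = ENNReal.ofReal (influenceVolume α β n r) := by
  have h0 : 0 ≤ influenceVolume α β n r := by unfold influenceVolume; positivity
  have h1 : influenceVolume α β n r ≤ 1 := by
    unfold influenceVolume
    exact mul_le_one₀ (Real.rpow_le_one_of_one_le_of_nonpos (by exact_mod_cast hr) (by linarith))
      (by positivity) (Real.rpow_le_one_of_one_le_of_nonpos (by exact_mod_cast hn) (by linarith))
  have h2 : influenceVolume α β n r ^ (1 / (m : ℝ)) ≤ 1 :=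
    Real.rpow_le_one h0 h1 (by positivity)
  have h3 : 0 ≤ influenceVolume α β n r ^ (1 / (m : ℝ)) := by positivity
  rw [influenceRegion, closedBall_pi _ (by positivity), volume_pi_pi]
  simp only [AddCircle.volume_closedBall]
  rw [Finset.prod_const, mul_div_cancel₀ _ (two_ne_zero), min_eq_right h2, Finset.card_univ,
    Fintype.card_fin, ← ENNReal.ofReal_pow h3, ← Real.rpow_natCast, ← Real.rpow_mul h0,
    one_div_mul_cancel (by positivity), Real.rpow_one]

/-- The new rank of a surviving node of rank `r`, when the node of rank `D` is deleted and a node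
is inserted at rank `R`: first the ranks below `D` close up, then the ranks from `R` on make room.
The deleted node's own rank `D` is sent to `R`, as its place is taken by the new node. -/
def newRank (D R r : ℕ) : ℕ :=
  if r = D then R
  else
    let r' := if D < r then r - 1 else r
    if R ≤ r' then r' + 1 else r'

/-- The update of the ranking as a permutation of the set of ranks (the rank `k + 1` is
represented by `k : Fin n`). -/
noncomputable def rankUpdate {n : ℕ} (D R : Fin n) : Equiv.Perm (Fin n) :=
  Equiv.ofBijective
    (fun r => (⟨newRank D R r, by
      have := D.2; have := R.2; have := r.2
      simp only [newRank]; split_ifs <;> omega⟩ : Fin n))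
    (Finite.injective_iff_bijective.mp (by
      intro a b h
      have h' : newRank D R a = newRank D R b := congrArg Fin.val h
      apply Fin.ext
      simp only [newRank] at h'
      split_ifs at h' <;> omega))

instance instMeasurableSpaceRanking {n : ℕ} : MeasurableSpace (Equiv.Perm (Fin n)) := ⊤

instance instDiscreteMeasurableSpaceRanking {n : ℕ} :
    DiscreteMeasurableSpace (Equiv.Perm (Fin n)) := ⟨fun _ => trivial⟩

/-- A state of the chain: the positions of the `n` nodes, their ranks (a bijection; the rank of
node `i` is `ρ i + 1`), and the graph. A node that is born takes the label of the node that dies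
in the same step. -/
abbrev State (n m : ℕ) : Type := (Fin n → Torus m) × Equiv.Perm (Fin n) × SimpleGraph (Fin n)

/-- The randomness of one step: the node to be deleted, the position of the new node, its initial
rank, and for each existing node a coin deciding whether an available link is realised. -/
abbrev Innovation (n m : ℕ) : Type := Fin n × Torus m × Fin n × (Fin n → Bool)

/-- In one step the four ingredients are independent; the deleted node, the position and the
initial rank are uniform, and each coin shows `true` with probability `p`. -/
noncomputable def innovationLaw (p : unitInterval) (n m : ℕ) : Measure (Innovation n m) :=
  (uniformOn (Set.univ : Set (Fin n))).prod
    ((volume : Measure (Torus m)).prod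
      ((uniformOn (Set.univ : Set (Fin n))).prod
        (Measure.pi fun _ : Fin n => bernoulliMeasure true false p)))

/-- The new node at `y` is linked to node `w`: the point `y` lies in the influence region that `w`
has before the step, and the coin of `w` shows `true`. -/
def Linked (α β : ℝ) {n m : ℕ} (s : State n m) (ω : Innovation n m) (w : Fin n) : Prop :=
  ω.2.1 ∈ influenceRegion α β n m ((s.2.1 w : ℕ) + 1) (s.1 w) ∧ ω.2.2.2 w = true

/-- The graph after one step: node `u` and its edges are removed, edges between survivors are
kept, and the new node (now labelled `u`) is joined to the survivors it is linked to. -/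
def nextGraph (α β : ℝ) {n m : ℕ} (s : State n m) (ω : Innovation n m) :
    SimpleGraph (Fin n) where
  Adj a b := a ≠ b ∧
    ((a ≠ ω.1 ∧ b ≠ ω.1 ∧ s.2.2.Adj a b) ∨
      (a = ω.1 ∧ Linked α β s ω b) ∨ (b = ω.1 ∧ Linked α β s ω a))
  symm := ⟨by
    rintro a b ⟨hab, h⟩
    refine ⟨hab.symm, ?_⟩
    rcases h with ⟨h1, h2, h3⟩ | h | h
    · exact Or.inl ⟨h2, h1, h3.symm⟩
    · exact Or.inr (Or.inr h)
    · exact Or.inr (Or.inl h)⟩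
  loopless := ⟨fun _ h => h.1 rfl⟩

/-- One step of the chain. -/
noncomputable def step (α β : ℝ) {n m : ℕ} (s : State n m) (ω : Innovation n m) : State n m :=
  (Function.update s.1 ω.1 ω.2.1,
    s.2.1.trans (rankUpdate (s.2.1 ω.1) ω.2.2.1),
    nextGraph α β s ω)

theorem measurable_step (α β : ℝ) (n m : ℕ) :
    Measurable fun z : State n m × Innovation n m => step α β z.1 z.2 := by
  have hu : Measurable fun z : State n m × Innovation n m => z.2.1 := by fun_prop
  have hρ : Measurable fun z : State n m × Innovation n m => z.1.2.1 := by fun_prop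
  have hx (i : Fin n) : Measurable fun z : State n m × Innovation n m => z.1.1 i := by fun_prop
  have hy : Measurable fun z : State n m × Innovation n m => z.2.2.1 := by fun_prop
  have hR : Measurable fun z : State n m × Innovation n m => z.2.2.2.1 := by fun_prop
  have hc (w : Fin n) : Measurable fun z : State n m × Innovation n m => z.2.2.2.2 w := by
    fun_prop
  have hl (w : Fin n) : MeasurableSet
      {z : State n m × Innovation n m | Linked α β z.1 z.2 w} := by
    refine MeasurableSet.inter ?_ (hc w (MeasurableSet.singleton true))
    have hr : Measurable fun z : State n m × Innovation n m =>
        influenceVolume α β n ((z.1.2.1 w : ℕ) + 1) ^ (1 / (m : ℝ)) / 2 :=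
      (Measurable.of_discrete (f := fun ρ : Equiv.Perm (Fin n) =>
        influenceVolume α β n ((ρ w : ℕ) + 1) ^ (1 / (m : ℝ)) / 2)).comp hρ
    exact measurableSet_le (hy.dist (hx w)) hr
  have he (a : Fin n) : MeasurableSet {z : State n m × Innovation n m | a = z.2.1} :=
    hu (MeasurableSet.of_discrete (s := {b | a = b}))
  have hG : Measurable fun z : State n m × Innovation n m => z.1.2.2 := by fun_prop
  refine Measurable.prodMk ?_ (Measurable.prodMk ?_ ?_)
  · refine measurable_pi_iff.2 fun i => ?_
    simp only [Function.update_apply]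
    exact Measurable.ite (he i) hy (hx i)
  · exact (Measurable.of_discrete (f := fun t : Equiv.Perm (Fin n) × Fin n × Fin n =>
      t.1.trans (rankUpdate (t.1 t.2.1) t.2.2))).comp (hρ.prodMk (hu.prodMk hR))
  · refine SimpleGraph.measurable_iff_adj.2 fun a b => measurableSet_setOfPred.1 ?_
    have hA : MeasurableSet {z : State n m × Innovation n m | z.1.2.2.Adj a b} :=
      measurableSet_setOfPred.2 (SimpleGraph.measurable_iff_adj.1 hG a b)
    exact (MeasurableSet.const (a ≠ b)).inter
      (((he a).compl.inter ((he b).compl.inter hA)).union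
        (((he a).inter (hl b)).union ((he b).inter (hl a))))

/-- The transition kernel of the geo-protean Markov chain. -/
noncomputable def transition (α β : ℝ) (p : unitInterval) (n m : ℕ) :
    Kernel (State n m) (State n m) :=
  (Kernel.id ×ₖ Kernel.const (State n m) (innovationLaw p n m)).map
    fun z => step α β z.1 z.2

/-- `μ` is the law of the geo-protean graph `GEO-P(α, β, m, p)` on `n` nodes: the law of the graph
under a stationary distribution of the chain. -/
def IsGeoP (α β : ℝ) (p : unitInterval) (n m : ℕ) (μ : Measure (SimpleGraph (Fin n))) : Prop :=
  ∃ π : Measure (State n m), IsProbabilityMeasure π ∧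
    (transition α β p n m).Invariant π ∧ μ = π.map fun s => s.2.2

/-- With extreme probability the graph `GEO-P(α, β, m n, p)` on `n` nodes belongs to `E n`:
the probability is at least `1 - exp (-c log² n)` for all large `n`, with a constant `c > 0`. -/
def WithExtremeProbability (α β : ℝ) (p : unitInterval) (m : ℕ → ℕ)
    (E : (n : ℕ) → Set (SimpleGraph (Fin n))) : Prop :=
  ∃ c : ℝ, 0 < c ∧ ∀ᶠ n : ℕ in atTop, ∀ μ : Measure (SimpleGraph (Fin n)),
    IsGeoP α β p n (m n) μ → 1 - Real.exp (-(c * Real.log n ^ 2)) ≤ μ.real (E n)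

/-- The largest even integer that is at most `x` (for `x ≥ 0`). -/
noncomputable def floorEven (x : ℝ) : ℕ := 2 * ⌊x / 2⌋₊

/-- `K`, the largest even integer that is at most `(n ^ (1 - α - β) / log³ n) ^ (1 / m)`. -/
noncomputable def gridSize (α β : ℝ) (n m : ℕ) : ℕ :=
  floorEven (((n : ℝ) ^ (1 - α - β) / Real.log n ^ 3) ^ (1 / (m : ℝ)))

end GeoP

/-! ### Exponential moments along an ordered family of independent coordinates -/

/-! Run the chain from a stationary state for T = n⌊√n⌋ steps; the law of the graph does not change.
Up to a stretched exponential error every node has been replaced by then, so the initial graph is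
forgotten: a link between an older node i and a younger node j was decided at the last birth of j,
by the two positions, a coin of j and the rank of i at that moment (`run_graph_eq`). Ranks are
driven by the deletions and initial ranks alone. Given these, positions and coins of the n nodes are
independent, and the graph is a random graph along a fixed schedule (`measureReal_run_graph_le`).

With high probability the schedule is regular (`RegularSchedule`). Insertions and deletions move a
rank up and down at equal rates up to O(1/n), so an exponential supermartingale keeps each rank
within εδn of its birth rank (`measureReal_exists_rank_drift_le`). Given the deletions, birth ranks
are independent and uniform, so in units of u = n^(-α-β) the influences of the nodes older than v
add up to about Q = 1/(1-α) times their number. Influence is truncated at relative rank δ, which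
makes it bounded and stable under small drifts.

Fix v of relative birth rank y ≥ 2δ, with o older and w younger nodes, and put P = y^(-α). Its
expected degree is about p u (Qo + Pw). Let i be older than j. The triangle v, i, j needs three
different coins, and two of its links are decided by the cube of the older of v and i, while the
third cube has volume at least u. In one coordinate two intervals of length σ at distance a overlap
in length σ - |a|; averaging over |a| ≤ η/2 with η ≤ σ keeps at least 3/4 of σ, and the sup metric
turns this into (3/4)^m (`torus_overlap_wide`, `torus_overlap_narrow`). Summing over pairs, twice
the number of edges among the neighbours is at least about p³ (3/4)^m u² (Qo² + 2Qow + Pw²).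
Dividing by the squared degree leaves c(v) ≥ p (3/4)^m min(1/P, 1/Q), up to small errors. The degree
concentrates by Chernoff's inequality, the edge count by revealing the nodes in birth order
(`measureReal_quadratic_tail`).

The average of min(y^α, 1-α) over uniform y is at least (1-α) - α(1-α)/(2α+1), which strictly
exceeds (1-α)/(1+α). This constant slack absorbs every error, so the bound holds without the 1+o(1)
and without the factor 1 - 2/(3K) < 1. In the tail bounds K ≥ 2 serves only to ensure n^(1-α-β)
(3/4)^m ≥ n^((1-α-β)/2), so that the failure probabilities are tiny.

For the binomial graph, the edges inside a neighbourhood are independent of that neighbourhood, so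
the expected clustering is at most the edge probability. Stationarity balances deleted and inserted
edges, whence d ≤ Q n^(1-α-β) and d/n = O(n^(-α-β)). For m = O(log n / log log n) this is far below
(3/4)^m = n^(-o(1)). -/

section Sequential

variable {ι : Type*} [Fintype ι] [DecidableEq ι] {Ω : ι → Type*} [∀ i, MeasurableSpace (Ω i)]
  {μ : ∀ i, Measure (Ω i)} [∀ i, IsProbabilityMeasure (μ i)]

-- Integrate out the coordinates from the latest to the earliest. When coordinate i is integrated,
-- all factors of smaller τ are constant in it by `hdep`, and the factor of i itself integrates to
-- at most 1. This is the supermartingale property, with τ as time.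
open Classical in
theorem lintegral_prod_le_one_of_sequential {τ : ι → ℕ} (hτ : Function.Injective τ)
    {F : ι → (∀ i, Ω i) → ENNReal} (hF : ∀ j, Measurable (F j))
    (hdep : ∀ i j, τ j < τ i → ∀ x y, F j (Function.update x i y) = F j x)
    (hone : ∀ j x, ∫⁻ y, F j (Function.update x j y) ∂μ j ≤ 1) :
    ∫⁻ x, ∏ j, F j x ∂(Measure.pi μ) ≤ 1 := by
  have hmeas (s : Finset ι) : Measurable fun x => ∏ j ∈ s, F j x :=
    Finset.measurable_prod _ fun j _ => hF j
  have key : ∀ N : ℕ, ∀ s : Finset ι, (∀ j ∈ s, τ j < N) → ∀ x,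
      (∫⋯∫⁻_s, (fun x => ∏ j ∈ s, F j x) ∂μ) x ≤ 1 := by
    intro N
    induction N with
    | zero =>
      intro s hs x
      have : s = ∅ := Finset.eq_empty_of_forall_notMem fun j hj => by simpa using hs j hj
      subst this
      simp
    | succ N ih =>
      intro s hs x
      by_cases h : ∃ i ∈ s, τ i = N
      · obtain ⟨i, his, hi⟩ := h
        have hlt : ∀ j ∈ s.erase i, τ j < N := by
          intro j hj
          have h1 := hs j (Finset.mem_of_mem_erase hj)
          have h2 : τ j ≠ N := fun h => Finset.ne_of_mem_erase hj (hτ (h.trans hi.symm))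
          omega
        have := ih (s.erase i) hlt x
        refine le_trans ?_ this
        conv_lhs => rw [← Finset.insert_erase his]
        rw [lmarginal_insert' _ (hmeas _) (Finset.notMem_erase i s)]
        refine lmarginal_mono (fun z => ?_) x
        calc ∫⁻ y, ∏ j ∈ insert i (s.erase i), F j (Function.update z i y) ∂μ i
            = ∫⁻ y, (∏ j ∈ s.erase i, F j z) * F i (Function.update z i y) ∂μ i := by
              refine lintegral_congr fun y => ?_
              rw [Finset.prod_insert (Finset.notMem_erase i s), mul_comm]
              congr 1
              exact Finset.prod_congr rfl fun j hj => hdep i j (hi ▸ hlt j hj) z y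
          _ = (∏ j ∈ s.erase i, F j z) * ∫⁻ y, F i (Function.update z i y) ∂μ i :=
              lintegral_const_mul _ ((hF i).comp (measurable_update z))
          _ ≤ (∏ j ∈ s.erase i, F j z) * 1 := by gcongr; exact hone i z
          _ = _ := mul_one _
      · refine ih s (fun j hj => ?_) x
        have h1 := hs j hj
        have h2 : τ j ≠ N := fun h' => h ⟨j, hj, h'⟩
        omega
  have : ∀ i, Nonempty (Ω i) := fun i => (μ i).nonempty_of_neZero
  let x₀ : ∀ i, Ω i := fun i => Classical.choice (this i)
  rw [lintegral_eq_lmarginal_univ x₀]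
  exact key (∑ i, τ i + 1) Finset.univ (fun j _ => Nat.lt_succ_of_le
    (Finset.single_le_sum (f := τ) (fun _ _ => Nat.zero_le _) (Finset.mem_univ j))) x₀

/-- Markov's inequality for the exponential of a sum whose terms have sequential exponential
moments at most `1`. -/
theorem measureReal_le_exp_of_sequential {τ : ι → ℕ} (hτ : Function.Injective τ)
    {φ : ι → (∀ i, Ω i) → ℝ} (hφ : ∀ j, Measurable (φ j))
    (hdep : ∀ i j, τ j < τ i → ∀ x y, φ j (Function.update x i y) = φ j x)
    (hone : ∀ j x, ∫⁻ y, ENNReal.ofReal (Real.exp (φ j (Function.update x j y))) ∂μ j ≤ 1)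
    (L : ℝ) {S : Set (∀ i, Ω i)} (hS : ∀ x ∈ S, L ≤ ∑ j, φ j x) :
    (Measure.pi μ).real S ≤ Real.exp (-L) := by
  have h1 : ∫⁻ x, ∏ j, ENNReal.ofReal (Real.exp (φ j x)) ∂(Measure.pi μ) ≤ 1 :=
    lintegral_prod_le_one_of_sequential hτ
      (fun j => (Real.measurable_exp.comp (hφ j)).ennreal_ofReal)
      (fun i j h x y => by rw [hdep i j h]) hone
  have h2 : ∀ x, ∏ j, ENNReal.ofReal (Real.exp (φ j x))
      = ENNReal.ofReal (Real.exp (∑ j, φ j x)) := fun x => by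
    rw [← ENNReal.ofReal_prod_of_nonneg (fun _ _ => (Real.exp_pos _).le), Real.exp_sum]
  simp_rw [h2] at h1
  have hm : Measurable fun x => ENNReal.ofReal (Real.exp (∑ j, φ j x)) := by fun_prop
  have h3 : ENNReal.ofReal (Real.exp L) * (Measure.pi μ) S ≤ 1 := by
    refine le_trans ?_ h1
    refine le_trans ?_ (mul_meas_ge_le_lintegral₀ hm.aemeasurable (ENNReal.ofReal (Real.exp L)))
    gcongr
    intro x hx
    exact ENNReal.ofReal_le_ofReal (Real.exp_le_exp.2 (hS x hx))
  have h4 := ENNReal.toReal_mono ENNReal.one_ne_top h3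
  rw [ENNReal.toReal_mul, ENNReal.toReal_ofReal (Real.exp_pos _).le, ENNReal.toReal_one] at h4
  rw [Real.exp_neg, measureReal_def, ← one_div, le_div_iff₀ (Real.exp_pos _)]
  linarith

end Sequential

/-- The exponential lies below its chord on `[0, k]`. -/
theorem exp_mul_le_chord {k w : ℝ} (θ : ℝ) (hk : 0 < k) (h0 : 0 ≤ w) (h1 : w ≤ k) :
    Real.exp (θ * w) ≤ 1 + (Real.exp (θ * k) - 1) / k * w := by
  have hw : 0 ≤ 1 - w / k := by rw [sub_nonneg, div_le_one hk]; exact h1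
  have h := convexOn_exp.2 (Set.mem_univ (0 : ℝ)) (Set.mem_univ (θ * k)) hw
    (div_nonneg h0 hk.le) (by ring)
  have e : (1 - w / k) • (0 : ℝ) + (w / k) • (θ * k) = θ * w := by
    simp only [smul_eq_mul]; field_simp; ring
  rw [e] at h
  simp only [smul_eq_mul, Real.exp_zero] at h
  calc _ ≤ _ := h
    _ = _ := by field_simp; ring

/-- A random variable with values in `[0, k]` has the exponential moment bound used in Chernoff's
inequality, at every `θ` of either sign. -/
theorem lintegral_exp_le_one {Ω : Type*} [MeasurableSpace Ω] {ν : Measure Ω}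
    [IsProbabilityMeasure ν] {W : Ω → ℝ} (hW : Measurable W) {k : ℝ} (θ : ℝ) (hk : 0 < k)
    (h0 : ∀ x, 0 ≤ W x) (h1 : ∀ x, W x ≤ k) :
    ∫⁻ x, ENNReal.ofReal (Real.exp (θ * W x - (Real.exp (θ * k) - 1) / k * ∫ y, W y ∂ν)) ∂ν
      ≤ 1 := by
  set κ := (Real.exp (θ * k) - 1) / k
  have hint : Integrable W ν := by
    refine Integrable.of_bound hW.aestronglyMeasurable k (ae_of_all _ fun x => ?_)
    rw [Real.norm_eq_abs, abs_of_nonneg (h0 x)]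
    exact h1 x
  set I := ∫ y, W y ∂ν
  have h2 : ∀ x, Real.exp (θ * W x - κ * I) ≤ (1 + κ * W x) * Real.exp (-(κ * I)) := fun x => by
    rw [sub_eq_add_neg, Real.exp_add]
    gcongr
    exact exp_mul_le_chord θ hk (h0 x) (h1 x)
  have hint2 : Integrable (fun x => (1 + κ * W x) * Real.exp (-(κ * I))) ν :=
    ((integrable_const 1).add (hint.const_mul κ)).mul_const _
  calc _ ≤ ∫⁻ x, ENNReal.ofReal ((1 + κ * W x) * Real.exp (-(κ * I))) ∂ν :=
        lintegral_mono fun x => ENNReal.ofReal_le_ofReal (h2 x)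
    _ = ENNReal.ofReal (∫ x, (1 + κ * W x) * Real.exp (-(κ * I)) ∂ν) := by
        rw [ofReal_integral_eq_lintegral_ofReal hint2]
        exact ae_of_all _ fun x => (Real.exp_pos _).le.trans (h2 x)
    _ = ENNReal.ofReal ((1 + κ * I) * Real.exp (-(κ * I))) := by
        rw [integral_mul_const, integral_add (integrable_const 1) (hint.const_mul κ),
          integral_const_mul]
        simp
        rfl
    _ ≤ 1 := by
        rw [ENNReal.ofReal_le_one, Real.exp_neg, ← div_eq_mul_inv, div_le_one (Real.exp_pos _)]
        linarith [Real.add_one_le_exp (κ * I)]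

/-! ### Chernoff bounds for independent bounded variables -/

section Independent

variable {ι Ω : Type*} [Fintype ι] [DecidableEq ι] [MeasurableSpace Ω] {ν : Measure Ω}
  [IsProbabilityMeasure ν]

/-- Chernoff's inequality in exponential form, for independent variables with values
in `[0, k]`. -/
theorem measureReal_le_exp_of_independent {W : ι → Ω → ℝ} (hW : ∀ i, Measurable (W i)) {k : ℝ}
    (θ : ℝ) (hk : 0 < k) (h0 : ∀ i x, 0 ≤ W i x) (h1 : ∀ i x, W i x ≤ k) (L : ℝ)
    {S : Set (ι → Ω)}
    (hS : ∀ x ∈ S, L ≤ θ * ∑ i, W i (x i) - (Real.exp (θ * k) - 1) / k * ∑ i, ∫ y, W i y ∂ν) :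
    (Measure.pi fun _ : ι => ν).real S ≤ Real.exp (-L) := by
  let τ : ι → ℕ := fun i => (Fintype.equivFin ι i : ℕ)
  refine measureReal_le_exp_of_sequential (τ := τ)
    (φ := fun i x => θ * W i (x i) - (Real.exp (θ * k) - 1) / k * ∫ y, W i y ∂ν)
    (fun a b h => (Fintype.equivFin ι).injective (Fin.ext h)) ?_ ?_ ?_ L ?_
  · intro i
    have := (hW i).comp (measurable_pi_apply (X := fun _ : ι => Ω) i)
    exact (this.const_mul θ).sub_const _
  · intro i j h x y
    have : j ≠ i := by rintro rfl; exact lt_irrefl _ h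
    rw [Function.update_of_ne this]
  · intro j x
    simp only [Function.update_self]
    exact lintegral_exp_le_one (hW j) θ hk (h0 j) (h1 j)
  · intro x hx
    refine (hS x hx).trans (le_of_eq ?_)
    rw [Finset.sum_sub_distrib, ← Finset.mul_sum, ← Finset.mul_sum]

/-- Upper tail: a sum of independent `[0, 1]`-valued variables rarely exceeds a multiple
`1 + ε` of a bound on its mean. -/
theorem measureReal_sum_upper_tail {a : ι → Ω → ℝ} (ha : ∀ i, Measurable (a i))
    (h0 : ∀ i x, 0 ≤ a i x) (h1 : ∀ i x, a i x ≤ 1) {ε B : ℝ} (hε0 : 0 ≤ ε) (hε1 : ε ≤ 1)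
    (hB : ∑ i, ∫ y, a i y ∂ν ≤ B) :
    (Measure.pi fun _ : ι => ν).real {x | (1 + ε) * B < ∑ i, a i (x i)}
      ≤ Real.exp (-(ε ^ 2 * B / 4)) := by
  have hB0 : 0 ≤ B := le_trans (Finset.sum_nonneg fun i _ => integral_nonneg (h0 i)) hB
  -- With θ = ε/2 the exponent is at least (ε/2)(1+ε)B - (ε/2 + ε²/4)B = ε²B/4.
  refine measureReal_le_exp_of_independent ha (ε / 2) one_pos h0 h1 _ ?_
  intro x hx
  have hx' : (1 + ε) * B < ∑ i, a i (x i) := hx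
  have e1 : Real.exp (ε / 2) - 1 ≤ ε / 2 + (ε / 2) ^ 2 := by
    have := Real.abs_exp_sub_one_sub_id_le (x := ε / 2) (by rw [abs_of_nonneg] <;> linarith)
    linarith [le_abs_self (Real.exp (ε / 2) - 1 - ε / 2)]
  have e2 : 0 ≤ Real.exp (ε / 2) - 1 := by linarith [Real.add_one_le_exp (ε / 2)]
  have e3 : (Real.exp (ε / 2) - 1) * ∑ i, ∫ y, a i y ∂ν ≤ (ε / 2 + (ε / 2) ^ 2) * B :=
    mul_le_mul e1 hB (Finset.sum_nonneg fun i _ => integral_nonneg (h0 i)) (by positivity)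
  rw [mul_one, div_one]
  nlinarith

/-- Lower tail for independent `[0, k]`-valued variables. -/
theorem measureReal_sum_lower_tail {G : ι → Ω → ℝ} (hG : ∀ i, Measurable (G i)) {k : ℝ}
    (hk : 0 < k) (h0 : ∀ i x, 0 ≤ G i x) (h1 : ∀ i x, G i x ≤ k) {ε M : ℝ} (hε0 : 0 ≤ ε)
    (hε1 : ε ≤ 1) (hM : M ≤ ∑ i, ∫ y, G i y ∂ν) (hM0 : 0 ≤ M) :
    (Measure.pi fun _ : ι => ν).real {x | ∑ i, G i (x i) < (1 - ε) * M}
      ≤ Real.exp (-(ε ^ 2 * M / (2 * k))) := by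
  refine measureReal_le_exp_of_independent hG (-(ε / k)) hk h0 h1 _ ?_
  intro x hx
  have hx' : ∑ i, G i (x i) < (1 - ε) * M := hx
  have e0 : -(ε / k) * k = -ε := by field_simp
  -- This follows from e^ε ≥ 1 + ε + ε²/2 because (1 + ε + ε²/2)(1 - ε + ε²/2) = 1 + ε⁴/4 ≥ 1.
  have e1 : Real.exp (-ε) ≤ 1 - ε + ε ^ 2 / 2 := by
    have h := Real.quadratic_le_exp_of_nonneg hε0
    rw [Real.exp_neg, inv_le_comm₀ (Real.exp_pos _) (by nlinarith)]
    refine le_trans ?_ h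
    rw [inv_le_comm₀ (by nlinarith) (by positivity), ← one_div, div_le_iff₀ (by positivity)]
    nlinarith [pow_nonneg hε0 4]
  rw [e0]
  have e2 : (ε - ε ^ 2 / 2) / k * M ≤ -((Real.exp (-ε) - 1) / k * ∑ i, ∫ y, G i y ∂ν) := by
    rw [← neg_mul, ← neg_div]
    refine mul_le_mul ?_ hM hM0 ?_
    · gcongr; linarith
    · refine div_nonneg ?_ hk.le
      have : Real.exp (-ε) ≤ 1 := Real.exp_le_one_iff.2 (by linarith)
      linarith
  have e3 : ε / k * ∑ i, G i (x i) ≤ ε / k * ((1 - ε) * M) := by gcongr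
  have e4 : ε ^ 2 * M / (2 * k) = (ε - ε ^ 2 / 2) / k * M - ε / k * ((1 - ε) * M) := by
    field_simp; ring
  rw [e4]
  linarith

end Independent

/-! ### Lower tail of quadratic sums over ordered pairs of independent variables -/

section Quadratic

variable {ι Ω : Type*} [Fintype ι] [DecidableEq ι] [MeasurableSpace Ω] {ν : Measure Ω}
  [IsProbabilityMeasure ν]

theorem integrable_of_mem_unitInterval {f : Ω → ℝ} (hf : Measurable f) (h0 : ∀ x, 0 ≤ f x)
    (h1 : ∀ x, f x ≤ 1) : Integrable f ν := by
  refine Integrable.of_bound hf.aestronglyMeasurable 1 (ae_of_all _ fun x => ?_)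
  rw [Real.norm_eq_abs, abs_of_nonneg (h0 x)]
  exact h1 x

/-- The part of the quadratic tail bound in which the conditional means are large and the linear
sum is not too large. -/
theorem measureReal_quadratic_lower_tail_aux {τ : ι → ℕ} (hτ : Function.Injective τ)
    {a : ι → Ω → ℝ} {e : ι → ι → Ω → Ω → ℝ} (ha : ∀ i, Measurable (a i))
    (ha0 : ∀ i x, 0 ≤ a i x) (ha1 : ∀ i x, a i x ≤ 1)
    (he : ∀ i j, Measurable (Function.uncurry (e i j)))
    (he0 : ∀ i j x y, 0 ≤ e i j x y) (he1 : ∀ i j x y, e i j x y ≤ 1)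
    {ε k M : ℝ} (hε0 : 0 ≤ ε) (hε1 : ε ≤ 1) (hk : 0 < k) (hM : 0 ≤ M) :
    (Measure.pi fun _ : ι => ν).real {x | ∑ i, a i (x i) ≤ k ∧
      (1 - ε) * M ≤ ∑ j, ∑ i, (if τ i < τ j then
        a i (x i) * ∫ y, a j y * e i j (x i) y ∂ν else 0) ∧
      ∑ j, ∑ i, (if τ i < τ j then a i (x i) * a j (x j) * e i j (x i) (x j) else 0)
        < (1 - 2 * ε) * M} ≤ Real.exp (-(ε ^ 2 * M / (2 * k))) := by
  set θ : ℝ := -(ε / k) with hθ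
  set κ : ℝ := (Real.exp (θ * k) - 1) / k with hκ
  let C : ι → (ι → Ω) → ℝ := fun j x => ∑ i, if τ i < τ j then a i (x i) else 0
  let W : ι → (ι → Ω) → ℝ := fun j x =>
    ∑ i, if τ i < τ j then a i (x i) * a j (x j) * e i j (x i) (x j) else 0
  let H : ι → (ι → Ω) → ℝ := fun j x =>
    ∑ i, if τ i < τ j then a i (x i) * ∫ y, a j y * e i j (x i) y ∂ν else 0
  have hne : ∀ {i j : ι}, τ i < τ j → i ≠ j := fun h h' => by simp [h'] at h
  have hCm : ∀ j, Measurable (C j) := fun j => by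
    refine Finset.measurable_sum _ fun i _ => ?_
    split_ifs
    · exact (ha i).comp (measurable_pi_apply (X := fun _ : ι => Ω) i)
    · exact measurable_const
  have hev : ∀ i j, Measurable fun x : ι → Ω => e i j (x i) (x j) := fun i j =>
    (he i j).comp ((measurable_pi_apply (X := fun _ : ι => Ω) i).prodMk
      (measurable_pi_apply (X := fun _ : ι => Ω) j))
  have hav : ∀ i, Measurable fun x : ι → Ω => a i (x i) := fun i =>
    (ha i).comp (measurable_pi_apply (X := fun _ : ι => Ω) i)
  have hWm : ∀ j, Measurable (W j) := fun j => by
    refine Finset.measurable_sum _ fun i _ => ?_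
    split_ifs
    · exact ((hav i).mul (hav j)).mul (hev i j)
    · exact measurable_const
  have hint : ∀ i j, Measurable fun z => ∫ y, a j y * e i j z y ∂ν := fun i j => by
    have : Measurable (Function.uncurry fun z y => a j y * e i j z y) :=
      ((ha j).comp measurable_snd).mul (he i j)
    exact this.stronglyMeasurable.integral_prod_right.measurable
  have hHm : ∀ j, Measurable (H j) := fun j => by
    refine Finset.measurable_sum _ fun i _ => ?_
    split_ifs
    · exact (hav i).mul ((hint i j).comp (measurable_pi_apply (X := fun _ : ι => Ω) i))
    · exact measurable_const
  -- The increment `W j` has conditional mean `H j` given the earlier coordinates and is at most `C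
  -- j`. Switching the term off when `C j > k` is a decision based on earlier coordinates only, and
  -- it keeps the active increments in [0, k]. On the event in question no term is switched off.
  refine measureReal_le_exp_of_sequential hτ
    (φ := fun j x => if C j x ≤ k then θ * W j x - κ * H j x else 0) ?_ ?_ ?_ _ ?_
  · intro j
    exact Measurable.ite (measurableSet_le (hCm j) measurable_const)
      (((hWm j).const_mul θ).sub ((hHm j).const_mul κ)) measurable_const
  · intro i j hij x y
    have h2 : Function.update x i y j = x j := Function.update_of_ne (hne hij) _ _
    have h3 : ∀ l, τ l < τ j → Function.update x i y l = x l := fun l hl =>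
      Function.update_of_ne (hne (hl.trans hij)) _ _
    have hC : C j (Function.update x i y) = C j x :=
      Finset.sum_congr rfl fun l _ => by split_ifs with hl <;> simp [h3 l, hl]
    have hW : W j (Function.update x i y) = W j x :=
      Finset.sum_congr rfl fun l _ => by split_ifs with hl <;> simp [h3 l, hl, h2]
    have hH : H j (Function.update x i y) = H j x :=
      Finset.sum_congr rfl fun l _ => by split_ifs with hl <;> simp [h3 l, hl]
    simp only [hC, hW, hH]
  · intro j x
    have h3 : ∀ y, ∀ l, τ l < τ j → Function.update x j y l = x l := fun y l hl =>
      Function.update_of_ne (hne hl) _ _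
    have hC : ∀ y, C j (Function.update x j y) = C j x := fun y =>
      Finset.sum_congr rfl fun l _ => by split_ifs with hl <;> simp [h3 y l, hl]
    have hH : ∀ y, H j (Function.update x j y) = H j x := fun y =>
      Finset.sum_congr rfl fun l _ => by split_ifs with hl <;> simp [h3 y l, hl]
    let w : Ω → ℝ := fun y => ∑ i, if τ i < τ j then a i (x i) * a j y * e i j (x i) y else 0
    have hW : ∀ y, W j (Function.update x j y) = w y := fun y =>
      Finset.sum_congr rfl fun l _ => by split_ifs with hl <;> simp [h3 y l, hl]
    simp only [hC, hH, hW]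
    by_cases hcap : C j x ≤ k
    · simp only [hcap, if_true]
      have hez : ∀ i, Measurable fun y => e i j (x i) y := fun i =>
        (he i j).comp measurable_prodMk_left
      have hwm : Measurable w := by
        refine Finset.measurable_sum _ fun i _ => ?_
        split_ifs
        · exact ((ha j).const_mul _).mul (hez i)
        · exact measurable_const
      have hterm : ∀ i y, 0 ≤ a i (x i) * a j y * e i j (x i) y := fun i y =>
        mul_nonneg (mul_nonneg (ha0 _ _) (ha0 _ _)) (he0 _ _ _ _)
      have hterm1 : ∀ i y, a i (x i) * a j y * e i j (x i) y ≤ a i (x i) := fun i y => by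
        rw [mul_assoc]
        exact mul_le_of_le_one_right (ha0 _ _)
          (mul_le_one₀ (ha1 _ _) (he0 _ _ _ _) (he1 _ _ _ _))
      have hw : ∫ y, w y ∂ν = H j x := by
        simp only [w, H]
        rw [integral_finsetSum]
        · refine Finset.sum_congr rfl fun i _ => ?_
          split_ifs
          · rw [← integral_const_mul]
            simp only [mul_assoc]
          · simp
        · intro i _
          split_ifs
          · exact integrable_of_mem_unitInterval (((ha j).const_mul _).mul (hez i)) (hterm i)
              fun y => (hterm1 i y).trans (ha1 _ _)
          · exact integrable_zero _ _ _
      rw [← hw]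
      refine lintegral_exp_le_one hwm θ hk (fun y => Finset.sum_nonneg fun i _ => ?_)
        (fun y => le_trans (Finset.sum_le_sum fun i _ => ?_) hcap)
      · split_ifs
        · exact hterm i y
        · exact le_rfl
      · split_ifs
        · exact hterm1 i y
        · exact le_rfl
    · simp [hcap]
  · rintro x ⟨hx1, hx2, hx3⟩
    have hcap : ∀ j, C j x ≤ k := fun j => by
      refine le_trans (Finset.sum_le_sum fun i _ => ?_) hx1
      split_ifs
      · exact le_rfl
      · exact ha0 _ _
    simp only [hcap, if_true, Finset.sum_sub_distrib, ← Finset.mul_sum]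
    change (1 - ε) * M ≤ ∑ j, H j x at hx2
    change ∑ j, W j x < _ at hx3
    have e0 : θ * k = -ε := by rw [hθ]; field_simp
    have e1 : Real.exp (-ε) ≤ 1 - ε + ε ^ 2 / 2 := by
      have h := Real.quadratic_le_exp_of_nonneg hε0
      rw [Real.exp_neg, inv_le_comm₀ (Real.exp_pos _) (by nlinarith)]
      refine le_trans ?_ h
      rw [inv_le_comm₀ (by nlinarith) (by positivity), ← one_div, div_le_iff₀ (by positivity)]
      nlinarith [pow_nonneg hε0 4]
    have e2 : (ε - ε ^ 2 / 2) / k * ((1 - ε) * M) ≤ -κ * ∑ j, H j x := by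
      refine mul_le_mul ?_ hx2 (mul_nonneg (by linarith) hM) ?_
      · rw [hκ, e0, ← neg_div]
        gcongr; linarith
      · rw [hκ, e0, ← neg_div]
        refine div_nonneg ?_ hk.le
        have : Real.exp (-ε) ≤ 1 := Real.exp_le_one_iff.2 (by linarith)
        linarith
    have e3 : ε / k * ∑ j, W j x ≤ ε / k * ((1 - 2 * ε) * M) := by gcongr
    have e4 : ε ^ 2 * M / (2 * k) + ε ^ 3 * M / (2 * k)
        = (ε - ε ^ 2 / 2) / k * ((1 - ε) * M) - ε / k * ((1 - 2 * ε) * M) := by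
      field_simp; ring
    have e5 : 0 ≤ ε ^ 3 * M / (2 * k) := by positivity
    rw [hθ]
    linarith

/-- Concentration of a sum over ordered pairs of independent variables: both the linear sum is not
much larger, and the quadratic sum is not much smaller, than expected. -/
theorem measureReal_quadratic_tail {τ : ι → ℕ} (hτ : Function.Injective τ)
    {a : ι → Ω → ℝ} {e : ι → ι → Ω → Ω → ℝ} (ha : ∀ i, Measurable (a i))
    (ha0 : ∀ i x, 0 ≤ a i x) (ha1 : ∀ i x, a i x ≤ 1)
    (he : ∀ i j, Measurable (Function.uncurry (e i j)))
    (he0 : ∀ i j x y, 0 ≤ e i j x y) (he1 : ∀ i j x y, e i j x y ≤ 1)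
    {ε B M : ℝ} (hε0 : 0 ≤ ε) (hε1 : ε ≤ 1) (hB0 : 0 < B) (hM0 : 0 ≤ M)
    (hB : ∑ i, ∫ y, a i y ∂ν ≤ B)
    (hM : M ≤ ∑ j, ∑ i, if τ i < τ j then
      ∫ x, a i x * ∫ y, a j y * e i j x y ∂ν ∂ν else 0) :
    (Measure.pi fun _ : ι => ν).real {x | ¬ (∑ i, a i (x i) ≤ (1 + ε) * B ∧
      (1 - 2 * ε) * M ≤
      ∑ j, ∑ i, if τ i < τ j then a i (x i) * a j (x j) * e i j (x i) (x j) else 0)}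
    ≤ Real.exp (-(ε ^ 2 * B / 4)) + 2 * Real.exp (-(ε ^ 2 * M / (4 * B))) := by
  have hint : ∀ i j, Measurable fun z => ∫ y, a j y * e i j z y ∂ν := fun i j => by
    have : Measurable (Function.uncurry fun z y => a j y * e i j z y) :=
      ((ha j).comp measurable_snd).mul (he i j)
    exact this.stronglyMeasurable.integral_prod_right.measurable
  have hez : ∀ i j z, Measurable fun y => e i j z y := fun i j z =>
    (he i j).comp measurable_prodMk_left
  have hh0 : ∀ i j z, 0 ≤ ∫ y, a j y * e i j z y ∂ν := fun i j z =>
    integral_nonneg fun y => mul_nonneg (ha0 _ _) (he0 _ _ _ _)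
  have hh1 : ∀ i j z, ∫ y, a j y * e i j z y ∂ν ≤ ∫ y, a j y ∂ν := fun i j z => by
    refine integral_mono (integrable_of_mem_unitInterval ((ha j).mul (hez i j z))
      (fun y => mul_nonneg (ha0 _ _) (he0 _ _ _ _))
      (fun y => mul_le_one₀ (ha1 _ _) (he0 _ _ _ _) (he1 _ _ _ _)))
      (integrable_of_mem_unitInterval (ha j) (ha0 j) (ha1 j)) fun y => ?_
    exact mul_le_of_le_one_right (ha0 _ _) (he1 _ _ _ _)
  have ha2 : ∀ j, ∫ y, a j y ∂ν ≤ 1 := fun j => by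
    calc ∫ y, a j y ∂ν ≤ ∫ _, (1 : ℝ) ∂ν :=
          integral_mono (integrable_of_mem_unitInterval (ha j) (ha0 j) (ha1 j))
            (integrable_const 1) (ha1 j)
      _ = 1 := by simp
  -- With the sums interchanged, the total of the conditional means becomes a sum of independent
  -- terms `G i (x i)`, each at most B because `a i ≤ 1` and the inner integral is at most the mean
  -- of `a j`. So the linear lower tail controls it.
  let G : ι → Ω → ℝ := fun i z =>
    ∑ j, if τ i < τ j then a i z * ∫ y, a j y * e i j z y ∂ν else 0
  have hGm : ∀ i, Measurable (G i) := fun i => by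
    refine Finset.measurable_sum _ fun j _ => ?_
    split_ifs
    · exact (ha i).mul (hint i j)
    · exact measurable_const
  have hG0 : ∀ i z, 0 ≤ G i z := fun i z => Finset.sum_nonneg fun j _ => by
    split_ifs
    · exact mul_nonneg (ha0 _ _) (hh0 _ _ _)
    · exact le_rfl
  have hG1 : ∀ i z, G i z ≤ B := fun i z => by
    refine le_trans (Finset.sum_le_sum fun j _ => ?_) hB
    split_ifs
    · exact (mul_le_of_le_one_left (hh0 _ _ _) (ha1 _ _)).trans (hh1 _ _ _)
    · exact integral_nonneg (ha0 j)
  have hGM : M ≤ ∑ i, ∫ z, G i z ∂ν := by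
    refine hM.trans (le_of_eq ?_)
    rw [Finset.sum_comm]
    refine Finset.sum_congr rfl fun i _ => ?_
    simp only [G]
    rw [integral_finsetSum]
    · refine Finset.sum_congr rfl fun j _ => ?_
      split_ifs <;> simp
    · intro j _
      split_ifs
      · exact integrable_of_mem_unitInterval ((ha i).mul (hint i j))
          (fun z => mul_nonneg (ha0 _ _) (hh0 _ _ _))
          (fun z => mul_le_one₀ (ha1 _ _) (hh0 _ _ _) ((hh1 i j z).trans (ha2 j)))
      · exact integrable_zero _ _ _
  have t1 := measureReal_sum_upper_tail (ν := ν) ha ha0 ha1 hε0 hε1 hB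
  have t2 := measureReal_sum_lower_tail (ν := ν) hGm hB0 hG0 hG1 hε0 hε1 hGM hM0
  -- The cap (1+ε)B is what the upper tail of the linear sum guarantees; being at most 2B, it
  -- accounts for the 4B in the final exponent.
  have t3 := measureReal_quadratic_lower_tail_aux (ν := ν) hτ ha ha0 ha1 he he0 he1 hε0 hε1
    (k := (1 + ε) * B) (by positivity) hM0
  have c2 : Real.exp (-(ε ^ 2 * M / (2 * B))) ≤ Real.exp (-(ε ^ 2 * M / (4 * B))) := by
    refine Real.exp_le_exp.2 (neg_le_neg ?_)
    refine div_le_div_of_nonneg_left (by positivity) (by positivity) (by linarith)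
  have c3 : Real.exp (-(ε ^ 2 * M / (2 * ((1 + ε) * B)))) ≤
      Real.exp (-(ε ^ 2 * M / (4 * B))) := by
    refine Real.exp_le_exp.2 (neg_le_neg ?_)
    refine div_le_div_of_nonneg_left (by positivity) (by positivity) (by nlinarith)
  refine le_trans (measureReal_mono (fun x hx => ?_) (measure_ne_top _ _))
    ((measureReal_union_le _ _).trans (add_le_add t1 ((measureReal_union_le _ _).trans
      ((add_le_add (t2.trans c2) (t3.trans c3)).trans (le_of_eq (two_mul _).symm)))))
  by_contra hcon
  simp only [Set.mem_union, Set.mem_ofPred_eq, not_or, not_and, not_lt] at hcon hx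
  obtain ⟨h1, h2, h3⟩ := hcon
  refine hx h1 (h3 h1 (h2.trans (le_of_eq ?_)))
  rw [Finset.sum_comm]

end Quadratic

/-! ### Overlaps of cubes in the torus -/

namespace GeoP

theorem norm_coe_le_abs (t : ℝ) : ‖(t : UnitAddCircle)‖ ≤ |t| := by
  rw [UnitAddCircle.norm_eq]
  simpa using round_le t 0

theorem exists_real_lift (x : UnitAddCircle) : ∃ t : ℝ, (t : UnitAddCircle) = x ∧ |t| = ‖x‖ := by
  obtain ⟨t, rfl⟩ := QuotientAddGroup.mk_surjective x
  refine ⟨t - round t, ?_, ?_⟩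
  · have : ((round t : ℝ) : UnitAddCircle) = 0 := by
      have := AddCircle.coe_eq_zero_iff (p := (1 : ℝ)) (x := (round t : ℝ))
      exact this.2 ⟨round t, by simp⟩
    rw [AddCircle.coe_sub, this, sub_zero]
  · exact (UnitAddCircle.norm_eq).symm

/-- The intersection contains the ball of diameter s - d around the midpoint of a shortest arc from
x to y. If d > s the left side is 0 by the convention of `ENNReal.ofReal`. -/
theorem le_volume_closedBall_inter (x y : UnitAddCircle) {s : ℝ} (hs : s ≤ 1) :
    ENNReal.ofReal (s - dist x y) ≤
      volume (Metric.closedBall x (s / 2) ∩ Metric.closedBall y (s / 2)) := by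
  obtain ⟨t, ht, htn⟩ := exists_real_lift (y - x)
  have hd : dist x y = |t| := by rw [htn, dist_comm, dist_eq_norm]
  have h2 : ‖((t / 2 : ℝ) : UnitAddCircle)‖ ≤ |t| / 2 := by
    refine (norm_coe_le_abs _).trans (le_of_eq ?_)
    rw [abs_div, abs_two]
  have hy : y = x + ((t / 2 : ℝ) : UnitAddCircle) + ((t / 2 : ℝ) : UnitAddCircle) := by
    rw [add_assoc, ← AddCircle.coe_add, add_halves, ht]; abel
  have hsub : Metric.closedBall (x + ((t / 2 : ℝ) : UnitAddCircle)) ((s - dist x y) / 2) ⊆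
      Metric.closedBall x (s / 2) ∩ Metric.closedBall y (s / 2) := by
    refine Set.subset_inter (Metric.closedBall_subset_closedBall' ?_)
      (Metric.closedBall_subset_closedBall' ?_)
    · rw [hd, dist_eq_norm, add_sub_cancel_left]; linarith
    · rw [hd, dist_comm, dist_eq_norm]
      nth_rw 1 [hy]
      rw [add_sub_cancel_left]; linarith
  refine le_trans (le_of_eq ?_) (measure_mono hsub)
  rw [AddCircle.volume_closedBall, mul_div_cancel₀ _ two_ne_zero, min_eq_right]
  linarith [dist_nonneg (x := x) (y := y)]

theorem integral_sub_abs {σ c : ℝ} (hc : 0 ≤ c) :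
    ∫ a in (-c)..c, (σ - |a|) = 2 * c * σ - c ^ 2 := by
  have h1 : ∫ a in (0 : ℝ)..c, (σ - |a|) = c * σ - c ^ 2 / 2 := by
    rw [intervalIntegral.integral_congr (g := fun a => σ - a) fun a ha => ?_]
    · rw [intervalIntegral.integral_sub (by simp) (by simp)]
      simp
    · rw [Set.uIcc_of_le hc] at ha
      simp [abs_of_nonneg ha.1]
  have h2 : ∫ a in (-c)..0, (σ - |a|) = c * σ - c ^ 2 / 2 := by
    rw [← h1]
    have := intervalIntegral.integral_comp_neg (a := -c) (b := 0) (fun a : ℝ => σ - |a|)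
    simpa using this
  have hi : ∀ a b : ℝ, IntervalIntegrable (fun a : ℝ => σ - |a|) volume a b := fun a b =>
    (by fun_prop : Continuous fun a : ℝ => σ - |a|).intervalIntegrable a b
  rw [← intervalIntegral.integral_add_adjacent_intervals (hi (-c) 0) (hi 0 c), h1, h2]
  ring

/-- The origin of the constant 3/4: the integral of σ - |a| over |a| ≤ η/2 equals ση - η²/4, and η ≤
σ. Translation invariance moves the centre to 0, where the ball is unrolled into the fundamental
domain (-1/2, 1/2]. -/
theorem le_setLIntegral_closedBall (x : UnitAddCircle) {σ η : ℝ} (hη : 0 ≤ η) (hησ : η ≤ σ)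
    (hσ : σ ≤ 1) :
    ENNReal.ofReal (3 / 4 * (σ * η)) ≤
      ∫⁻ v in Metric.closedBall x (η / 2), ENNReal.ofReal (σ - dist x v) := by
  let f : UnitAddCircle → ENNReal := fun w =>
    (Metric.closedBall (0 : UnitAddCircle) (η / 2)).indicator
      (fun w => ENNReal.ofReal (σ - ‖w‖)) w
  have e1 : ∫⁻ v in Metric.closedBall x (η / 2), ENNReal.ofReal (σ - dist x v) = ∫⁻ w, f w := by
    rw [← lintegral_indicator Metric.isClosed_closedBall.measurableSet,
      ← lintegral_add_left_eq_self _ x]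
    refine lintegral_congr fun w => ?_
    have h1 : x + w ∈ Metric.closedBall x (η / 2) ↔
        w ∈ Metric.closedBall (0 : UnitAddCircle) (η / 2) := by simp [dist_eq_norm]
    have h2 : dist x (x + w) = ‖w‖ := by simp [dist_eq_norm]
    simp only [f]
    by_cases hw : w ∈ Metric.closedBall (0 : UnitAddCircle) (η / 2)
    · rw [Set.indicator_of_mem (h1.2 hw), Set.indicator_of_mem hw, h2]
    · rw [Set.indicator_of_notMem (mt h1.1 hw), Set.indicator_of_notMem hw]
  rw [e1, ← UnitAddCircle.lintegral_preimage (-(1 / 2)) f]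
  have h2 : ∫⁻ a in Set.Ioc (-(η / 2)) (η / 2), ENNReal.ofReal (σ - |a|) ≤
      ∫⁻ a in Set.Ioc (-(1 / 2) : ℝ) (-(1 / 2) + 1), f (a : UnitAddCircle) := by
    refine le_trans ?_ (lintegral_mono_set (s := Set.Ioc (-(η / 2)) (η / 2)) ?_)
    · refine setLIntegral_mono' measurableSet_Ioc fun a ha => ?_
      have ha' : |a| ≤ η / 2 := abs_le.2 ⟨ha.1.le, ha.2⟩
      have hn := norm_coe_le_abs a
      have : (a : UnitAddCircle) ∈ Metric.closedBall (0 : UnitAddCircle) (η / 2) := by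
        simpa using hn.trans ha'
      simp only [f, Set.indicator_of_mem this]
      exact ENNReal.ofReal_le_ofReal (by linarith)
    · exact Set.Ioc_subset_Ioc (by linarith) (by linarith)
  refine le_trans ?_ h2
  rw [← ofReal_integral_eq_lintegral_ofReal]
  · rw [← intervalIntegral.integral_of_le (by linarith), integral_sub_abs (by linarith)]
    exact ENNReal.ofReal_le_ofReal (by nlinarith)
  · exact ((by fun_prop : Continuous fun a : ℝ => σ - |a|).integrableOn_Ioc)
  · refine (ae_restrict_iff' measurableSet_Ioc).2 (ae_of_all _ fun a ha => ?_)
    have ha' : |a| ≤ η / 2 := abs_le.2 ⟨ha.1.le, ha.2⟩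
    simp only [Pi.zero_apply]
    linarith

theorem measurableSet_overlap (x : UnitAddCircle) (r s t : ℝ) :
    MeasurableSet {z : UnitAddCircle × UnitAddCircle | dist z.1 x ≤ r ∧ dist z.2 x ≤ s ∧
      dist z.2 z.1 ≤ t} := by
  have h1 : MeasurableSet {z : UnitAddCircle × UnitAddCircle | dist z.1 x ≤ r} :=
    measurableSet_le (by fun_prop) measurable_const
  have h2 : MeasurableSet {z : UnitAddCircle × UnitAddCircle | dist z.2 x ≤ s} :=
    measurableSet_le (by fun_prop) measurable_const
  have h3 : MeasurableSet {z : UnitAddCircle × UnitAddCircle | dist z.2 z.1 ≤ t} :=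
    measurableSet_le (by fun_prop) measurable_const
  exact h1.inter (h2.inter h3)

/-- For a fixed second point, the first one ranges over the intersection of two intervals of length
σ, centred at x and at the second point. -/
theorem circle_overlap_wide (x : UnitAddCircle) {σ η : ℝ} (hη : 0 ≤ η) (hησ : η ≤ σ)
    (hσ : σ ≤ 1) :
    ENNReal.ofReal (3 / 4 * (σ * η)) ≤ (volume.prod volume)
      {z : UnitAddCircle × UnitAddCircle | dist z.1 x ≤ σ / 2 ∧ dist z.2 x ≤ η / 2 ∧
        dist z.2 z.1 ≤ σ / 2} := by
  have hS := measurableSet_overlap x (σ / 2) (η / 2) (σ / 2)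
  rw [Measure.prod_apply_symm hS]
  refine (le_setLIntegral_closedBall x hη hησ hσ).trans ?_
  rw [← lintegral_indicator Metric.isClosed_closedBall.measurableSet]
  refine lintegral_mono fun v => ?_
  by_cases hv : v ∈ Metric.closedBall x (η / 2)
  · rw [Set.indicator_of_mem hv]
    refine (le_volume_closedBall_inter x v hσ).trans (measure_mono fun u hu => ?_)
    exact ⟨hu.1, hv, by rw [dist_comm]; exact hu.2⟩
  · rw [Set.indicator_of_notMem hv]
    exact zero_le

/-- In the coordinates (z₁, w) with w = z₂ - z₁, the first point must lie within σ/2 of both x and x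
- w. The remaining integral over |w| ≤ η/2 is the one of the wide case. -/
theorem circle_overlap_narrow (x : UnitAddCircle) {σ η : ℝ} (hη : 0 ≤ η) (hησ : η ≤ σ)
    (hσ : σ ≤ 1) :
    ENNReal.ofReal (3 / 4 * (σ * η)) ≤ (volume.prod volume)
      {z : UnitAddCircle × UnitAddCircle | dist z.1 x ≤ σ / 2 ∧ dist z.2 x ≤ σ / 2 ∧
        dist z.2 z.1 ≤ η / 2} := by
  have hS := measurableSet_overlap x (σ / 2) (σ / 2) (η / 2)
  have hmp := measurePreserving_prod_add (volume : Measure UnitAddCircle)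
    (volume : Measure UnitAddCircle)
  rw [← hmp.measure_preimage hS.nullMeasurableSet,
    Measure.prod_apply_symm (hmp.measurable hS)]
  refine (le_setLIntegral_closedBall 0 hη hησ hσ).trans ?_
  rw [← lintegral_indicator Metric.isClosed_closedBall.measurableSet]
  refine lintegral_mono fun w => ?_
  by_cases hw : w ∈ Metric.closedBall (0 : UnitAddCircle) (η / 2)
  · rw [Set.indicator_of_mem hw]
    have h := le_volume_closedBall_inter x (x - w) hσ
    have hd : dist x (x - w) = dist 0 w := by rw [dist_eq_norm, dist_eq_norm]; simp
    rw [hd] at h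
    refine h.trans (measure_mono fun u hu => ?_)
    refine ⟨hu.1, ?_, ?_⟩
    · have := hu.2
      rw [Metric.mem_closedBall, dist_eq_norm, sub_sub_eq_add_sub] at this
      change dist (u + w) x ≤ σ / 2
      rwa [dist_eq_norm]
    · rw [Metric.mem_closedBall, dist_zero_right] at hw
      simpa [dist_eq_norm] using hw
  · rw [Set.indicator_of_notMem hw]
    exact zero_le

theorem prod_volume_torus_pi {m : ℕ} (S : Fin m → Set (UnitAddCircle × UnitAddCircle))
    (hS : ∀ k, MeasurableSet (S k)) :
    (volume.prod volume) {z : Torus m × Torus m | ∀ k, (z.1 k, z.2 k) ∈ S k} =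
      ∏ k, (volume.prod volume) (S k) := by
  have hmp := measurePreserving_arrowProdEquivProdArrow UnitAddCircle UnitAddCircle (Fin m)
    (fun _ => volume) (fun _ => volume)
  have hm : MeasurableSet {z : Torus m × Torus m | ∀ k, (z.1 k, z.2 k) ∈ S k} := by
    rw [Set.ofPred_forall]
    refine MeasurableSet.iInter fun k => ?_
    exact (((measurable_pi_apply k).comp measurable_fst).prodMk
      ((measurable_pi_apply k).comp measurable_snd)) (hS k)
  rw [← Measure.pi_pi]
  rw [volume_pi, ← hmp.measure_preimage hm.nullMeasurableSet]
  congr 1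
  ext z
  simp [MeasurableEquiv.arrowProdEquivProdArrow, Equiv.arrowProdEquivProdArrow]

/-- In the sup metric the event is a product over coordinates, so the one-dimensional bound is
raised to the power m. -/
theorem torus_overlap_aux {m : ℕ} (x : Torus m) {σ η r s t : ℝ} (hr : 0 ≤ r) (hs : 0 ≤ s)
    (ht : 0 ≤ t) (hη : 0 ≤ η) (hσ : 0 ≤ σ)
    (h : ∀ x : UnitAddCircle, ENNReal.ofReal (3 / 4 * (σ * η)) ≤ (volume.prod volume)
      {z : UnitAddCircle × UnitAddCircle | dist z.1 x ≤ r ∧ dist z.2 x ≤ s ∧ dist z.2 z.1 ≤ t}) :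
    ENNReal.ofReal ((3 / 4) ^ m * (σ ^ m * η ^ m)) ≤ (volume.prod volume)
      {z : Torus m × Torus m | dist z.1 x ≤ r ∧ dist z.2 x ≤ s ∧ dist z.2 z.1 ≤ t} := by
  have e : {z : Torus m × Torus m | dist z.1 x ≤ r ∧ dist z.2 x ≤ s ∧ dist z.2 z.1 ≤ t} =
      {z : Torus m × Torus m | ∀ k, (z.1 k, z.2 k) ∈ {z : UnitAddCircle × UnitAddCircle |
        dist z.1 (x k) ≤ r ∧ dist z.2 (x k) ≤ s ∧ dist z.2 z.1 ≤ t}} := by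
    ext z
    simp only [Set.mem_ofPred_eq, dist_pi_le_iff hr, dist_pi_le_iff hs, dist_pi_le_iff ht]
    exact ⟨fun h k => ⟨h.1 k, h.2.1 k, h.2.2 k⟩,
      fun h => ⟨fun k => (h k).1, fun k => (h k).2.1, fun k => (h k).2.2⟩⟩
  rw [e, prod_volume_torus_pi]
  · calc ENNReal.ofReal ((3 / 4) ^ m * (σ ^ m * η ^ m))
        = ∏ _k : Fin m, ENNReal.ofReal (3 / 4 * (σ * η)) := by
          rw [Finset.prod_const, Finset.card_univ, Fintype.card_fin, ← ENNReal.ofReal_pow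
            (by positivity), mul_pow, mul_pow]
      _ ≤ _ := Finset.prod_le_prod' fun k _ => h (x k)
  · intro k
    exact measurableSet_overlap (x k) r s t

/-- Two points, one uniform in a wide cube and one in a concentric narrow cube: the narrow one lies
within the wide distance of the other with conditional probability at least `(3 / 4) ^ m`. -/
theorem torus_overlap_wide {m : ℕ} (x : Torus m) {σ η : ℝ} (hη : 0 ≤ η) (hησ : η ≤ σ)
    (hσ : σ ≤ 1) :
    ENNReal.ofReal ((3 / 4) ^ m * (σ ^ m * η ^ m)) ≤ (volume.prod volume)
      {z : Torus m × Torus m | dist z.1 x ≤ σ / 2 ∧ dist z.2 x ≤ η / 2 ∧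
        dist z.2 z.1 ≤ σ / 2} :=
  torus_overlap_aux x (by linarith) (by linarith) (by linarith) hη (hη.trans hησ)
    fun x => circle_overlap_wide x hη hησ hσ

/-- Two uniform points of a wide cube are within the narrow distance of each other with probability
at least `(3 / 4) ^ m` times the ratio of volumes. -/
theorem torus_overlap_narrow {m : ℕ} (x : Torus m) {σ η : ℝ} (hη : 0 ≤ η) (hησ : η ≤ σ)
    (hσ : σ ≤ 1) :
    ENNReal.ofReal ((3 / 4) ^ m * (σ ^ m * η ^ m)) ≤ (volume.prod volume)
      {z : Torus m × Torus m | dist z.1 x ≤ σ / 2 ∧ dist z.2 x ≤ σ / 2 ∧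
        dist z.2 z.1 ≤ η / 2} :=
  torus_overlap_aux x (by linarith) (by linarith) (by linarith) hη (hη.trans hησ)
    fun x => circle_overlap_narrow x hη hησ hσ

end GeoP

/-! ### Local clustering -/

theorem localClustering_nonneg {V : Type*} (G : SimpleGraph V) (v : V) :
    0 ≤ localClustering G v := by
  unfold localClustering; positivity

section LocalClustering

variable {V : Type*} [Fintype V]

open Classical in
theorem ncard_neighborSet_eq_sum (G : SimpleGraph V) (v : V) :
    ((G.neighborSet v).ncard : ℝ) = ∑ j, if G.Adj v j then (1 : ℝ) else 0 := by
  rw [Finset.sum_boole, Set.ncard_eq_toFinset_card', ← SimpleGraph.neighborFinset_def,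
    SimpleGraph.neighborFinset_eq_filter]

-- The order τ picks at most one orientation of each edge, so the ordered pairs inject into the
-- edges inside the neighbourhood.
open Classical in
theorem sum_le_ncard_edges_neighborSet (G : SimpleGraph V) (v : V) (τ : V → ℕ) :
    (∑ j, ∑ i, if τ i < τ j then
      (if G.Adj v i then (1 : ℝ) else 0) * (if G.Adj v j then (1 : ℝ) else 0) *
        (if G.Adj i j then (1 : ℝ) else 0) else 0)
      ≤ ({e ∈ G.edgeSet | ∀ w ∈ e, w ∈ G.neighborSet v}.ncard : ℝ) := by
  let S : Finset (V × V) := Finset.univ.filter fun z =>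
    τ z.2 < τ z.1 ∧ G.Adj v z.2 ∧ G.Adj v z.1 ∧ G.Adj z.2 z.1
  have h1 : (∑ j, ∑ i, if τ i < τ j then
      (if G.Adj v i then (1 : ℝ) else 0) * (if G.Adj v j then (1 : ℝ) else 0) *
        (if G.Adj i j then (1 : ℝ) else 0) else 0) = S.card := by
    rw [← Finset.sum_boole, Fintype.sum_prod_type]
    refine Finset.sum_congr rfl fun j _ => Finset.sum_congr rfl fun i _ => ?_
    by_cases c1 : τ i < τ j <;> by_cases c2 : G.Adj v i <;> by_cases c3 : G.Adj v j <;>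
      by_cases c4 : G.Adj i j <;> simp [c1, c2, c3, c4]
  rw [h1, ← Set.ncard_coe_finset]
  refine Nat.cast_le.2 (Set.ncard_le_ncard_of_injOn (fun z => s(z.2, z.1)) ?_ ?_ (Set.toFinite _))
  · intro z hz
    simp only [S, Finset.coe_filter, Finset.mem_univ, true_and, Set.mem_ofPred_eq] at hz
    refine ⟨hz.2.2.2, fun w hw => ?_⟩
    rcases Sym2.mem_iff.1 hw with rfl | rfl
    · exact hz.2.1
    · exact hz.2.2.1
  · intro z hz z' hz' h
    simp only [S, Finset.coe_filter, Finset.mem_univ, true_and, Set.mem_ofPred_eq] at hz hz'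
    rcases Sym2.eq_iff.1 h with ⟨h1, h2⟩ | ⟨h1, h2⟩
    · exact Prod.ext h2 h1
    · have a1 := hz.1
      rw [h1, h2] at a1
      exact absurd a1 (not_lt.2 hz'.1.le)

/-- Guards against the convention of division by zero: as soon as an edge is counted, the
denominator `deg v` choose 2 is positive. -/
theorem two_le_ncard_neighborSet (G : SimpleGraph V) (v : V)
    (h : 0 < {e ∈ G.edgeSet | ∀ w ∈ e, w ∈ G.neighborSet v}.ncard) :
    2 ≤ (G.neighborSet v).ncard := by
  obtain ⟨e, he⟩ := (Set.ncard_pos (Set.toFinite _)).1 h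
  induction e with
  | _ x y =>
    have hxy : x ≠ y := G.ne_of_adj he.1
    have hsub : ({x, y} : Set V) ⊆ G.neighborSet v := by
      rintro w (rfl | rfl)
      · exact he.2 _ (Sym2.mem_mk_left _ _)
      · exact he.2 _ (Sym2.mem_mk_right _ _)
    rw [← Set.ncard_pair hxy]
    exact Set.ncard_le_ncard hsub (Set.toFinite _)

theorem le_localClustering (G : SimpleGraph V) (v : V) {k M : ℝ} (hM : 0 < M)
    (hdeg : ((G.neighborSet v).ncard : ℝ) ≤ k)
    (he : M ≤ ({e ∈ G.edgeSet | ∀ w ∈ e, w ∈ G.neighborSet v}.ncard : ℝ)) :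
    2 * M / k ^ 2 ≤ localClustering G v := by
  have h2 := two_le_ncard_neighborSet G v (by
    have := hM.trans_le he
    exact_mod_cast this)
  have h2' : (2 : ℝ) ≤ ((G.neighborSet v).ncard : ℝ) := by exact_mod_cast h2
  unfold localClustering
  rw [Nat.cast_choose_two]
  have hpos : 0 < ((G.neighborSet v).ncard : ℝ) * ((G.neighborSet v).ncard - 1) / 2 := by
    have : 0 < ((G.neighborSet v).ncard : ℝ) - 1 := by linarith
    positivity
  rw [div_le_div_iff₀ (by nlinarith) hpos]
  have hd : ((G.neighborSet v).ncard : ℝ) * ((G.neighborSet v).ncard - 1) ≤ k ^ 2 := by nlinarith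
  nlinarith [mul_le_mul he hd (by linarith) (by linarith)]

end LocalClustering

/-! ### Product measures -/

section ProductMeasures

/-- Conditioning on the first factor: a conditional bound on the good set g, and the trivial bound 1
off it. -/
theorem measureReal_prod_le {X Y : Type*} [MeasurableSpace X] [MeasurableSpace Y] {μ : Measure X}
    {ν : Measure Y} [IsProbabilityMeasure μ] [IsProbabilityMeasure ν] {S : Set (X × Y)}
    (hS : MeasurableSet S) {g : Set X} (hg : MeasurableSet g) {b : ℝ} (hb : 0 ≤ b)
    (h : ∀ x ∈ g, ν.real (Prod.mk x ⁻¹' S) ≤ b) :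
    (μ.prod ν).real S ≤ μ.real gᶜ + b := by
  have h1 : (μ.prod ν) S ≤ μ gᶜ + ENNReal.ofReal b := by
    rw [Measure.prod_apply hS]
    calc ∫⁻ x, ν (Prod.mk x ⁻¹' S) ∂μ
        ≤ ∫⁻ x, (gᶜ.indicator 1 x + ENNReal.ofReal b) ∂μ := by
          refine lintegral_mono fun x => ?_
          by_cases hx : x ∈ g
          · rw [Set.indicator_of_notMem (by simpa using hx), zero_add,
              ← ofReal_measureReal (measure_ne_top _ _)]
            exact ENNReal.ofReal_le_ofReal (h x hx)
          · rw [Set.indicator_of_mem (by simpa using hx)]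
            exact le_add_right prob_le_one
      _ = μ gᶜ + ENNReal.ofReal b := by
          rw [lintegral_add_right _ measurable_const, lintegral_indicator_one hg.compl]
          simp
  have h2 := ENNReal.toReal_mono (by simp) h1
  rwa [ENNReal.toReal_add (measure_ne_top _ _) (by simp), ENNReal.toReal_ofReal hb] at h2

/-- Resampling one coordinate of an i.i.d. family keeps its law. This detaches the data of a chosen
vertex from the rest. -/
theorem measurePreserving_update {ι Ω : Type*} [Fintype ι] [DecidableEq ι] [MeasurableSpace Ω]
    (ν : Measure Ω) [IsProbabilityMeasure ν] (v : ι) :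
    MeasurePreserving (fun z : Ω × (ι → Ω) => Function.update z.2 v z.1)
      (ν.prod (Measure.pi fun _ => ν)) (Measure.pi fun _ => ν) := by
  have hm : Measurable fun z : Ω × (ι → Ω) => Function.update z.2 v z.1 := by
    refine measurable_pi_iff.2 fun i => ?_
    by_cases h : i = v
    · subst h; simpa using measurable_fst
    · simp only [Function.update_of_ne h]; fun_prop
  refine ⟨hm, (Measure.pi_eq fun s hs => ?_).symm⟩
  rw [Measure.map_apply hm (MeasurableSet.univ_pi hs)]
  have e : (fun z : Ω × (ι → Ω) => Function.update z.2 v z.1) ⁻¹' Set.univ.pi s =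
      s v ×ˢ Set.univ.pi (Function.update s v Set.univ) := by
    ext z
    simp only [Set.mem_preimage, Set.mem_univ_pi, Set.mem_prod]
    constructor
    · intro h
      refine ⟨by simpa using h v, fun i => ?_⟩
      by_cases hi : i = v
      · subst hi; simp
      · simpa [Function.update_of_ne hi] using h i
    · rintro ⟨h1, h2⟩ i
      by_cases hi : i = v
      · subst hi; simpa using h1
      · simpa [Function.update_of_ne hi] using h2 i
  rw [e, Measure.prod_prod, Measure.pi_pi, ← Finset.mul_prod_erase _ _ (Finset.mem_univ v),
    ← Finset.mul_prod_erase (a := v) _ (fun i => ν (s i)) (Finset.mem_univ v)]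
  simp only [Function.update_self, measure_univ, one_mul]
  congr 1
  refine Finset.prod_congr rfl fun i hi => ?_
  rw [Function.update_of_ne (Finset.ne_of_mem_erase hi)]

end ProductMeasures

namespace GeoP

theorem bernoulli_real_true (p : unitInterval) :
    (bernoulliMeasure true false p).real {true} = p := by
  rw [bernoulliMeasure_real_apply _ (by measurability)]
  simp

theorem bernoulli_pi_real_eval {n : ℕ} (p : unitInterval) (v : Fin n) :
    (Measure.pi fun _ : Fin n => bernoulliMeasure true false p).real {c | c v = true} = p := by
  rw [← bernoulli_real_true p, measureReal_def, measureReal_def,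
    ← (measurePreserving_eval (fun _ : Fin n => bernoulliMeasure true false p) v).measure_preimage
      (by measurability)]
  rfl

theorem bernoulli_pi_real_eval_two {n : ℕ} (p : unitInterval) {v i : Fin n} (h : i ≠ v) :
    (Measure.pi fun _ : Fin n => bernoulliMeasure true false p).real
      {c | c v = true ∧ c i = true} = p ^ 2 := by
  have e : {c : Fin n → Bool | c v = true ∧ c i = true} =
      Set.univ.pi (fun j => if j = v ∨ j = i then {true} else Set.univ) := by
    ext c
    simp only [Set.mem_ofPred_eq, Set.mem_univ_pi]
    constructor
    · rintro ⟨h1, h2⟩ j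
      split_ifs with hj
      · rcases hj with rfl | rfl <;> simpa
      · trivial
    · intro h
      exact ⟨by simpa using h v, by simpa using h i⟩
  rw [e, measureReal_def, Measure.pi_pi, ENNReal.toReal_prod,
    ← Finset.mul_prod_erase _ _ (Finset.mem_univ v),
    ← Finset.mul_prod_erase _ _ (Finset.mem_erase.2 ⟨h, Finset.mem_univ i⟩), Finset.prod_eq_one]
  · simp only [true_or, or_true, if_true, mul_one, ← measureReal_def, bernoulli_real_true]
    ring
  · intro j hj
    simp only [Finset.mem_erase] at hj
    simp [hj.1, hj.2.1]

theorem volume_real_closedBall {m : ℕ} (x : Torus m) {s : ℝ} (h0 : 0 ≤ s) (h1 : s ≤ 1) :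
    (volume : Measure (Torus m)).real (Metric.closedBall x (s / 2)) = s ^ m := by
  rw [measureReal_def, closedBall_pi _ (by positivity), volume_pi_pi]
  simp only [AddCircle.volume_closedBall]
  rw [Finset.prod_const, mul_div_cancel₀ _ (two_ne_zero), min_eq_right h1, Finset.card_univ,
    Fintype.card_fin, ENNReal.toReal_pow, ENNReal.toReal_ofReal h0]

end GeoP

namespace GeoP

/-! ### The graph built from independent positions and coins along a fixed birth order -/

/-- The graph on nodes born in the order given by `τ`, where the younger node `j` is linked to the
older node `i` if it lies in the cube of side `s i j` around `i` and its coin for `i` is `true`. -/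
def scheduleGraph {n m : ℕ} (τ : Fin n → ℕ) (s : Fin n → Fin n → ℝ)
    (Z : Fin n → Torus m × (Fin n → Bool)) : SimpleGraph (Fin n) where
  Adj i j := (τ i < τ j ∧ dist (Z j).1 (Z i).1 ≤ s i j / 2 ∧ (Z j).2 i = true) ∨
    (τ j < τ i ∧ dist (Z i).1 (Z j).1 ≤ s j i / 2 ∧ (Z i).2 j = true)
  symm := ⟨fun _ _ h => h.symm⟩
  loopless := ⟨fun _ h => by rcases h with h | h <;> exact lt_irrefl _ h.1⟩

theorem measurable_scheduleGraph {n m : ℕ} (τ : Fin n → ℕ) (s : Fin n → Fin n → ℝ) :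
    Measurable (scheduleGraph (m := m) τ s) := by
  refine SimpleGraph.measurable_iff_adj.2 fun a b => measurableSet_setOfPred.1 ?_
  have h (i j : Fin n) : MeasurableSet {Z : Fin n → Torus m × (Fin n → Bool) |
      τ i < τ j ∧ dist (Z j).1 (Z i).1 ≤ s i j / 2 ∧ (Z j).2 i = true} := by
    refine (MeasurableSet.const _).inter (MeasurableSet.inter ?_ ?_)
    · have hd : Measurable fun Z : Fin n → Torus m × (Fin n → Bool) => dist (Z j).1 (Z i).1 :=
        (measurable_fst.comp (measurable_pi_apply j)).dist
          (measurable_fst.comp (measurable_pi_apply i))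
      exact measurableSet_le hd measurable_const
    · have : Measurable fun Z : Fin n → Torus m × (Fin n → Bool) => (Z j).2 i :=
        (measurable_pi_apply i).comp (measurable_snd.comp (measurable_pi_apply j))
      exact this (MeasurableSet.singleton true)
  exact (h a b).union (h b a)

instance (m : ℕ) : IsProbabilityMeasure (volume : Measure (Torus m)) := by
  rw [volume_pi]
  have : IsProbabilityMeasure (volume : Measure UnitAddCircle) := ⟨by simp⟩
  infer_instance

/-- The law of the positions and coins of one node. -/
noncomputable def nodeLaw (p : unitInterval) (n m : ℕ) : Measure (Torus m × (Fin n → Bool)) :=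
  (volume : Measure (Torus m)).prod (Measure.pi fun _ : Fin n => bernoulliMeasure true false p)

instance (p : unitInterval) (n m : ℕ) : IsProbabilityMeasure (nodeLaw p n m) := by
  unfold nodeLaw; infer_instance

/-- The law of the position, the coins, and the coin that a distinguished node uses for this
node. -/
noncomputable def pairedNodeLaw (p : unitInterval) (n m : ℕ) :
    Measure (Torus m × ((Fin n → Bool) × Bool)) :=
  (volume : Measure (Torus m)).prod
    ((Measure.pi fun _ : Fin n => bernoulliMeasure true false p).prod
      (bernoulliMeasure true false p))

instance (p : unitInterval) (n m : ℕ) : IsProbabilityMeasure (pairedNodeLaw p n m) := by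
  unfold pairedNodeLaw; infer_instance

/-- Reassemble the nodes around the distinguished node `v` at position `x`. -/
def assemble {n m : ℕ} (v : Fin n)
    (z : Torus m × (Fin n → Torus m × ((Fin n → Bool) × Bool))) :
    Fin n → Torus m × (Fin n → Bool) :=
  Function.update (fun j => ((z.2 j).1, (z.2 j).2.1)) v (z.1, fun j => (z.2 j).2.2)

/-- The coins held by v are handed out, one to each node. For a fixed position of v, being linked to
v then depends only on the node's own data, and a link between two other nodes only on their two
data. These data are independent, as the quadratic tail bound requires. -/
theorem measurePreserving_assemble (p : unitInterval) {n m : ℕ} (v : Fin n) :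
    MeasurePreserving (assemble (m := m) v)
      ((volume : Measure (Torus m)).prod (Measure.pi fun _ : Fin n => pairedNodeLaw p n m))
      (Measure.pi fun _ : Fin n => nodeLaw p n m) := by
  have h1 : MeasurePreserving
      (MeasurableEquiv.prodAssoc.symm : Torus m × ((Fin n → Bool) × Bool) ≃ᵐ _)
      (pairedNodeLaw p n m) ((nodeLaw p n m).prod (bernoulliMeasure true false p)) :=
    (measurePreserving_prodAssoc _ _ _).symm
  have h2 := measurePreserving_pi (fun _ : Fin n => pairedNodeLaw p n m)
    (fun _ : Fin n => (nodeLaw p n m).prod (bernoulliMeasure true false p)) (fun _ => h1)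
  have h3 := (measurePreserving_arrowProdEquivProdArrow (Torus m × (Fin n → Bool)) Bool (Fin n)
    (fun _ => nodeLaw p n m) (fun _ => bernoulliMeasure true false p)).comp h2
  have h4 := (MeasurePreserving.id (volume : Measure (Torus m))).prod
    ((Measure.measurePreserving_swap).comp h3)
  have h5 : MeasurePreserving
      (MeasurableEquiv.prodAssoc.symm : Torus m × ((Fin n → Bool) ×
        (Fin n → Torus m × (Fin n → Bool))) ≃ᵐ _)
      ((volume : Measure (Torus m)).prod
        ((Measure.pi fun _ : Fin n => bernoulliMeasure true false p).prod
          (Measure.pi fun _ : Fin n => nodeLaw p n m)))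
      ((nodeLaw p n m).prod (Measure.pi fun _ : Fin n => nodeLaw p n m)) :=
    (measurePreserving_prodAssoc _ _ _).symm
  exact (measurePreserving_update (nodeLaw p n m) v).comp (h5.comp h4)

section Vertex

variable {n m : ℕ} (τ : Fin n → ℕ) (s : Fin n → Fin n → ℝ) (v : Fin n)

/-- The side of the cube that decides on a link between `v` and `j`. -/
def linkSide (j : Fin n) : ℝ := if τ j < τ v then s j v else s v j

/-- The coins deciding on a link between `v` and `j`. -/
def linkCoins (j : Fin n) : Set ((Fin n → Bool) × Bool) :=
  {b | if τ j < τ v then b.2 = true else b.1 v = true}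

theorem measurableSet_linkCoins (j : Fin n) : MeasurableSet (linkCoins τ v j) :=
  (Set.toFinite _).measurableSet

theorem linkCoins_real (p : unitInterval) (j : Fin n) :
    ((Measure.pi fun _ : Fin n => bernoulliMeasure true false p).prod
      (bernoulliMeasure true false p)).real (linkCoins τ v j) = p := by
  by_cases h : τ j < τ v
  · have : linkCoins τ v j = Set.univ ×ˢ {true} := by ext b; simp [linkCoins, h]
    rw [this, measureReal_prod_prod, bernoulli_real_true]
    simp
  · have : linkCoins τ v j = {c | c v = true} ×ˢ Set.univ := by ext b; simp [linkCoins, h]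
    rw [this, measureReal_prod_prod, bernoulli_pi_real_eval]
    simp

theorem linkCoins_inter_real (p : unitInterval) {i : Fin n} (hi : i ≠ v) (j : Fin n) :
    ((Measure.pi fun _ : Fin n => bernoulliMeasure true false p).prod
      (bernoulliMeasure true false p)).real (linkCoins τ v j ∩ {b | b.1 i = true}) = p ^ 2 := by
  by_cases h : τ j < τ v
  · have : linkCoins τ v j ∩ {b | b.1 i = true} = {c | c i = true} ×ˢ {true} := by
      ext b; simp [linkCoins, h, and_comm]
    rw [this, measureReal_prod_prod, bernoulli_real_true, bernoulli_pi_real_eval]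
    ring
  · have : linkCoins τ v j ∩ {b | b.1 i = true} =
        {c | c v = true ∧ c i = true} ×ˢ Set.univ := by ext b; simp [linkCoins, h]
    rw [this, measureReal_prod_prod, bernoulli_pi_real_eval_two p hi]
    simp

/-- The event that `j` is linked to `v`, when `v` is at `x`. -/
def linkSet (x : Torus m) (j : Fin n) : Set (Torus m × ((Fin n → Bool) × Bool)) :=
  if j = v then ∅ else Metric.closedBall x (linkSide τ s v j / 2) ×ˢ linkCoins τ v j

theorem measurableSet_linkSet (x : Torus m) (j : Fin n) :
    MeasurableSet (linkSet τ s v x j) := by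
  unfold linkSet
  split_ifs
  · exact MeasurableSet.empty
  · exact Metric.isClosed_closedBall.measurableSet.prod (measurableSet_linkCoins τ v j)

/-- The event that the younger node `j` is linked to `i`. -/
def pairSet (m : ℕ) (i j : Fin n) : Set ((Torus m × ((Fin n → Bool) × Bool)) ×
    (Torus m × ((Fin n → Bool) × Bool))) :=
  {z | dist z.2.1 z.1.1 ≤ s i j / 2 ∧ z.2.2.1 i = true}

theorem measurableSet_pairSet (i j : Fin n) : MeasurableSet (pairSet s m i j) := by
  have h1 : MeasurableSet {z : (Torus m × ((Fin n → Bool) × Bool)) ×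
      (Torus m × ((Fin n → Bool) × Bool)) | dist z.2.1 z.1.1 ≤ s i j / 2} :=
    measurableSet_le ((measurable_fst.comp measurable_snd).dist
      (measurable_fst.comp measurable_fst)) measurable_const
  have h2 : Measurable fun z : (Torus m × ((Fin n → Bool) × Bool)) ×
      (Torus m × ((Fin n → Bool) × Bool)) => z.2.2.1 i := by fun_prop
  exact h1.inter (h2 (MeasurableSet.singleton true))

variable {τ s v}

theorem adj_assemble_iff (hτ : Function.Injective τ) (x : Torus m)
    (ω : Fin n → Torus m × ((Fin n → Bool) × Bool)) (j : Fin n) :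
    (scheduleGraph τ s (assemble v (x, ω))).Adj v j ↔ ω j ∈ linkSet τ s v x j := by
  by_cases hj : j = v
  · subst hj
    simp [linkSet]
  · have hne : τ j ≠ τ v := fun h => hj (hτ h)
    rcases lt_or_gt_of_ne hne with h | h
    · simp [scheduleGraph, assemble, linkSet, hj, h, not_lt.2 h.le, linkSide, linkCoins,
        dist_comm]
    · simp [scheduleGraph, assemble, linkSet, hj, h, not_lt.2 h.le, linkSide, linkCoins]

theorem adj_assemble_pair_iff (x : Torus m)
    (ω : Fin n → Torus m × ((Fin n → Bool) × Bool)) {i j : Fin n} (hi : i ≠ v) (hj : j ≠ v)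
    (hij : τ i < τ j) :
    (scheduleGraph τ s (assemble v (x, ω))).Adj i j ↔ (ω i, ω j) ∈ pairSet s m i j := by
  simp [scheduleGraph, assemble, hi, hj, hij, not_lt.2 hij.le, pairSet]

theorem integral_linkSet (p : unitInterval) (x : Torus m) {j : Fin n} (hj : j ≠ v)
    (h0 : 0 ≤ linkSide τ s v j) (h1 : linkSide τ s v j ≤ 1) :
    ∫ ω, (linkSet τ s v x j).indicator 1 ω ∂(pairedNodeLaw p n m) =
      p * linkSide τ s v j ^ m := by
  rw [integral_indicator_one (measurableSet_linkSet τ s v x j), linkSet, if_neg hj, pairedNodeLaw,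
    measureReal_prod_prod, linkCoins_real, volume_real_closedBall x h0 h1, mul_comm]

/-- The links vi, vj and ij use three different coins, hence p³; `hi` separates the coins of j for v
and for i. What remains is the geometric probability for the two positions. -/
theorem integral_pairSet (p : unitInterval) (x : Torus m) {i j : Fin n} (hi : i ≠ v)
    (hj : j ≠ v) :
    ∫ ω, (linkSet τ s v x i).indicator 1 ω * ∫ ω', (linkSet τ s v x j).indicator 1 ω' *
      (pairSet s m i j).indicator 1 (ω, ω') ∂(pairedNodeLaw p n m) ∂(pairedNodeLaw p n m) =
      (p : ℝ) ^ 3 * (volume.prod volume).real {z : Torus m × Torus m |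
        dist z.1 x ≤ linkSide τ s v i / 2 ∧ dist z.2 x ≤ linkSide τ s v j / 2 ∧
        dist z.2 z.1 ≤ s i j / 2} := by
  have hin : ∀ ω : Torus m × ((Fin n → Bool) × Bool),
      ∫ ω', (linkSet τ s v x j).indicator 1 ω' *
        (pairSet s m i j).indicator 1 (ω, ω') ∂(pairedNodeLaw p n m) =
      (p : ℝ) ^ 2 * (volume : Measure (Torus m)).real (Metric.closedBall x (linkSide τ s v j / 2) ∩
        Metric.closedBall ω.1 (s i j / 2)) := fun ω => by
    have e : (fun ω' : Torus m × ((Fin n → Bool) × Bool) =>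
        (linkSet τ s v x j).indicator (1 : Torus m × ((Fin n → Bool) × Bool) → ℝ) ω' *
          (pairSet s m i j).indicator (1 : (Torus m × ((Fin n → Bool) × Bool)) ×
            (Torus m × ((Fin n → Bool) × Bool)) → ℝ) (ω, ω')) =
        ((Metric.closedBall x (linkSide τ s v j / 2) ∩ Metric.closedBall ω.1 (s i j / 2)) ×ˢ
          (linkCoins τ v j ∩ {b | b.1 i = true})).indicator 1 := by
      funext ω'
      have : ω' ∈ (Metric.closedBall x (linkSide τ s v j / 2) ∩
          Metric.closedBall ω.1 (s i j / 2)) ×ˢ (linkCoins τ v j ∩ {b | b.1 i = true}) ↔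
          ω' ∈ linkSet τ s v x j ∧ (ω, ω') ∈ pairSet s m i j := by
        simp only [linkSet, if_neg hj, pairSet, Set.mem_prod, Set.mem_inter_iff,
          Set.mem_ofPred_eq, Metric.mem_closedBall]
        tauto
      by_cases h1 : ω' ∈ linkSet τ s v x j <;> by_cases h2 : (ω, ω') ∈ pairSet s m i j <;>
        simp only [h1, h2, and_true, and_false, iff_false, iff_true] at this <;>
        simp [h1, h2, this]
    rw [e, integral_indicator_one, pairedNodeLaw, measureReal_prod_prod,
      linkCoins_inter_real τ v p hi j, mul_comm]
    exact (Metric.isClosed_closedBall.measurableSet.inter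
      Metric.isClosed_closedBall.measurableSet).prod (Set.toFinite _).measurableSet
  simp only [hin]
  let f : Torus m → ℝ := fun u => (volume : Measure (Torus m)).real
    (Metric.closedBall x (linkSide τ s v j / 2) ∩ Metric.closedBall u (s i j / 2))
  have e2 : ∀ ω : Torus m × ((Fin n → Bool) × Bool),
      (linkSet τ s v x i).indicator (1 : Torus m × ((Fin n → Bool) × Bool) → ℝ) ω * ((p : ℝ) ^ 2 * f ω.1) =
      ((Metric.closedBall x (linkSide τ s v i / 2)).indicator 1 ω.1 * ((p : ℝ) ^ 2 * f ω.1)) *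
        (linkCoins τ v i).indicator 1 ω.2 := fun ω => by
    have : ω ∈ linkSet τ s v x i ↔ ω.1 ∈ Metric.closedBall x (linkSide τ s v i / 2) ∧
        ω.2 ∈ linkCoins τ v i := by
      simp only [linkSet, if_neg hi, Set.mem_prod]
    by_cases h1 : ω.1 ∈ Metric.closedBall x (linkSide τ s v i / 2) <;>
      by_cases h2 : ω.2 ∈ linkCoins τ v i <;> 
      simp only [h1, h2, and_true, and_false, iff_false, iff_true] at this <;>
      simp [h1, h2, this]
  refine (integral_congr_ae (ae_of_all _ e2)).trans ?_
  rw [pairedNodeLaw, integral_prod_mul (fun u => (Metric.closedBall x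
    (linkSide τ s v i / 2)).indicator 1 u * ((p : ℝ) ^ 2 * f u)),
    integral_indicator_one (measurableSet_linkCoins τ v i), linkCoins_real]
  have e3 : ∀ u : Torus m, (Metric.closedBall x (linkSide τ s v i / 2)).indicator (1 : Torus m → ℝ) u *
      ((p : ℝ) ^ 2 * f u) = (p : ℝ) ^ 2 * (volume : Measure (Torus m)).real (Prod.mk u ⁻¹'
        {z : Torus m × Torus m | dist z.1 x ≤ linkSide τ s v i / 2 ∧
          dist z.2 x ≤ linkSide τ s v j / 2 ∧ dist z.2 z.1 ≤ s i j / 2}) := fun u => by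
    by_cases h1 : u ∈ Metric.closedBall x (linkSide τ s v i / 2)
    · rw [Set.indicator_of_mem h1, Pi.one_apply, one_mul]
      refine congrArg (fun t => (p : ℝ) ^ 2 * (volume : Measure (Torus m)).real t) ?_
      ext w
      rw [Metric.mem_closedBall] at h1
      simp [h1]
    · rw [Set.indicator_of_notMem h1, zero_mul]
      have : (Prod.mk u ⁻¹' {z : Torus m × Torus m | dist z.1 x ≤ linkSide τ s v i / 2 ∧
          dist z.2 x ≤ linkSide τ s v j / 2 ∧ dist z.2 z.1 ≤ s i j / 2}) = ∅ := by
        rw [Metric.mem_closedBall] at h1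
        ext w
        simp [h1]
      rw [this]; simp
  simp only [e3]
  rw [integral_const_mul]
  have hm : MeasurableSet {z : Torus m × Torus m | dist z.1 x ≤ linkSide τ s v i / 2 ∧
          dist z.2 x ≤ linkSide τ s v j / 2 ∧ dist z.2 z.1 ≤ s i j / 2} := by
    have h1 : MeasurableSet {z : Torus m × Torus m | dist z.1 x ≤ linkSide τ s v i / 2} :=
      measurableSet_le (by fun_prop) measurable_const
    have h2 : MeasurableSet {z : Torus m × Torus m | dist z.2 x ≤ linkSide τ s v j / 2} :=
      measurableSet_le (by fun_prop) measurable_const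
    have h3 : MeasurableSet {z : Torus m × Torus m | dist z.2 z.1 ≤ s i j / 2} :=
      measurableSet_le (by fun_prop) measurable_const
    exact h1.inter (h2.inter h3)
  have e4 : ∫ u : Torus m, (volume : Measure (Torus m)).real (Prod.mk u ⁻¹'
        {z : Torus m × Torus m | dist z.1 x ≤ linkSide τ s v i / 2 ∧
          dist z.2 x ≤ linkSide τ s v j / 2 ∧ dist z.2 z.1 ≤ s i j / 2}) =
      (volume.prod volume).real {z : Torus m × Torus m |
        dist z.1 x ≤ linkSide τ s v i / 2 ∧ dist z.2 x ≤ linkSide τ s v j / 2 ∧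
        dist z.2 z.1 ≤ s i j / 2} := by
    rw [measureReal_def, Measure.prod_apply hm, ← integral_toReal]
    · rfl
    · exact (measurable_measure_prodMk_left hm).aemeasurable
    · exact ae_of_all _ fun _ => measure_lt_top _ _
  rw [e4]
  ring

end Vertex

end GeoP

namespace GeoP

/-- Makes every set of graphs on a finite vertex set measurable, so events such as a lower bound on
the clustering coefficient need no further argument. -/
instance {V : Type*} [Finite V] : MeasurableSingletonClass (SimpleGraph V) where
  measurableSet_singleton G := by
    have e : ({G} : Set (SimpleGraph V)) = ⋂ a, ⋂ b, {H | H.Adj a b ↔ G.Adj a b} := by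
      ext H
      simp only [Set.mem_singleton_iff, Set.mem_iInter, Set.mem_ofPred_eq]
      exact ⟨fun h a b => by rw [h], fun h => SimpleGraph.ext (by ext a b; exact h a b)⟩
    have hadj (a b : V) : MeasurableSet {H : SimpleGraph V | H.Adj a b} :=
      measurableSet_setOfPred.2 (SimpleGraph.measurable_iff_adj.1 measurable_id a b)
    rw [e]
    refine MeasurableSet.iInter fun a => MeasurableSet.iInter fun b => ?_
    by_cases h : G.Adj a b
    · simpa only [h, iff_true] using hadj a b
    · simp only [h, iff_false]
      exact (hadj a b).compl

/-- With high probability a vertex of a schedule graph has not many more neighbours, and not many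
fewer edges between them, than expected. -/
theorem scheduleGraph_vertex_tail {n m : ℕ} {τ : Fin n → ℕ} (hτ : Function.Injective τ)
    {s : Fin n → Fin n → ℝ} (hs0 : ∀ i j, 0 ≤ s i j) (hs1 : ∀ i j, s i j ≤ 1)
    (p : unitInterval) (v : Fin n) {g : Fin n → Fin n → ℝ}
    (hg : ∀ (x : Torus m) (i j : Fin n), i ≠ v → j ≠ v → τ i < τ j →
      g i j ≤ (volume.prod volume).real {z : Torus m × Torus m |
        dist z.1 x ≤ linkSide τ s v i / 2 ∧ dist z.2 x ≤ linkSide τ s v j / 2 ∧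
        dist z.2 z.1 ≤ s i j / 2})
    {ε B M : ℝ} (hε0 : 0 ≤ ε) (hε1 : ε < 1 / 2) (hB0 : 0 < B) (hM0 : 0 < M)
    (hB : ∑ j, (if j = v then 0 else p * linkSide τ s v j ^ m) ≤ B)
    (hM : M ≤ ∑ j, ∑ i, if τ i < τ j then
      (if i = v ∨ j = v then 0 else (p : ℝ) ^ 3 * g i j) else 0) :
    (Measure.pi fun _ : Fin n => nodeLaw p n m).real
      {Z | ¬ (2 * ((1 - 2 * ε) * M) / ((1 + ε) * B) ^ 2 ≤
        localClustering (scheduleGraph τ s Z) v)}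
      ≤ Real.exp (-(ε ^ 2 * B / 4)) + 2 * Real.exp (-(ε ^ 2 * M / (4 * B))) := by
  classical
  set b := Real.exp (-(ε ^ 2 * B / 4)) + 2 * Real.exp (-(ε ^ 2 * M / (4 * B))) with hb
  have hmS : MeasurableSet {Z : Fin n → Torus m × (Fin n → Bool) |
      ¬ (2 * ((1 - 2 * ε) * M) / ((1 + ε) * B) ^ 2 ≤ localClustering (scheduleGraph τ s Z) v)} :=
    measurable_scheduleGraph τ s (Set.toFinite {G : SimpleGraph (Fin n) |
      ¬ (2 * ((1 - 2 * ε) * M) / ((1 + ε) * B) ^ 2 ≤ localClustering G v)}).measurableSet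
  have hmp := measurePreserving_assemble (m := m) p v
  rw [measureReal_def, ← hmp.measure_preimage hmS.nullMeasurableSet, ← measureReal_def]
  have key := measureReal_prod_le (μ := (volume : Measure (Torus m)))
    (ν := Measure.pi fun _ : Fin n => pairedNodeLaw p n m) (hmp.measurable hmS)
    (g := Set.univ) MeasurableSet.univ (b := b) (by positivity) ?_
  · simpa using key
  intro x _
  have ha0 : ∀ (i : Fin n) ω, (0 : ℝ) ≤ (linkSet τ s v x i).indicator 1 ω := fun i ω =>
    Set.indicator_nonneg (fun _ _ => zero_le_one) _
  have ha1 : ∀ (i : Fin n) ω, (linkSet τ s v x i).indicator 1 ω ≤ (1 : ℝ) := fun i ω =>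
    Set.indicator_le' (fun _ _ => le_rfl) (fun _ _ => zero_le_one) _
  have key := measureReal_quadratic_tail (ν := pairedNodeLaw p n m) hτ
    (a := fun j => (linkSet τ s v x j).indicator 1)
    (e := fun i j ω ω' => (pairSet s m i j).indicator 1 (ω, ω'))
    (fun j => measurable_const.indicator (measurableSet_linkSet τ s v x j)) ha0 ha1
    (fun i j => measurable_const.indicator (measurableSet_pairSet s i j))
    (fun i j ω ω' => Set.indicator_nonneg (fun _ _ => zero_le_one) _)
    (fun i j ω ω' => Set.indicator_le' (fun _ _ => le_rfl) (fun _ _ => zero_le_one) _)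
    hε0 (by linarith) hB0 hM0.le ?_ ?_
  · refine le_trans (measureReal_mono ?_ (measure_ne_top _ _)) key
    rintro ω hω ⟨h1, h2⟩
    refine hω ?_
    refine le_localClustering _ v (by nlinarith) ?_ (h2.trans ?_)
    · refine le_trans (le_of_eq ?_) h1
      rw [ncard_neighborSet_eq_sum]
      refine Finset.sum_congr rfl fun j _ => ?_
      rw [Set.indicator_apply]
      simp only [adj_assemble_iff hτ x ω j, Pi.one_apply]
    · refine le_trans (le_of_eq ?_) (sum_le_ncard_edges_neighborSet _ v τ)
      refine Finset.sum_congr rfl fun j _ => Finset.sum_congr rfl fun i _ => ?_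
      by_cases hij : τ i < τ j
      · rw [if_pos hij, if_pos hij]
        by_cases hi : i = v
        · simp [linkSet, hi]
        by_cases hj : j = v
        · simp [linkSet, hj]
        simp only [Set.indicator_apply, adj_assemble_iff hτ x ω,
          adj_assemble_pair_iff x ω hi hj hij, Pi.one_apply]
      · rw [if_neg hij, if_neg hij]
  · refine le_trans (Finset.sum_le_sum fun j _ => ?_) hB
    by_cases hj : j = v
    · simp [hj, linkSet]
    · rw [if_neg hj, integral_linkSet p x hj]
      · unfold linkSide; split_ifs <;> apply hs0
      · unfold linkSide; split_ifs <;> apply hs1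
  · refine hM.trans (Finset.sum_le_sum fun j _ => Finset.sum_le_sum fun i _ => ?_)
    by_cases hij : τ i < τ j
    · rw [if_pos hij, if_pos hij]
      by_cases hi : i = v
      · simp [hi, linkSet]
      by_cases hj : j = v
      · simp [hj, linkSet]
      rw [if_neg (by tauto), integral_pairSet p x hi hj]
      exact mul_le_mul_of_nonneg_left (hg x i j hi hj hij) (pow_nonneg p.2.1 3)
    · rw [if_neg hij, if_neg hij]

end GeoP

/-! ### Power sums -/

section PowerSums

/-- This bound and the next three compare a sum with an integral by induction. The induction step is
Bernoulli's inequality at k/(k+1) or (k+2)/(k+1), in its concave form for the exponent 1 - a and in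
its convex form for q + 1. -/
theorem sum_rpow_neg_le {a : ℝ} (h0 : 0 < a) (h1 : a < 1) (k : ℕ) :
    ∑ r ∈ Finset.Icc 1 k, (r : ℝ) ^ (-a) ≤ (k : ℝ) ^ (1 - a) / (1 - a) := by
  have ha : 0 < 1 - a := by linarith
  induction k with
  | zero => simp [Real.zero_rpow ha.ne']
  | succ k ih =>
    rw [Finset.sum_Icc_succ_top (by omega)]
    have hk : (0 : ℝ) < k + 1 := by positivity
    have hb := rpow_one_add_le_one_add_mul_self (s := -(1 / ((k : ℝ) + 1))) (p := 1 - a)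
      (by rw [neg_le_neg_iff, div_le_one hk]; linarith [Nat.cast_nonneg (α := ℝ) k])
      ha.le (by linarith)
    have e1 : 1 + -(1 / ((k : ℝ) + 1)) = k / (k + 1) := by field_simp; ring
    rw [e1, Real.div_rpow (Nat.cast_nonneg k) hk.le, div_le_iff₀ (Real.rpow_pos_of_pos hk _)] at hb
    have e2 : ((k : ℝ) + 1) ^ (1 - a) = (k + 1) * ((k : ℝ) + 1) ^ (-a) := by
      rw [sub_eq_add_neg, Real.rpow_add hk, Real.rpow_one]
    have e3 : (1 + (1 - a) * -(1 / ((k : ℝ) + 1))) * ((k : ℝ) + 1) ^ (1 - a) =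
        ((k : ℝ) + 1) ^ (1 - a) - (1 - a) * ((k : ℝ) + 1) ^ (-a) := by
      rw [e2]; field_simp; ring
    rw [e3] at hb
    push_cast
    rw [le_div_iff₀ ha] at ih ⊢
    linarith

theorem le_sum_rpow_neg {a : ℝ} (h0 : 0 < a) (h1 : a < 1) (k : ℕ) :
    (((k : ℝ) + 1) ^ (1 - a) - 1) / (1 - a) ≤ ∑ r ∈ Finset.Icc 1 k, (r : ℝ) ^ (-a) := by
  have ha : 0 < 1 - a := by linarith
  induction k with
  | zero => simp
  | succ k ih =>
    rw [Finset.sum_Icc_succ_top (by omega)]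
    have hk : (0 : ℝ) < k + 1 := by positivity
    have hb := rpow_one_add_le_one_add_mul_self (s := 1 / ((k : ℝ) + 1)) (p := 1 - a)
      (by linarith [show (0 : ℝ) ≤ 1 / ((k : ℝ) + 1) by positivity]) ha.le (by linarith)
    have e1 : 1 + 1 / ((k : ℝ) + 1) = (k + 1 + 1) / (k + 1) := by field_simp
    rw [e1, Real.div_rpow (by positivity) hk.le, div_le_iff₀ (Real.rpow_pos_of_pos hk _)] at hb
    have e2 : ((k : ℝ) + 1) ^ (1 - a) = (k + 1) * ((k : ℝ) + 1) ^ (-a) := by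
      rw [sub_eq_add_neg, Real.rpow_add hk, Real.rpow_one]
    have e3 : (1 + (1 - a) * (1 / ((k : ℝ) + 1))) * ((k : ℝ) + 1) ^ (1 - a) =
        ((k : ℝ) + 1) ^ (1 - a) + (1 - a) * ((k : ℝ) + 1) ^ (-a) := by
      rw [e2]; field_simp
    rw [e3] at hb
    push_cast
    rw [div_le_iff₀ ha] at ih ⊢
    linarith

theorem le_sum_rpow {q : ℝ} (hq : 0 < q) (k : ℕ) :
    (k : ℝ) ^ (q + 1) / (q + 1) ≤ ∑ r ∈ Finset.Icc 1 k, (r : ℝ) ^ q := by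
  have hq1 : 0 < q + 1 := by linarith
  induction k with
  | zero => simp [Real.zero_rpow hq1.ne']
  | succ k ih =>
    rw [Finset.sum_Icc_succ_top (by omega)]
    have hk : (0 : ℝ) < k + 1 := by positivity
    have hb := one_add_mul_self_le_rpow_one_add (s := -(1 / ((k : ℝ) + 1))) (p := q + 1)
      (by rw [neg_le_neg_iff, div_le_one hk]; linarith [Nat.cast_nonneg (α := ℝ) k])
      (by linarith)
    have e1 : 1 + -(1 / ((k : ℝ) + 1)) = k / (k + 1) := by field_simp; ring
    rw [e1, Real.div_rpow (Nat.cast_nonneg k) hk.le, le_div_iff₀ (Real.rpow_pos_of_pos hk _)] at hb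
    have e2 : ((k : ℝ) + 1) ^ (q + 1) = ((k : ℝ) + 1) ^ q * (k + 1) := by
      rw [Real.rpow_add hk, Real.rpow_one]
    have e3 : (1 + (q + 1) * -(1 / ((k : ℝ) + 1))) * ((k : ℝ) + 1) ^ (q + 1) =
        ((k : ℝ) + 1) ^ (q + 1) - (q + 1) * ((k : ℝ) + 1) ^ q := by
      rw [e2]; field_simp; ring
    rw [e3] at hb
    push_cast
    rw [div_le_iff₀ hq1] at ih ⊢
    linarith

theorem sum_rpow_le {q : ℝ} (hq : 0 < q) (k : ℕ) :
    ∑ r ∈ Finset.Icc 1 k, (r : ℝ) ^ q ≤ ((k : ℝ) + 1) ^ (q + 1) / (q + 1) := by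
  have hq1 : 0 < q + 1 := by linarith
  induction k with
  | zero => simp; positivity
  | succ k ih =>
    rw [Finset.sum_Icc_succ_top (by omega)]
    have hk : (0 : ℝ) < k + 1 := by positivity
    have hb := one_add_mul_self_le_rpow_one_add (s := 1 / ((k : ℝ) + 1)) (p := q + 1)
      (by linarith [show (0 : ℝ) ≤ 1 / ((k : ℝ) + 1) by positivity]) (by linarith)
    have e1 : 1 + 1 / ((k : ℝ) + 1) = (k + 1 + 1) / (k + 1) := by field_simp
    rw [e1, Real.div_rpow (by positivity) hk.le, le_div_iff₀ (Real.rpow_pos_of_pos hk _)] at hb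
    have e2 : ((k : ℝ) + 1) ^ (q + 1) = ((k : ℝ) + 1) ^ q * (k + 1) := by
      rw [Real.rpow_add hk, Real.rpow_one]
    have e3 : (1 + (q + 1) * (1 / ((k : ℝ) + 1))) * ((k : ℝ) + 1) ^ (q + 1) =
        ((k : ℝ) + 1) ^ (q + 1) + (q + 1) * ((k : ℝ) + 1) ^ q := by
      rw [e2]; field_simp
    rw [e3] at hb
    push_cast
    rw [le_div_iff₀ hq1] at ih ⊢
    linarith

end PowerSums

/-- The number of ordered pairs in a finite set that is ordered by an injective function. -/
theorem two_mul_sum_card_lt {ι : Type*} [DecidableEq ι] {τ : ι → ℕ} (hτ : Function.Injective τ)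
    (S : Finset ι) :
    2 * ∑ j ∈ S, ∑ i ∈ S, (if τ i < τ j then (1 : ℝ) else 0) = S.card * (S.card - 1) := by
  have h1 : ∑ j ∈ S, ∑ i ∈ S, (if τ i < τ j then (1 : ℝ) else 0) =
      ∑ j ∈ S, ∑ i ∈ S, (if τ j < τ i then (1 : ℝ) else 0) := Finset.sum_comm
  have h2 : ∀ i j, (if τ i < τ j then (1 : ℝ) else 0) + (if τ j < τ i then (1 : ℝ) else 0) =
      1 - if j = i then (1 : ℝ) else 0 := fun i j => by
    by_cases h : j = i
    · simp [h]
    · have : τ i ≠ τ j := fun h' => h (hτ h').symm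
      rcases lt_or_gt_of_ne this with h' | h' <;> simp [h, h', not_lt.2 h'.le]
  calc _ = ∑ j ∈ S, ∑ i ∈ S, (if τ i < τ j then (1 : ℝ) else 0) +
        ∑ j ∈ S, ∑ i ∈ S, (if τ j < τ i then (1 : ℝ) else 0) := by rw [two_mul]; nth_rw 2 [h1]
    _ = ∑ j ∈ S, ∑ i ∈ S, (1 - if j = i then (1 : ℝ) else 0) := by
        simp only [← Finset.sum_add_distrib, h2]
    _ = ∑ j ∈ S, ((S.card : ℝ) - 1) := by
        refine Finset.sum_congr rfl fun j hj => ?_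
        rw [Finset.sum_sub_distrib, Finset.sum_ite_eq, if_pos hj]
        simp
    _ = _ := by simp; ring

namespace GeoP

/-! ### Truncated influence -/

/-- The influence of relative rank `y`, truncated at `δ`. -/
noncomputable def truncInfluence (α δ y : ℝ) : ℝ := max y δ ^ (-α)

section TruncInfluence

variable {α δ : ℝ}

theorem truncInfluence_pos (hδ : 0 < δ) (y : ℝ) : 0 < truncInfluence α δ y :=
  Real.rpow_pos_of_pos (lt_max_of_lt_right hδ) _

theorem truncInfluence_le_rpow (hα : 0 < α) {y : ℝ} (hy : 0 < y) :
    truncInfluence α δ y ≤ y ^ (-α) :=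
  Real.rpow_le_rpow_of_nonpos hy (le_max_left _ _) (by linarith)

theorem truncInfluence_eq {y : ℝ} (h : δ ≤ y) : truncInfluence α δ y = y ^ (-α) := by
  rw [truncInfluence, max_eq_left h]

theorem one_le_truncInfluence (hα : 0 < α) (hδ : 0 < δ) (hδ1 : δ ≤ 1) {y : ℝ} (hy : y ≤ 1) :
    1 ≤ truncInfluence α δ y :=
  Real.one_le_rpow_of_pos_of_le_one_of_nonpos (lt_max_of_lt_right hδ) (max_le hy hδ1)
    (by linarith)

theorem truncInfluence_le (hα : 0 < α) (hδ : 0 < δ) (y : ℝ) :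
    truncInfluence α δ y ≤ δ ^ (-α) :=
  Real.rpow_le_rpow_of_nonpos hδ (le_max_right _ _) (by linarith)

/-- After truncation the argument is at least δ, so an absolute error εδ is a relative error at most
ε. The exponent is less than 1 in modulus, so the influence loses at most the factor 1/(1+ε) ≥ 1 -
ε. -/
theorem truncInfluence_stable (hα : 0 < α) (hα1 : α < 1) (hδ : 0 < δ) {ε x y : ℝ} (hε : 0 ≤ ε)
    (hε1 : ε < 1) (h : |x - y| ≤ ε * δ) :
    (1 - ε) * truncInfluence α δ y ≤ truncInfluence α δ x := by
  have hy : 0 < max y δ := lt_max_of_lt_right hδ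
  have hx : 0 < max x δ := lt_max_of_lt_right hδ
  have h1 : max x δ ≤ (1 + ε) * max y δ := by
    have h2 := (abs_le.1 h).2
    have h3 : ε * δ ≤ ε * max y δ := by gcongr; exact le_max_right _ _
    refine max_le ?_ ?_
    · linarith [le_max_left y δ]
    · nlinarith [le_max_right y δ]
  unfold truncInfluence
  refine le_trans ?_ (Real.rpow_le_rpow_of_nonpos hx h1 (by linarith))
  rw [Real.mul_rpow (by linarith) hy.le]
  gcongr
  rw [Real.rpow_neg (by linarith), ← one_div, le_div_iff₀ (Real.rpow_pos_of_pos (by linarith) _)]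
  have h4 : (1 + ε) ^ α ≤ 1 + ε := by
    conv_rhs => rw [← Real.rpow_one (1 + ε)]
    exact Real.rpow_le_rpow_of_exponent_le (by linarith) hα1.le
  nlinarith

end TruncInfluence

end GeoP

/-! ### Regular schedules: degrees and pairs of neighbours -/

namespace GeoP

open Classical in
/-- The regularity of a birth schedule on which the clustering estimate rests. Node `i` has rank
`ρ i` at its birth and rank `rk i j` just before the birth of a younger node `j`. -/
structure RegularSchedule (α δ ε : ℝ) {n : ℕ} (τ : Fin n → ℕ) (rk : Fin n → Fin n → ℕ)
    (ρ : Fin n → ℕ) : Prop where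
  injective_time : Function.Injective τ
  one_le_rk : ∀ i j, 1 ≤ rk i j
  rk_le : ∀ i j, rk i j ≤ n
  injective_rk : ∀ j, Function.Injective fun i => rk i j
  birth_le : ∀ i, ρ i ≤ n
  drift : ∀ i j, τ i < τ j → |(rk i j : ℝ) - ρ i| ≤ ε * δ * n
  older : ∀ v, |∑ i, (if τ i < τ v then truncInfluence α δ (ρ i / n) else 0) -
    1 / (1 - α) * ∑ i, (if τ i < τ v then (1 : ℝ) else 0)| ≤ ε * n

section Vertex

variable {α δ ε : ℝ} {n : ℕ} {τ : Fin n → ℕ} {rk : Fin n → Fin n → ℕ} {ρ : Fin n → ℕ}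

/-- The price of truncation. Distinct ranks below δn contribute at most the full sum over 1, …,
⌊δn⌋, which is of order δ^(1-α) n because the singularity of order α < 1 is integrable. -/
theorem sum_small_rank_le (hα : 0 < α) (hα1 : α < 1) (hδ : 0 < δ) (hn : 0 < n) {f : Fin n → ℕ}
    (hf : Function.Injective f) (h1 : ∀ i, 1 ≤ f i) :
    ∑ i, (if (f i : ℝ) / n < δ then ((f i : ℝ) / n) ^ (-α) else 0) ≤
      1 / (1 - α) * δ ^ (1 - α) * n := by
  classical
  have hn' : (0 : ℝ) < n := by exact_mod_cast hn
  set k := ⌊δ * n⌋₊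
  rw [← Finset.sum_filter]
  have e : ∑ i ∈ Finset.univ.filter (fun i => (f i : ℝ) / n < δ), ((f i : ℝ) / n) ^ (-α) ≤
      ∑ r ∈ Finset.Icc 1 k, ((r : ℝ) / n) ^ (-α) := by
    rw [← Finset.sum_image (f := fun r : ℕ => ((r : ℝ) / n) ^ (-α)) (g := f)
      (fun a _ b _ h => hf h)]
    refine Finset.sum_le_sum_of_subset_of_nonneg ?_ fun _ _ _ => by positivity
    intro r hr
    obtain ⟨i, hi, rfl⟩ := Finset.mem_image.1 hr
    rw [Finset.mem_filter, div_lt_iff₀ hn'] at hi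
    exact Finset.mem_Icc.2 ⟨h1 i, Nat.le_floor hi.2.le⟩
  refine e.trans ?_
  have e2 : ∀ r : ℕ, ((r : ℝ) / n) ^ (-α) = (r : ℝ) ^ (-α) * (n : ℝ) ^ α := fun r => by
    rw [Real.div_rpow (Nat.cast_nonneg _) hn'.le, Real.rpow_neg hn'.le, div_inv_eq_mul]
  simp only [e2]
  rw [← Finset.sum_mul]
  have h3 := sum_rpow_neg_le hα hα1 k
  have h4 : (k : ℝ) ^ (1 - α) ≤ (δ * n) ^ (1 - α) :=
    Real.rpow_le_rpow (Nat.cast_nonneg _) (Nat.floor_le (by positivity)) (by linarith)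
  calc _ ≤ (δ * n) ^ (1 - α) / (1 - α) * (n : ℝ) ^ α := by
        gcongr
        exact h3.trans (div_le_div_of_nonneg_right h4 (by linarith))
    _ = 1 / (1 - α) * δ ^ (1 - α) * ((n : ℝ) ^ (1 - α) * (n : ℝ) ^ α) := by
        rw [Real.mul_rpow hδ.le hn'.le]; ring
    _ = _ := by rw [← Real.rpow_add hn']; simp

theorem influenceVolume_eq (α β : ℝ) {n : ℕ} (hn : 0 < n) (r : ℕ) :
    influenceVolume α β n r = (n : ℝ) ^ (-α - β) * ((r : ℝ) / n) ^ (-α) := by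
  have hn' : (0 : ℝ) < n := by exact_mod_cast hn
  rw [influenceVolume, Real.div_rpow (Nat.cast_nonneg _) hn'.le, sub_eq_add_neg,
    Real.rpow_add hn']
  have : (n : ℝ) ^ (-α) ≠ 0 := (Real.rpow_pos_of_pos hn' _).ne'
  field_simp

/-- The number of nodes older than `v`. -/
noncomputable def numOlder (τ : Fin n → ℕ) (v : Fin n) : ℝ :=
  ∑ i, if τ i < τ v then (1 : ℝ) else 0

/-- The number of nodes younger than `v`. -/
noncomputable def numYounger (τ : Fin n → ℕ) (v : Fin n) : ℝ :=
  ∑ i, if τ v < τ i then (1 : ℝ) else 0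

theorem numOlder_nonneg (τ : Fin n → ℕ) (v : Fin n) : 0 ≤ numOlder τ v :=
  Finset.sum_nonneg fun _ _ => by split_ifs <;> simp

theorem numYounger_nonneg (τ : Fin n → ℕ) (v : Fin n) : 0 ≤ numYounger τ v :=
  Finset.sum_nonneg fun _ _ => by split_ifs <;> simp

theorem numOlder_add_numYounger (hτ : Function.Injective τ) (v : Fin n) :
    numOlder τ v + numYounger τ v = n - 1 := by
  classical
  have h : ∀ i, (if τ i < τ v then (1 : ℝ) else 0) + (if τ v < τ i then (1 : ℝ) else 0) =
      1 - if v = i then (1 : ℝ) else 0 := fun i => by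
    by_cases h : v = i
    · simp [h]
    · have : τ i ≠ τ v := fun h' => h (hτ h').symm
      rcases lt_or_gt_of_ne this with h' | h' <;> simp [h, h', not_lt.2 h'.le]
  rw [numOlder, numYounger, ← Finset.sum_add_distrib]
  simp only [h, Finset.sum_sub_distrib, Finset.sum_ite_eq]
  simp

/-- The expected degree of `v`, up to normalisation and lower order terms. -/
noncomputable def idealDegree (α : ℝ) (τ : Fin n → ℕ) (ρ : Fin n → ℕ) (v : Fin n) : ℝ :=
  1 / (1 - α) * numOlder τ v + ((ρ v : ℝ) / n) ^ (-α) * numYounger τ v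

theorem RegularSchedule.relative_drift (h : RegularSchedule α δ ε τ rk ρ) (hn : 0 < n)
    {i j : Fin n} (hij : τ i < τ j) : |(rk i j : ℝ) / n - ρ i / n| ≤ ε * δ := by
  have hn' : (0 : ℝ) < n := by exact_mod_cast hn
  rw [← sub_div, abs_div, abs_of_pos hn', div_le_iff₀ hn']
  exact h.drift i j hij

/-- Older neighbours contribute their own influence, controlled by `older` up to the truncation
loss; younger ones contribute the influence of v, which stays close to its birth value. Starting at
relative rank 2δ and drifting by at most εδ, v never enters the truncated range. -/
theorem RegularSchedule.degree_le (h : RegularSchedule α δ ε τ rk ρ) (hα : 0 < α) (hα1 : α < 1)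
    (hδ : 0 < δ) (hδ1 : δ ≤ 1) (hε : 0 < ε) (hε1 : ε ≤ 1 / 24)
    (hδε : 2 * (1 / (1 - α) * δ ^ (1 - α)) ≤ ε) (hn : 2 ≤ n) {v : Fin n}
    (hv : 2 * δ ≤ ρ v / n) :
    ∑ j, (if j = v then 0 else
      (((if τ j < τ v then rk j v else rk v j : ℕ) : ℝ) / n) ^ (-α)) ≤
      (1 + 7 * ε) * idealDegree α τ ρ v := by
  classical
  have hn0 : 0 < n := by omega
  have hn' : (0 : ℝ) < n := by exact_mod_cast hn0
  have hn2 : (2 : ℝ) ≤ n := by exact_mod_cast hn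
  set Q := 1 / (1 - α) with hQ
  have hQ1 : 1 ≤ Q := by rw [hQ, le_div_iff₀ (by linarith)]; linarith
  set P := ((ρ v : ℝ) / n) ^ (-α) with hP
  have hρ1 : (ρ v : ℝ) / n ≤ 1 := by
    rw [div_le_one hn']; exact_mod_cast h.birth_le v
  have hPψ : truncInfluence α δ ((ρ v : ℝ) / n) = P := truncInfluence_eq (by linarith)
  have hP1 : 1 ≤ P := hPψ ▸ one_le_truncInfluence hα hδ hδ1 hρ1
  have hinv : ∀ {a b : ℝ}, (1 - ε) * a ≤ b → 0 ≤ b → a ≤ (1 + 2 * ε) * b := by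
    intro a b hab hb
    have h1 : 1 ≤ (1 - ε) * (1 + 2 * ε) := by nlinarith
    have : (1 - ε) * a ≤ (1 - ε) * ((1 + 2 * ε) * b) := by
      rw [← mul_assoc]; exact hab.trans (le_mul_of_one_le_left hb h1)
    exact le_of_mul_le_mul_left this (by linarith)
  have hterm : ∀ j, (if j = v then (0 : ℝ) else
      (((if τ j < τ v then rk j v else rk v j : ℕ) : ℝ) / n) ^ (-α)) ≤
      ((1 + 2 * ε) * (if τ j < τ v then truncInfluence α δ (ρ j / n) else 0) +
        (if (rk j v : ℝ) / n < δ then ((rk j v : ℝ) / n) ^ (-α) else 0)) +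
      (1 + 2 * ε) * P * (if τ v < τ j then (1 : ℝ) else 0) := by
    intro j
    have hsm : 0 ≤ (if (rk j v : ℝ) / n < δ then ((rk j v : ℝ) / n) ^ (-α) else 0) := by
      split_ifs <;> positivity
    by_cases hj : j = v
    · subst hj
      simpa using hsm
    rw [if_neg hj]
    have hne : τ j ≠ τ v := fun h' => hj (h.injective_time h')
    rcases lt_or_gt_of_ne hne with hlt | hlt
    · rw [if_pos hlt, if_pos hlt, if_neg (not_lt.2 hlt.le), mul_zero, add_zero]
      by_cases hs : (rk j v : ℝ) / n < δ
      · rw [if_pos hs]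
        have := truncInfluence_pos (α := α) hδ ((ρ j : ℝ) / n)
        have : 0 ≤ (1 + 2 * ε) * truncInfluence α δ ((ρ j : ℝ) / n) := by positivity
        linarith
      · rw [if_neg hs, add_zero, ← truncInfluence_eq (not_lt.1 hs)]
        refine hinv (truncInfluence_stable hα hα1 hδ hε.le (by linarith) ?_)
          (truncInfluence_pos hδ _).le
        rw [abs_sub_comm]
        exact h.relative_drift hn0 hlt
    · rw [if_neg (not_lt.2 hlt.le), if_neg (not_lt.2 hlt.le), if_pos hlt, mul_zero, zero_add,
        mul_one]
      have hd := h.relative_drift hn0 hlt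
      have hge : δ ≤ (rk v j : ℝ) / n := by
        have := (abs_le.1 hd).1
        nlinarith
      rw [← truncInfluence_eq hge, ← hPψ]
      have := hinv (truncInfluence_stable hα hα1 hδ hε.le (by linarith)
        (by rw [abs_sub_comm]; exact hd)) (truncInfluence_pos hδ _).le
      linarith
  refine (Finset.sum_le_sum fun j _ => hterm j).trans ?_
  rw [Finset.sum_add_distrib, Finset.sum_add_distrib, ← Finset.mul_sum, ← Finset.mul_sum]
  have h1 := (abs_le.1 (h.older v)).2
  have h2 := sum_small_rank_le hα hα1 hδ hn0 (h.injective_rk v) (fun i => h.one_le_rk i v)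
  have h3 := numOlder_add_numYounger h.injective_time v
  have ho := numOlder_nonneg τ v
  have hy := numYounger_nonneg τ v
  rw [← numOlder] at h1
  rw [← numYounger]
  have hD : (n : ℝ) - 1 ≤ Q * numOlder τ v + P * numYounger τ v := by nlinarith
  unfold idealDegree
  rw [← hQ, ← hP]
  set A := ∑ i, (if τ i < τ v then truncInfluence α δ ((ρ i : ℝ) / n) else 0)
  have h4 : (1 + 2 * ε) * A ≤ (1 + 2 * ε) * (Q * numOlder τ v + ε * n) := by
    gcongr; linarith
  have h5 : Q * δ ^ (1 - α) * n ≤ ε / 2 * n := by gcongr; linarith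
  -- The additive errors total at most 2εn, and n is at most twice the ideal degree since P, Q ≥ 1
  -- and n - 1 ≥ n/2. Together with the factor 1 + 2ε this stays below 1 + 7ε.
  have h6 : (n : ℝ) ≤ 2 * (Q * numOlder τ v + P * numYounger τ v) := by linarith
  have h7 : (1 + 2 * ε) * ε * n + ε / 2 * n ≤ 2 * ε * n := by
    have : (1 + 2 * ε) * ε + ε / 2 ≤ 2 * ε := by nlinarith
    nlinarith
  nlinarith

/-- The heart of the degree comparison: expanding the square gives lQ·Qo² + 2·lP·Qoy + lP·Py². With
l = min(1/P, 1/Q) this bounds the ratio of pair weights to squared degree. -/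
theorem mul_sq_le_of_mul_le_one {Q P o y l : ℝ} (ho : 0 ≤ o) (hy : 0 ≤ y) (hQ : 0 ≤ Q)
    (hP : 0 ≤ P) (hlQ : l * Q ≤ 1) (hlP : l * P ≤ 1) :
    l * (Q * o + P * y) ^ 2 ≤ Q * o ^ 2 + 2 * (Q * o * y) + P * y ^ 2 := by
  have a1 : l * Q * (Q * o ^ 2) ≤ 1 * (Q * o ^ 2) := by gcongr
  have a2 : l * P * (2 * (Q * o * y)) ≤ 1 * (2 * (Q * o * y)) := by gcongr
  have a3 : l * P * (P * y ^ 2) ≤ 1 * (P * y ^ 2) := by gcongr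
  linarith

theorem sq_add_le_weighted {Q P o y : ℝ} (ho : 0 ≤ o) (hy : 0 ≤ y) (hQ : 1 ≤ Q) (hP : 1 ≤ P) :
    (o + y) ^ 2 ≤ Q * o ^ 2 + 2 * (Q * o * y) + P * y ^ 2 := by
  have b1 : 0 ≤ (Q - 1) * o ^ 2 := mul_nonneg (by linarith) (by positivity)
  have b2 : 0 ≤ (Q - 1) * (o * y) := mul_nonneg (by linarith) (by positivity)
  have b3 : 0 ≤ (P - 1) * y ^ 2 := mul_nonneg (by linarith) (by positivity)
  linarith

/-- With o older and y younger nodes, pairs of two older nodes weigh about Qo²/2, mixed pairs Qoy,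
and pairs of two younger nodes Py²/2. In a mixed pair the older member always precedes v, so its
influence counts and P does not enter. -/
theorem RegularSchedule.pairs_ge (h : RegularSchedule α δ ε τ rk ρ) (hα : 0 < α) (hα1 : α < 1)
    (hδ : 0 < δ) (hδ1 : δ ≤ 1) (hε : 0 < ε) (hε1 : ε ≤ 1 / 24) (hn : 2 ≤ n)
    (hbig : 1 / (1 - α) + δ ^ (-α) ≤ ε * n) {v : Fin n}
    (hv : 2 * δ ≤ ρ v / n) :
    (1 - 12 * ε) * (min (((ρ v : ℝ) / n) ^ α) (1 - α) * idealDegree α τ ρ v ^ 2) ≤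
      2 * ∑ j, ∑ i, (if τ i < τ j then (if i = v ∨ j = v then 0 else
        (if τ i < τ v then truncInfluence α δ (ρ i / n) else ((ρ v : ℝ) / n) ^ (-α))) else 0) := by
  classical
  have hn0 : 0 < n := by omega
  have hn' : (0 : ℝ) < n := by exact_mod_cast hn0
  have hn2 : (2 : ℝ) ≤ n := by exact_mod_cast hn
  set Q := 1 / (1 - α) with hQ
  have hQ1 : 1 ≤ Q := by rw [hQ, le_div_iff₀ (by linarith)]; linarith
  set P := ((ρ v : ℝ) / n) ^ (-α) with hP
  have hρ1 : (ρ v : ℝ) / n ≤ 1 := by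
    rw [div_le_one hn']; exact_mod_cast h.birth_le v
  have hρ0 : 0 < (ρ v : ℝ) / n := by linarith
  have hPψ : truncInfluence α δ ((ρ v : ℝ) / n) = P := truncInfluence_eq (by linarith)
  have hP1 : 1 ≤ P := hPψ ▸ one_le_truncInfluence hα hδ hδ1 hρ1
  have hPδ : P ≤ δ ^ (-α) := hPψ ▸ truncInfluence_le hα hδ _
  have h3 := numOlder_add_numYounger h.injective_time v
  have ho := numOlder_nonneg τ v
  have hy := numYounger_nonneg τ v
  set o := numOlder τ v with ho_def
  set y := numYounger τ v with hy_def
  let O : Finset (Fin n) := Finset.univ.filter fun i => τ i < τ v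
  let Y : Finset (Fin n) := Finset.univ.filter fun i => τ v < τ i
  have hOc : (O.card : ℝ) = o := by rw [ho_def, numOlder, Finset.sum_boole]
  have hYc : (Y.card : ℝ) = y := by rw [hy_def, numYounger, Finset.sum_boole]
  have hlow : ∀ j, Q * numOlder τ j - ε * n ≤
      ∑ i, (if τ i < τ j then truncInfluence α δ ((ρ i : ℝ) / n) else 0) := fun j => by
    have := (abs_le.1 (h.older j)).1
    rw [← numOlder] at this
    linarith
  -- contributions by the younger node of the pair
  have hpoint : ∀ j, (if τ j < τ v then Q * numOlder τ j - ε * n else 0) +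
      (if τ v < τ j then Q * o - ε * n + P * ∑ i ∈ Y, (if τ i < τ j then (1 : ℝ) else 0) else 0) ≤
      ∑ i, (if τ i < τ j then (if i = v ∨ j = v then 0 else
        (if τ i < τ v then truncInfluence α δ (ρ i / n) else P)) else 0) := by
    intro j
    by_cases hj : j = v
    · subst hj
      simp
    have hne : τ j ≠ τ v := fun h' => hj (h.injective_time h')
    rcases lt_or_gt_of_ne hne with hlt | hlt
    · rw [if_pos hlt, if_neg (not_lt.2 hlt.le), add_zero]
      refine (hlow j).trans (Finset.sum_le_sum fun i _ => ?_)
      by_cases hi : τ i < τ j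
      · have hiv : τ i < τ v := hi.trans hlt
        have hiv' : i ≠ v := by rintro rfl; exact lt_irrefl _ hiv
        simp [hi, hiv, hiv', hj]
      · simp [hi]
    · rw [if_neg (not_lt.2 hlt.le), if_pos hlt, zero_add]
      have hsum := hlow v
      rw [← ho_def] at hsum
      calc Q * o - ε * n + P * ∑ i ∈ Y, (if τ i < τ j then (1 : ℝ) else 0)
          ≤ ∑ i, (if τ i < τ v then truncInfluence α δ ((ρ i : ℝ) / n) else 0) +
            ∑ i, (if τ v < τ i then P * (if τ i < τ j then (1 : ℝ) else 0) else 0) := by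
              rw [Finset.mul_sum, ← Finset.sum_filter (p := fun i => τ v < τ i)]
              linarith
        _ = _ := by
              rw [← Finset.sum_add_distrib]
              refine Finset.sum_congr rfl fun i _ => ?_
              by_cases hiv : i = v
              · subst hiv; simp
              have hne' : τ i ≠ τ v := fun h' => hiv (h.injective_time h')
              rcases lt_or_gt_of_ne hne' with hl | hl
              · simp [hl, hl.trans hlt, not_lt.2 hl.le, hiv, hj]
              · by_cases hij : τ i < τ j <;> simp [hl, not_lt.2 hl.le, hiv, hj, hij]
  have hOO : 2 * ∑ j ∈ O, numOlder τ j = o * (o - 1) := by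
    rw [← hOc, ← two_mul_sum_card_lt h.injective_time O]
    congr 1
    refine Finset.sum_congr rfl fun j hj => ?_
    have hj' : τ j < τ v := (Finset.mem_filter.1 hj).2
    rw [numOlder, Finset.sum_filter]
    refine Finset.sum_congr rfl fun i _ => ?_
    by_cases hi : τ i < τ j
    · simp [hi, hi.trans hj']
    · simp [hi]
  have hYY := two_mul_sum_card_lt h.injective_time Y
  rw [hYc] at hYY
  have hlowsum : Q * (o * (o - 1)) + 2 * (Q * o * y) + P * (y * (y - 1)) -
      2 * (ε * n * (o + y)) ≤
      2 * ∑ j, ∑ i, (if τ i < τ j then (if i = v ∨ j = v then 0 else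
        (if τ i < τ v then truncInfluence α δ (ρ i / n) else P)) else 0) := by
    have e1 : ∑ j, (if τ j < τ v then Q * numOlder τ j - ε * n else 0) =
        Q * ∑ j ∈ O, numOlder τ j - o * (ε * n) := by
      rw [← Finset.sum_filter, Finset.sum_sub_distrib, ← Finset.mul_sum, Finset.sum_const,
        nsmul_eq_mul, ← hOc]
    have e2 : ∑ j, (if τ v < τ j then
        Q * o - ε * n + P * ∑ i ∈ Y, (if τ i < τ j then (1 : ℝ) else 0) else 0) =
        y * (Q * o - ε * n) + P * ∑ j ∈ Y, ∑ i ∈ Y, (if τ i < τ j then (1 : ℝ) else 0) := by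
      rw [← Finset.sum_filter, Finset.sum_add_distrib, ← Finset.mul_sum, Finset.sum_const,
        nsmul_eq_mul, ← hYc]
    refine le_trans (le_of_eq ?_)
      (mul_le_mul_of_nonneg_left (Finset.sum_le_sum fun j _ => hpoint j) zero_le_two)
    rw [Finset.sum_add_distrib, e1, e2]
    linear_combination (-Q) * hOO - P * hYY
  refine le_trans ?_ hlowsum
  -- the comparison with the square of the degree
  set lam := min (((ρ v : ℝ) / n) ^ α) (1 - α) with hlam
  have hPinv : ((ρ v : ℝ) / n) ^ α = 1 / P := by
    rw [hP, Real.rpow_neg hρ0.le, one_div, inv_inv]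
  have hlam0 : 0 ≤ lam := le_min (Real.rpow_nonneg hρ0.le _) (by linarith)
  have hlamP : lam * P ≤ 1 := by
    have : lam ≤ 1 / P := hPinv ▸ min_le_left _ _
    rwa [le_div_iff₀ (by linarith)] at this
  have hlamQ : lam * Q ≤ 1 := by
    have : lam ≤ 1 - α := min_le_right _ _
    rw [hQ, mul_one_div, div_le_one (by linarith)]
    exact this
  have hA : lam * (Q * o + P * y) ^ 2 ≤ Q * o ^ 2 + 2 * (Q * o * y) + P * y ^ 2 :=
    mul_sq_le_of_mul_le_one ho hy (by linarith) (by linarith) hlamQ hlamP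
  -- The diagonal terms cost at most εn² by `hbig`, and the errors in `older` at most 2εn². In total
  -- 3εn² is at most 12ε times the main term, which explains the factor 1 - 12ε.
  have hA1 : (n : ℝ) ^ 2 ≤ 4 * (Q * o ^ 2 + 2 * (Q * o * y) + P * y ^ 2) := by
    have a1 := sq_add_le_weighted ho hy hQ1 hP1
    rw [h3] at a1
    have a2 : (n : ℝ) ^ 2 ≤ 4 * ((n : ℝ) - 1) ^ 2 := by
      have : (n : ℝ) ≤ 2 * (n - 1) := by linarith
      calc (n : ℝ) ^ 2 ≤ (2 * (n - 1)) ^ 2 := by gcongr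
        _ = _ := by ring
    linarith
  have hsmall : Q * o + P * y ≤ ε * n * n := by
    have b1 : Q * o + P * y ≤ (Q + P) * n := by
      have c1 : Q * o ≤ Q * n := by gcongr; linarith
      have c2 : P * y ≤ P * n := by gcongr; linarith
      linarith
    have b2 : (Q + P) * n ≤ ε * n * n := by gcongr; linarith
    linarith
  have hoy : ε * n * (o + y) ≤ ε * n * n := by gcongr; linarith
  have hdeg : idealDegree α τ ρ v = Q * o + P * y := rfl
  have e : Q * (o * (o - 1)) + 2 * (Q * o * y) + P * (y * (y - 1)) - 2 * (ε * n * (o + y)) =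
      (Q * o ^ 2 + 2 * (Q * o * y) + P * y ^ 2) - (Q * o + P * y) - 2 * (ε * n * (o + y)) := by
    ring
  rw [hdeg, e]
  generalize Q * o ^ 2 + 2 * (Q * o * y) + P * y ^ 2 = A at hA hA1 ⊢
  generalize ε * n * (o + y) = E at hoy ⊢
  generalize lam * (Q * o + P * y) ^ 2 = F at hA ⊢
  have hAe : ε * (n : ℝ) ^ 2 ≤ ε * (4 * A) := by gcongr
  have := mul_le_mul_of_nonneg_left hA (by linarith : 0 ≤ 1 - 12 * ε)
  linarith [show ε * n * n = ε * (n : ℝ) ^ 2 by ring]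

end Vertex

end GeoP

/-! ### Clustering of a random graph along a regular schedule -/

namespace GeoP

/-- The side of the influence region of a node of rank `r`. -/
noncomputable def influenceSide (α β : ℝ) (n m r : ℕ) : ℝ :=
  influenceVolume α β n r ^ (1 / (m : ℝ))

section Side

variable {α β : ℝ} {n m : ℕ}

theorem influenceVolume_nonneg (α β : ℝ) (n r : ℕ) : 0 ≤ influenceVolume α β n r := by
  unfold influenceVolume; positivity

theorem influenceVolume_le_one (hα : 0 ≤ α) (hβ : 0 ≤ β) {r : ℕ} (hn : 1 ≤ n) (hr : 1 ≤ r) :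
    influenceVolume α β n r ≤ 1 := by
  unfold influenceVolume
  exact mul_le_one₀ (Real.rpow_le_one_of_one_le_of_nonpos (by exact_mod_cast hr) (by linarith))
    (by positivity) (Real.rpow_le_one_of_one_le_of_nonpos (by exact_mod_cast hn) (by linarith))

theorem influenceSide_nonneg (α β : ℝ) (n m r : ℕ) : 0 ≤ influenceSide α β n m r :=
  Real.rpow_nonneg (influenceVolume_nonneg α β n r) _

theorem influenceSide_le_one (hα : 0 ≤ α) (hβ : 0 ≤ β) {r : ℕ} (hn : 1 ≤ n) (hr : 1 ≤ r) :
    influenceSide α β n m r ≤ 1 :=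
  Real.rpow_le_one (influenceVolume_nonneg α β n r) (influenceVolume_le_one hα hβ hn hr)
    (by positivity)

theorem rpow_one_div_pow {x : ℝ} (hx : 0 ≤ x) (hm : 1 ≤ m) : (x ^ (1 / (m : ℝ))) ^ m = x := by
  rw [one_div, Real.rpow_inv_natCast_pow hx (by omega)]

theorem influenceSide_pow (hm : 1 ≤ m) (r : ℕ) :
    influenceSide α β n m r ^ m = influenceVolume α β n r :=
  rpow_one_div_pow (influenceVolume_nonneg α β n r) hm

theorem rpow_one_div_le_influenceSide {x : ℝ} (hx : 0 ≤ x) {r : ℕ}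
    (h : x ≤ influenceVolume α β n r) : x ^ (1 / (m : ℝ)) ≤ influenceSide α β n m r :=
  Real.rpow_le_rpow hx h (by positivity)

end Side

theorem one_sub_mul_le_ratio {ε : ℝ} (h0 : 0 ≤ ε) (h1 : ε ≤ 1 / 40) :
    (1 - 40 * ε) * ((1 + ε) * (1 + 7 * ε)) ^ 2 ≤ (1 - 2 * ε) * ((1 - ε) ^ 2 * (1 - 12 * ε)) := by
  have a1 : (1 + ε) * (1 + 7 * ε) ≤ 1 + 9 * ε := by nlinarith
  have a2 : ((1 + ε) * (1 + 7 * ε)) ^ 2 ≤ 1 + 21 * ε := by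
    calc ((1 + ε) * (1 + 7 * ε)) ^ 2 ≤ (1 + 9 * ε) ^ 2 := by gcongr
      _ ≤ _ := by nlinarith
  have a3 : (1 - 40 * ε) * ((1 + ε) * (1 + 7 * ε)) ^ 2 ≤ (1 - 40 * ε) * (1 + 21 * ε) :=
    mul_le_mul_of_nonneg_left a2 (by linarith)
  have a4 : 1 - 2 * ε ≤ (1 - ε) ^ 2 := by nlinarith
  have a5 : (1 - 2 * ε) * (1 - 12 * ε) ≤ (1 - ε) ^ 2 * (1 - 12 * ε) :=
    mul_le_mul_of_nonneg_right a4 (by linarith)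
  have a6 : 1 - 14 * ε ≤ (1 - ε) ^ 2 * (1 - 12 * ε) := by nlinarith
  have a7 : (1 - 2 * ε) * (1 - 14 * ε) ≤ (1 - 2 * ε) * ((1 - ε) ^ 2 * (1 - 12 * ε)) :=
    mul_le_mul_of_nonneg_left a6 (by linarith)
  nlinarith

section Vertex

variable {α β δ ε : ℝ} {n m : ℕ} {τ : Fin n → ℕ} {rk : Fin n → Fin n → ℕ} {ρ : Fin n → ℕ}

theorem linkSide_influenceSide (τ : Fin n → ℕ) (rk : Fin n → Fin n → ℕ) (v j : Fin n) :
    linkSide τ (fun i j => influenceSide α β n m (rk i j)) v j =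
      influenceSide α β n m (if τ j < τ v then rk j v else rk v j) := by
  unfold linkSide; split_ifs <;> rfl

/-- If i is older than v, the cube of i decides both vi and ij, and the cube deciding vj has volume
at least u: the wide overlap applies. Otherwise v is oldest, its cube decides vi and vj, and the
cube of i for ij has volume at least u: the narrow overlap applies. Shrinking all volumes by 1 - ε
covers the drift and keeps the narrow side below the wide one. -/
theorem RegularSchedule.overlap_ge (h : RegularSchedule α δ ε τ rk ρ) (hα : 0 < α) (hα1 : α < 1)
    (hβ : 0 < β) (hδ : 0 < δ) (hδ1 : δ ≤ 1) (hε : 0 < ε) (hε1 : ε ≤ 1 / 40) (hn : 2 ≤ n)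
    (hm : 1 ≤ m) {v : Fin n} (hv : 2 * δ ≤ ρ v / n) (x : Torus m) {i j : Fin n} (hi : i ≠ v)
    (hij : τ i < τ j) :
    (3 / 4) ^ m * (((1 - ε) * (n : ℝ) ^ (-α - β)) ^ 2 *
      (if τ i < τ v then truncInfluence α δ (ρ i / n) else ((ρ v : ℝ) / n) ^ (-α))) ≤
    (volume.prod volume).real {z : Torus m × Torus m |
      dist z.1 x ≤ linkSide τ (fun i j => influenceSide α β n m (rk i j)) v i / 2 ∧
      dist z.2 x ≤ linkSide τ (fun i j => influenceSide α β n m (rk i j)) v j / 2 ∧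
      dist z.2 z.1 ≤ influenceSide α β n m (rk i j) / 2} := by
  have hn0 : 0 < n := by omega
  have hn' : (0 : ℝ) < n := by exact_mod_cast hn0
  set u := (n : ℝ) ^ (-α - β) with hu
  have hu0 : 0 < u := Real.rpow_pos_of_pos hn' _
  have hq : 0 < (1 - ε) * u := mul_pos (by linarith) hu0
  have hrel : ∀ {r : ℕ}, r ≤ n → (r : ℝ) / n ≤ 1 := fun hr => by
    rw [div_le_one hn']; exact_mod_cast hr
  have hvol : ∀ {r : ℕ}, 1 ≤ r → u * truncInfluence α δ ((r : ℝ) / n) ≤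
      influenceVolume α β n r := fun {r} hr => by
    rw [influenceVolume_eq α β hn0]
    have : (0 : ℝ) < r := by exact_mod_cast hr
    exact mul_le_mul_of_nonneg_left (truncInfluence_le_rpow hα (by positivity)) hu0.le
  have hmin : ∀ {r : ℕ}, 1 ≤ r → r ≤ n → (1 - ε) * u ≤ influenceVolume α β n r := fun hr hrn => by
    refine le_trans ?_ (hvol hr)
    have := one_le_truncInfluence hα hδ hδ1 (hrel hrn)
    nlinarith
  have hrk1 : ∀ a b : Fin n, 1 ≤ (if τ a < τ v then rk a b else rk b a) := fun a b => by
    split_ifs <;> apply h.one_le_rk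
  have hrkn : ∀ a b : Fin n, (if τ a < τ v then rk a b else rk b a) ≤ n := fun a b => by
    split_ifs <;> apply h.rk_le
  have hstep : ∀ a b : Fin n, τ a < τ b →
      (1 - ε) * u * truncInfluence α δ ((ρ a : ℝ) / n) ≤ influenceVolume α β n (rk a b) := by
    intro a b hab
    refine le_trans ?_ (hvol (h.one_le_rk a b))
    have := truncInfluence_stable hα hα1 hδ hε.le (by linarith) (h.relative_drift hn0 hab)
    nlinarith
  have main : ∀ t : ℝ, 1 ≤ t → (1 - ε) * u * t ≤ 1 →
      ((3 / 4) ^ m * (((1 - ε) * u) ^ 2 * t) =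
        (3 / 4) ^ m * ((((1 - ε) * u * t) ^ (1 / (m : ℝ))) ^ m *
          (((1 - ε) * u) ^ (1 / (m : ℝ))) ^ m)) ∧
      (0 ≤ ((1 - ε) * u) ^ (1 / (m : ℝ))) ∧
      (((1 - ε) * u) ^ (1 / (m : ℝ)) ≤ ((1 - ε) * u * t) ^ (1 / (m : ℝ))) ∧
      ((1 - ε) * u * t) ^ (1 / (m : ℝ)) ≤ 1 := by
    intro t ht ht1
    refine ⟨?_, by positivity, ?_, Real.rpow_le_one (by positivity) ht1 (by positivity)⟩
    · rw [rpow_one_div_pow (by positivity) hm, rpow_one_div_pow hq.le hm]; ring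
    · exact Real.rpow_le_rpow hq.le (by nlinarith) (by positivity)
  have toReal : ∀ {a : ℝ} {S : Set (Torus m × Torus m)},
      ENNReal.ofReal a ≤ (volume.prod volume) S → a ≤ (volume.prod volume).real S := by
    intro a S hS
    exact (ENNReal.ofReal_le_iff_le_toReal (measure_ne_top _ _)).1 hS
  have hside : ∀ {y : ℝ} {r : ℕ}, 0 ≤ y → y ≤ influenceVolume α β n r →
      y ^ (1 / (m : ℝ)) / 2 ≤ influenceSide α β n m r / 2 := fun hy hr =>
    div_le_div_of_nonneg_right (rpow_one_div_le_influenceSide hy hr) zero_le_two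
  rw [linkSide_influenceSide, linkSide_influenceSide]
  by_cases hiv : τ i < τ v
  · simp only [if_pos hiv]
    obtain ⟨e, h0, h1, h2⟩ := main (truncInfluence α δ (ρ i / n))
      (one_le_truncInfluence hα hδ hδ1 (hrel (h.birth_le i)))
      ((hstep i j hij).trans (influenceVolume_le_one hα.le hβ.le hn0 (h.one_le_rk i j)))
    rw [e]
    refine (toReal (torus_overlap_wide x h0 h1 h2)).trans
      (measureReal_mono (fun z hz => ?_) (measure_ne_top _ _))
    obtain ⟨z1, z2, z3⟩ := hz
    have hpos : 0 ≤ (1 - ε) * u * truncInfluence α δ (ρ i / n) :=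
      mul_nonneg hq.le (truncInfluence_pos hδ _).le
    exact ⟨z1.trans (hside hpos (hstep i v hiv)),
      z2.trans (hside hq.le (hmin (hrk1 j v) (hrkn j v))),
      z3.trans (hside hpos (hstep i j hij))⟩
  · have hvi : τ v < τ i := lt_of_le_of_ne (not_lt.1 hiv) fun h' => hi (h.injective_time h').symm
    have hvj : τ v < τ j := hvi.trans hij
    simp only [if_neg hiv, if_neg (not_lt.2 hvj.le)]
    rw [← truncInfluence_eq (show δ ≤ (ρ v : ℝ) / n by linarith)]
    obtain ⟨e, h0, h1, h2⟩ := main (truncInfluence α δ (ρ v / n))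
      (one_le_truncInfluence hα hδ hδ1 (hrel (h.birth_le v)))
      ((hstep v j hvj).trans (influenceVolume_le_one hα.le hβ.le hn0 (h.one_le_rk v j)))
    rw [e]
    refine (toReal (torus_overlap_narrow x h0 h1 h2)).trans
      (measureReal_mono (fun z hz => ?_) (measure_ne_top _ _))
    obtain ⟨z1, z2, z3⟩ := hz
    have hpos : 0 ≤ (1 - ε) * u * truncInfluence α δ (ρ v / n) :=
      mul_nonneg hq.le (truncInfluence_pos hδ _).le
    exact ⟨z1.trans (hside hpos (hstep v i hvi)),
      z2.trans (hside hpos (hstep v j hvj)),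
      z3.trans (hside hq.le (hmin (h.one_le_rk i j) (h.rk_le i j)))⟩

/-- B is the upper bound on the mean degree and M the lower bound on the mean number of edges among
neighbours. Up to the factors in ε, 2M/B² is p (3/4)^m times the minimum, since the powers of u and
of the ideal degree cancel. -/
theorem RegularSchedule.vertex_tail (h : RegularSchedule α δ ε τ rk ρ) (hα : 0 < α) (hα1 : α < 1)
    (hβ : 0 < β) (p : unitInterval) (hp : 0 < p) (hδ : 0 < δ) (hδ1 : δ ≤ 1) (hε : 0 < ε)
    (hε1 : ε ≤ 1 / 40) (hδε : 2 * (1 / (1 - α) * δ ^ (1 - α)) ≤ ε) (hn : 2 ≤ n) (hm : 1 ≤ m)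
    (hbig : 1 / (1 - α) + δ ^ (-α) ≤ ε * n) {v : Fin n} (hv : 2 * δ ≤ ρ v / n) :
    (Measure.pi fun _ : Fin n => nodeLaw p n m).real
      {Z | ¬ ((1 - 40 * ε) * (p * (3 / 4) ^ m * min (((ρ v : ℝ) / n) ^ α) (1 - α)) ≤
        localClustering
          (scheduleGraph τ (fun i j => influenceSide α β n m (rk i j)) Z) v)} ≤
      3 * Real.exp (-(ε ^ 2 * (p : ℝ) ^ 2 * (δ ^ α * (1 - α)) / 128 *
        ((n : ℝ) ^ (1 - α - β) * (3 / 4) ^ m))) := by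
  have hn0 : 0 < n := by omega
  have hn' : (0 : ℝ) < n := by exact_mod_cast hn0
  have hn2 : (2 : ℝ) ≤ n := by exact_mod_cast hn
  have hp0 : (0 : ℝ) < p := hp
  have hp1 : (p : ℝ) ≤ 1 := p.2.2
  set u := (n : ℝ) ^ (-α - β) with hu
  have hu0 : 0 < u := Real.rpow_pos_of_pos hn' _
  set D := idealDegree α τ ρ v with hD
  set l := min (((ρ v : ℝ) / n) ^ α) (1 - α) with hl
  have hρ1 : (ρ v : ℝ) / n ≤ 1 := by
    rw [div_le_one hn']; exact_mod_cast h.birth_le v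
  have hρ0 : 0 < (ρ v : ℝ) / n := by linarith
  have hδα : 0 < δ ^ α := Real.rpow_pos_of_pos hδ _
  have hδα1 : δ ^ α ≤ 1 := Real.rpow_le_one hδ.le hδ1 hα.le
  have hlδ : δ ^ α * (1 - α) ≤ l := by
    refine le_min ?_ ?_
    · calc δ ^ α * (1 - α) ≤ δ ^ α := mul_le_of_le_one_right hδα.le (by linarith)
        _ ≤ _ := Real.rpow_le_rpow hδ.le (by linarith) hα.le
    · exact mul_le_of_le_one_left (by linarith) hδα1
  have hl0 : 0 < l := lt_of_lt_of_le (mul_pos hδα (by linarith)) hlδ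
  have hl1 : l ≤ 1 := (min_le_right _ _).trans (by linarith)
  have hDn : (n : ℝ) / 2 ≤ D := by
    have h3 := numOlder_add_numYounger h.injective_time v
    have ho := numOlder_nonneg τ v
    have hy := numYounger_nonneg τ v
    have hQ1 : 1 ≤ 1 / (1 - α) := by rw [le_div_iff₀ (by linarith)]; linarith
    have hP1 : 1 ≤ ((ρ v : ℝ) / n) ^ (-α) :=
      Real.one_le_rpow_of_pos_of_le_one_of_nonpos hρ0 hρ1 (by linarith)
    have a1 : numOlder τ v ≤ 1 / (1 - α) * numOlder τ v := le_mul_of_one_le_left ho hQ1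
    have a2 : numYounger τ v ≤ ((ρ v : ℝ) / n) ^ (-α) * numYounger τ v :=
      le_mul_of_one_le_left hy hP1
    rw [hD, idealDegree]
    linarith
  have hD0 : 0 < D := by linarith
  have h34 : (0 : ℝ) < (3 / 4) ^ m := by positivity
  have h341 : ((3 : ℝ) / 4) ^ m ≤ 1 := pow_le_one₀ (by norm_num) (by norm_num)
  set B := p * u * ((1 + 7 * ε) * D) with hB
  set M := (p : ℝ) ^ 3 * ((3 / 4) ^ m * ((1 - ε) * u) ^ 2) * ((1 - 12 * ε) * (l * D ^ 2) / 2)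
    with hM
  have hε12 : 0 < 1 - 12 * ε := by linarith
  have hε11 : 0 < 1 - ε := by linarith
  have hB0 : 0 < B := by positivity
  have hM0 : 0 < M := by positivity
  have key := scheduleGraph_vertex_tail h.injective_time
    (s := fun i j => influenceSide α β n m (rk i j))
    (fun i j => influenceSide_nonneg α β n m _)
    (fun i j => influenceSide_le_one hα.le hβ.le hn0 (h.one_le_rk i j)) p v
    (g := fun i _ => (3 / 4) ^ m * (((1 - ε) * u) ^ 2 *
      (if τ i < τ v then truncInfluence α δ (ρ i / n) else ((ρ v : ℝ) / n) ^ (-α))))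
    (fun x i j hi _ hij => h.overlap_ge hα hα1 hβ hδ hδ1 hε hε1 hn hm hv x hi hij)
    (ε := ε) (B := B) (M := M) hε.le (by linarith) hB0 hM0 ?_ ?_
  · refine le_trans (measureReal_mono (fun Z hZ hcon => hZ (le_trans ?_ hcon))
      (measure_ne_top _ _)) (key.trans ?_)
    · rw [le_div_iff₀ (by positivity)]
      have := mul_le_mul_of_nonneg_left (one_sub_mul_le_ratio hε.le hε1)
        (show 0 ≤ (p : ℝ) ^ 3 * (3 / 4) ^ m * l * u ^ 2 * D ^ 2 by positivity)
      calc _ = (p : ℝ) ^ 3 * (3 / 4) ^ m * l * u ^ 2 * D ^ 2 *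
            ((1 - 40 * ε) * ((1 + ε) * (1 + 7 * ε)) ^ 2) := by rw [hB]; ring
        _ ≤ _ := this
        _ = _ := by rw [hM]; ring
    · have hγ : (n : ℝ) ^ (1 - α - β) = u * n := by
        rw [hu, show 1 - α - β = (-α - β) + 1 by ring, Real.rpow_add hn', Real.rpow_one]
      -- A common lower bound for the exponents ε²B/4 and ε²M/(4B). It uses that the ideal degree is
      -- at least n/2 and that the minimum is at least δ^α (1-α).
      set X := ε ^ 2 * (p : ℝ) ^ 2 * (δ ^ α * (1 - α)) / 128 *
        ((n : ℝ) ^ (1 - α - β) * (3 / 4) ^ m) with hX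
      have hX1 : X ≤ ε ^ 2 * B / 4 := by
        have b1 : (p : ℝ) ^ 2 ≤ p := pow_le_of_le_one hp0.le hp1 two_ne_zero
        have b2 : δ ^ α * (1 - α) ≤ 1 := hlδ.trans hl1
        have b3 : (n : ℝ) / 2 ≤ (1 + 7 * ε) * D :=
          hDn.trans (le_mul_of_one_le_left hD0.le (by linarith))
        have b4 : (p : ℝ) ^ 2 * (δ ^ α * (1 - α)) * (3 / 4) ^ m ≤ p * 1 * 1 := by gcongr
        calc X = ε ^ 2 / 128 * (u * n) * ((p : ℝ) ^ 2 * (δ ^ α * (1 - α)) * (3 / 4) ^ m) := by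
              rw [hX, hγ]; ring
          _ ≤ ε ^ 2 / 128 * (u * n) * (p * 1 * 1) := by gcongr
          _ = ε ^ 2 * (p * u * (n / 2)) / 64 := by ring
          _ ≤ ε ^ 2 * (p * u * ((1 + 7 * ε) * D)) / 64 := by gcongr
          _ ≤ ε ^ 2 * (p * u * ((1 + 7 * ε) * D)) / 4 := by gcongr; norm_num
      have hX2 : X ≤ ε ^ 2 * M / (4 * B) := by
        rw [le_div_iff₀ (by positivity)]
        have c1 : (1 : ℝ) / 2 ≤ (1 - ε) ^ 2 :=
          calc (1 : ℝ) / 2 ≤ (39 / 40) ^ 2 := by norm_num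
            _ ≤ (1 - ε) ^ 2 := by gcongr; linarith
        have c2 : (1 : ℝ) / 2 ≤ 1 - 12 * ε := by linarith
        have c3 : 1 + 7 * ε ≤ 2 := by linarith
        calc X * (4 * B) = ε ^ 2 * (p : ℝ) ^ 3 * (3 / 4) ^ m * u ^ 2 * D / 32 *
              ((δ ^ α * (1 - α)) * n * (1 + 7 * ε)) := by rw [hX, hγ, hB]; ring
          _ ≤ ε ^ 2 * (p : ℝ) ^ 3 * (3 / 4) ^ m * u ^ 2 * D / 32 * (l * (2 * D) * 2) := by
              gcongr; linarith
          _ = ε ^ 2 * ((p : ℝ) ^ 3 * ((3 / 4) ^ m * u ^ 2) * (l * D ^ 2) / 2) *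
              (1 / 2 * (1 / 2)) := by ring
          _ ≤ ε ^ 2 * ((p : ℝ) ^ 3 * ((3 / 4) ^ m * u ^ 2) * (l * D ^ 2) / 2) *
              ((1 - ε) ^ 2 * (1 - 12 * ε)) := by gcongr
          _ = ε ^ 2 * M := by rw [hM]; ring
      have y1 := Real.exp_le_exp.2 (neg_le_neg hX1)
      have y2 := Real.exp_le_exp.2 (neg_le_neg hX2)
      linarith
  · have hdeg := h.degree_le hα hα1 hδ hδ1 hε (by linarith) hδε hn hv
    calc _ = p * u * ∑ j, (if j = v then 0 else
          (((if τ j < τ v then rk j v else rk v j : ℕ) : ℝ) / n) ^ (-α)) := by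
          rw [Finset.mul_sum]
          refine Finset.sum_congr rfl fun j _ => ?_
          by_cases hj : j = v
          · simp [hj]
          · rw [if_neg hj, if_neg hj, linkSide_influenceSide, influenceSide_pow hm,
              influenceVolume_eq α β hn0]
            ring
      _ ≤ p * u * ((1 + 7 * ε) * D) := by gcongr
  · have hpair := h.pairs_ge hα hα1 hδ hδ1 hε (by linarith) hn hbig hv
    calc M ≤ (p : ℝ) ^ 3 * ((3 / 4) ^ m * ((1 - ε) * u) ^ 2) *
          ∑ j, ∑ i, (if τ i < τ j then (if i = v ∨ j = v then 0 else
        (if τ i < τ v then truncInfluence α δ (ρ i / n) else ((ρ v : ℝ) / n) ^ (-α))) else 0) := by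
          rw [hM]
          gcongr
          linarith
      _ = _ := by
          rw [Finset.mul_sum]
          refine Finset.sum_congr rfl fun j _ => ?_
          rw [Finset.mul_sum]
          refine Finset.sum_congr rfl fun i _ => ?_
          split_ifs <;> ring

/-- The clustering coefficient of the random graph along a regular schedule. -/
theorem RegularSchedule.clustering_tail (h : RegularSchedule α δ ε τ rk ρ) (hα : 0 < α)
    (hα1 : α < 1) (hβ : 0 < β) (p : unitInterval) (hp : 0 < p) (hδ : 0 < δ) (hδ1 : δ ≤ 1)
    (hε : 0 < ε) (hε1 : ε ≤ 1 / 40) (hδε : 2 * (1 / (1 - α) * δ ^ (1 - α)) ≤ ε) (hn : 2 ≤ n)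
    (hm : 1 ≤ m) (hbig : 1 / (1 - α) + δ ^ (-α) ≤ ε * n) {I : ℝ}
    (hI : I * n ≤ ∑ v, min (((ρ v : ℝ) / n) ^ α) (1 - α)) :
    (Measure.pi fun _ : Fin n => nodeLaw p n m).real
      {Z | ¬ ((1 - 40 * ε) * (p * (3 / 4) ^ m * (I - (2 * δ) ^ α)) ≤ clusteringCoeff
          (scheduleGraph τ (fun i j => influenceSide α β n m (rk i j)) Z))} ≤
      n * (3 * Real.exp (-(ε ^ 2 * (p : ℝ) ^ 2 * (δ ^ α * (1 - α)) / 128 *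
        ((n : ℝ) ^ (1 - α - β) * (3 / 4) ^ m)))) := by
  have hn0 : 0 < n := by omega
  have hn' : (0 : ℝ) < n := by exact_mod_cast hn0
  have hp0 : (0 : ℝ) < p := hp
  set E := 3 * Real.exp (-(ε ^ 2 * (p : ℝ) ^ 2 * (δ ^ α * (1 - α)) / 128 *
        ((n : ℝ) ^ (1 - α - β) * (3 / 4) ^ m))) with hE
  -- Only vertices of relative birth rank at least 2δ can be bad. For the others the profile is
  -- below (2δ)^α, so after subtracting (2δ)^α their required share is nonpositive.
  let bad : Fin n → Set (Fin n → Torus m × (Fin n → Bool)) := fun v =>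
    {Z | 2 * δ ≤ ρ v / n ∧ ¬ ((1 - 40 * ε) * (p * (3 / 4) ^ m * min (((ρ v : ℝ) / n) ^ α) (1 - α)) ≤
        localClustering
          (scheduleGraph τ (fun i j => influenceSide α β n m (rk i j)) Z) v)}
  have hbad : ∀ v, (Measure.pi fun _ : Fin n => nodeLaw p n m).real (bad v) ≤ E := by
    intro v
    by_cases hv : 2 * δ ≤ ρ v / n
    · refine le_trans (measureReal_mono (fun Z hZ => hZ.2) (measure_ne_top _ _))
        (h.vertex_tail hα hα1 hβ p hp hδ hδ1 hε hε1 hδε hn hm hbig hv)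
    · have : bad v = ∅ := by ext Z; simp [bad, hv]
      rw [this]; simp [hE]; positivity
  calc _ ≤ (Measure.pi fun _ : Fin n => nodeLaw p n m).real (⋃ v, bad v) := by
        refine measureReal_mono (fun Z hZ => ?_) (measure_ne_top _ _)
        by_contra hcon
        refine hZ ?_
        simp only [bad, Set.mem_iUnion, Set.mem_ofPred_eq, not_exists, not_and, not_not] at hcon
        rw [clusteringCoeff, Fintype.card_fin, le_div_iff₀ hn']
        have hc0 : 0 ≤ (1 - 40 * ε) * (p * (3 / 4 : ℝ) ^ m) :=
          mul_nonneg (by linarith) (by positivity)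
        calc (1 - 40 * ε) * (p * (3 / 4) ^ m * (I - (2 * δ) ^ α)) * n
            = (1 - 40 * ε) * (p * (3 / 4) ^ m) * (I * n - n * (2 * δ) ^ α) := by ring
          _ ≤ (1 - 40 * ε) * (p * (3 / 4) ^ m) *
              ∑ v, (min (((ρ v : ℝ) / n) ^ α) (1 - α) - (2 * δ) ^ α) := by
              refine mul_le_mul_of_nonneg_left ?_ hc0
              rw [Finset.sum_sub_distrib, Finset.sum_const, Finset.card_univ, Fintype.card_fin,
                nsmul_eq_mul]
              linarith
          _ ≤ _ := by
              rw [Finset.mul_sum]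
              refine Finset.sum_le_sum fun v _ => ?_
              by_cases hv : 2 * δ ≤ ρ v / n
              · refine le_trans ?_ (hcon v hv)
                rw [mul_assoc]
                refine mul_le_mul_of_nonneg_left ?_ (by linarith)
                refine mul_le_mul_of_nonneg_left ?_ (by positivity)
                linarith [Real.rpow_nonneg (show 0 ≤ 2 * δ by linarith) α]
              · refine le_trans ?_ (localClustering_nonneg _ v)
                refine mul_nonpos_of_nonneg_of_nonpos hc0 ?_
                have : ((ρ v : ℝ) / n) ^ α ≤ (2 * δ) ^ α :=
                  Real.rpow_le_rpow (by positivity) (by linarith) hα.le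
                linarith [min_le_left (((ρ v : ℝ) / n) ^ α) (1 - α)]
    _ ≤ ∑ v, (Measure.pi fun _ : Fin n => nodeLaw p n m).real (bad v) :=
        measureReal_iUnion_fintype_le _
    _ ≤ ∑ _v : Fin n, E := Finset.sum_le_sum fun v _ => hbad v
    _ = _ := by simp

end Vertex

end GeoP

namespace GeoP

/-! ### Runs of the chain -/

section Run

variable {n m : ℕ}

/-- The trajectory of the chain from `s` driven by the innovations `ω`. -/
noncomputable def run (α β : ℝ) (s : State n m) (ω : ℕ → Innovation n m) : ℕ → State n m
  | 0 => s
  | t + 1 => step α β (run α β s ω t) (ω t)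

theorem run_congr {α β : ℝ} (s : State n m) {ω ω' : ℕ → Innovation n m} {T : ℕ}
    (h : ∀ t < T, ω t = ω' t) : run α β s ω T = run α β s ω' T := by
  induction T with
  | zero => rfl
  | succ T ih => rw [run, run, ih fun t ht => h t (by omega), h T (by omega)]

/-- The trajectory of the ranking, driven by the deleted nodes and the initial ranks. -/
noncomputable def rankAt (σ : Equiv.Perm (Fin n)) (d : ℕ → Fin n × Fin n) :
    ℕ → Equiv.Perm (Fin n)
  | 0 => σ
  | t + 1 => (rankAt σ d t).trans (rankUpdate (rankAt σ d t (d t).1) (d t).2)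

theorem run_ranking (α β : ℝ) (s : State n m) (ω : ℕ → Innovation n m) (t : ℕ) :
    (run α β s ω t).2.1 = rankAt s.2.1 (fun t => ((ω t).1, (ω t).2.2.1)) t := by
  induction t with
  | zero => rfl
  | succ t ih => simp only [run, rankAt, step, ih]

theorem rankUpdate_self (D R : Fin n) : rankUpdate D R D = R := by
  apply Fin.ext
  simp [rankUpdate, newRank]

theorem rankAt_succ_self (σ : Equiv.Perm (Fin n)) (d : ℕ → Fin n × Fin n) (t : ℕ) :
    rankAt σ d (t + 1) (d t).1 = (d t).2 := by
  simp [rankAt, rankUpdate_self]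

/-- The last time before `T` at which the node `i` is replaced. -/
noncomputable def lastTime (D : ℕ → Fin n) (T : ℕ) (i : Fin n) : ℕ :=
  Nat.findGreatest (fun t => t < T ∧ D t = i) T

section LastTime

variable {D : ℕ → Fin n} {T : ℕ} (hD : ∀ i, ∃ t < T, D t = i)

include hD

theorem lastTime_spec (i : Fin n) : lastTime D T i < T ∧ D (lastTime D T i) = i := by
  obtain ⟨t, ht, hi⟩ := hD i
  exact Nat.findGreatest_spec (P := fun t => t < T ∧ D t = i) ht.le ⟨ht, hi⟩

theorem injective_lastTime : Function.Injective (lastTime D T) := fun i j h => by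
  rw [← (lastTime_spec hD i).2, ← (lastTime_spec hD j).2, h]

omit hD in
theorem ne_of_lastTime_lt {i : Fin n} {t : ℕ} (h : lastTime D T i < t) (ht : t < T) :
    D t ≠ i := fun hi =>
  not_lt.2 (Nat.le_findGreatest (P := fun t => t < T ∧ D t = i) ht.le ⟨ht, hi⟩) h

end LastTime

variable {α β : ℝ} {s : State n m} {ω : ℕ → Innovation n m} {T : ℕ}

/-- The position is set at the last replacement of i and no later step touches it. -/
theorem run_position (hD : ∀ i, ∃ t < T, (ω t).1 = i) (i : Fin n) {t : ℕ}
    (h1 : lastTime (fun t => (ω t).1) T i < t) (h2 : t ≤ T) :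
    (run α β s ω t).1 i = (ω (lastTime (fun t => (ω t).1) T i)).2.1 := by
  induction t with
  | zero => omega
  | succ t ih =>
    simp only [run, step]
    rcases (Nat.lt_succ_iff.1 h1).eq_or_lt with h | h
    · have := (lastTime_spec hD i).2
      rw [h] at this ⊢
      nth_rw 1 [← this]
      rw [Function.update_self]
    · rw [Function.update_of_ne, ih h (by omega)]
      exact (ne_of_lastTime_lt (D := fun t => (ω t).1) h (by omega)).symm

/-- The last replacement of the younger node erases every earlier link with i and decides the new
one; afterwards both nodes survive, so the link is kept. -/
theorem run_adj (hD : ∀ i, ∃ t < T, (ω t).1 = i) {i j : Fin n}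
    (hij : lastTime (fun t => (ω t).1) T i < lastTime (fun t => (ω t).1) T j) {t : ℕ}
    (h1 : lastTime (fun t => (ω t).1) T j < t) (h2 : t ≤ T) :
    (run α β s ω t).2.2.Adj i j ↔ Linked α β (run α β s ω (lastTime (fun t => (ω t).1) T j))
      (ω (lastTime (fun t => (ω t).1) T j)) i := by
  have hne : i ≠ j := by rintro rfl; exact lt_irrefl _ hij
  induction t with
  | zero => omega
  | succ t ih =>
    simp only [run, step, nextGraph]
    rcases (Nat.lt_succ_iff.1 h1).eq_or_lt with h | h
    · have hj := (lastTime_spec hD j).2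
      rw [h] at hj ⊢
      rw [hj]
      simp [hne]
    · have hi := ne_of_lastTime_lt (D := fun t => (ω t).1) (hij.trans h) (by omega : t < T)
      have hj := ne_of_lastTime_lt (D := fun t => (ω t).1) h (by omega : t < T)
      refine Iff.trans ?_ (ih h (by omega))
      simp [hne, hi.symm, hj.symm]

/-- Once every node has been replaced, the graph of the chain is a schedule graph. -/
theorem run_graph_eq (hD : ∀ i, ∃ t < T, (ω t).1 = i) :
    (run α β s ω T).2.2 = scheduleGraph (lastTime (fun t => (ω t).1) T)
      (fun i j => influenceSide α β n m (rankAt s.2.1 (fun t => ((ω t).1, (ω t).2.2.1))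
        (lastTime (fun t => (ω t).1) T j) i + 1))
      (fun i => ((ω (lastTime (fun t => (ω t).1) T i)).2.1,
        (ω (lastTime (fun t => (ω t).1) T i)).2.2.2)) := by
  set τ := lastTime (fun t => (ω t).1) T with hτ
  have key : ∀ i j, τ i < τ j → ((run α β s ω T).2.2.Adj i j ↔
      dist (ω (τ j)).2.1 (ω (τ i)).2.1 ≤ influenceSide α β n m (rankAt s.2.1
        (fun t => ((ω t).1, (ω t).2.2.1)) (τ j) i + 1) / 2 ∧ (ω (τ j)).2.2.2 i = true) := by
    intro i j hij
    rw [run_adj hD hij (lastTime_spec hD j).1 le_rfl, Linked,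
      run_position hD i hij (lastTime_spec hD j).1.le, run_ranking]
    rfl
  ext i j
  by_cases hne : i = j
  · subst hne; simp
  have : τ i ≠ τ j := fun h => hne (injective_lastTime hD h)
  rcases lt_or_gt_of_ne this with h | h
  · rw [key i j h]
    simp only [scheduleGraph, h, not_lt.2 h.le, true_and, false_and, or_false]
  · rw [SimpleGraph.adj_comm, key j i h]
    simp only [scheduleGraph, h, not_lt.2 h.le, true_and, false_and, false_or]

end Run

end GeoP

/-! ### The law of a stationary run and conditioning on the rank data -/

namespace GeoP

section RunLaw

variable {n m : ℕ}

/-- The law of the deleted node and of the initial rank in one step. -/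
noncomputable def rankLaw (n : ℕ) : Measure (Fin n × Fin n) :=
  (uniformOn (Set.univ : Set (Fin n))).prod (uniformOn (Set.univ : Set (Fin n)))

theorem isProbabilityMeasure_uniformOn_univ (hn : 0 < n) :
    IsProbabilityMeasure (uniformOn (Set.univ : Set (Fin n))) :=
  isProbabilityMeasure_uniformOn Set.finite_univ ⟨⟨0, hn⟩, trivial⟩

theorem isProbabilityMeasure_rankLaw (hn : 0 < n) : IsProbabilityMeasure (rankLaw n) := by
  have := isProbabilityMeasure_uniformOn_univ hn
  unfold rankLaw; infer_instance

theorem isProbabilityMeasure_innovationLaw (p : unitInterval) (m : ℕ) (hn : 0 < n) :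
    IsProbabilityMeasure (innovationLaw p n m) := by
  have := isProbabilityMeasure_uniformOn_univ hn
  unfold innovationLaw; infer_instance

/-- Assemble an innovation from its rank part and its geometric part. -/
def joinInnovation (z : (Fin n × Fin n) × (Torus m × (Fin n → Bool))) : Innovation n m :=
  (z.1.1, z.2.1, z.1.2, z.2.2)

theorem measurePreserving_joinInnovation (p : unitInterval) (m : ℕ) (hn : 0 < n) :
    MeasurePreserving (joinInnovation (n := n) (m := m)) ((rankLaw n).prod (nodeLaw p n m))
      (innovationLaw p n m) := by
  have := isProbabilityMeasure_uniformOn_univ hn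
  have h1 := measurePreserving_prodAssoc (uniformOn (Set.univ : Set (Fin n)))
    (uniformOn (Set.univ : Set (Fin n))) (nodeLaw p n m)
  have h2 := (measurePreserving_prodAssoc (uniformOn (Set.univ : Set (Fin n)))
    (volume : Measure (Torus m))
    (Measure.pi fun _ : Fin n => bernoulliMeasure true false p)).symm
  have h3 := (Measure.measurePreserving_swap (μ := uniformOn (Set.univ : Set (Fin n)))
    (ν := (volume : Measure (Torus m)))).prod
    (MeasurePreserving.id (Measure.pi fun _ : Fin n => bernoulliMeasure true false p))
  have h4 := measurePreserving_prodAssoc (volume : Measure (Torus m))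
    (uniformOn (Set.univ : Set (Fin n)))
    (Measure.pi fun _ : Fin n => bernoulliMeasure true false p)
  exact ((MeasurePreserving.id (uniformOn (Set.univ : Set (Fin n)))).prod
    ((h4.comp h3).comp h2)).comp h1

/-- Extend a finite sequence by a constant. -/
def extendSeq {X : Type*} (x₀ : X) {T : ℕ} (x : Fin T → X) (t : ℕ) : X :=
  if h : t < T then x ⟨t, h⟩ else x₀

theorem extendSeq_of_lt {X : Type*} (x₀ : X) {T : ℕ} (x : Fin T → X) {t : ℕ} (h : t < T) :
    extendSeq x₀ x t = x ⟨t, h⟩ := dif_pos h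

theorem transition_apply (α β : ℝ) (p : unitInterval) (hn : 0 < n) (s : State n m)
    {S : Set (State n m)} (hS : MeasurableSet S) :
    transition α β p n m s S = innovationLaw p n m {ω | step α β s ω ∈ S} := by
  have := isProbabilityMeasure_innovationLaw p m hn
  have hS' := measurable_step α β n m hS
  rw [transition, Kernel.map_apply' _ (measurable_step α β n m) _ hS, Kernel.prod_apply,
    Kernel.id_apply, Kernel.const_apply, Measure.prod_apply hS', lintegral_dirac']
  · rfl
  · exact measurable_measure_prodMk_left hS'

theorem measurePreserving_step {α β : ℝ} {p : unitInterval} (hn : 0 < n)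
    {π : Measure (State n m)} [IsProbabilityMeasure π]
    (hπ : (transition α β p n m).Invariant π) :
    MeasurePreserving (fun z : State n m × Innovation n m => step α β z.1 z.2)
      (π.prod (innovationLaw p n m)) π := by
  have := isProbabilityMeasure_innovationLaw p m hn
  refine ⟨measurable_step α β n m, ?_⟩
  ext S hS
  rw [Measure.map_apply (measurable_step α β n m) hS,
    Measure.prod_apply (measurable_step α β n m hS)]
  conv_rhs => rw [← hπ.def, Measure.bind_apply hS (transition α β p n m).measurable.aemeasurable]
  exact lintegral_congr fun s => (transition_apply α β p hn s hS).symm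

/-- Stationarity iterated: the last innovation is split off and is independent of the run up to
then. -/
theorem measurePreserving_run {α β : ℝ} {p : unitInterval} (hn : 0 < n)
    {π : Measure (State n m)} [IsProbabilityMeasure π]
    (hπ : (transition α β p n m).Invariant π) (ω₀ : Innovation n m) (T : ℕ) :
    MeasurePreserving (fun z : State n m × (Fin T → Innovation n m) =>
      run α β z.1 (extendSeq ω₀ z.2) T)
      (π.prod (Measure.pi fun _ : Fin T => innovationLaw p n m)) π := by
  have := isProbabilityMeasure_innovationLaw p m hn
  induction T with
  | zero => exact measurePreserving_fst
  | succ T ih =>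
    have h1 := measurePreserving_piFinSuccAbove (fun _ : Fin (T + 1) => innovationLaw p n m)
      (Fin.last T)
    have h2 := Measure.measurePreserving_swap (μ := innovationLaw p n m)
      (ν := Measure.pi fun _ : Fin T => innovationLaw p n m)
    have h3 := (MeasurePreserving.id π).prod (h2.comp h1)
    have h4 := (measurePreserving_prodAssoc π (Measure.pi fun _ : Fin T => innovationLaw p n m)
      (innovationLaw p n m)).symm
    have h5 := ih.prod (MeasurePreserving.id (innovationLaw p n m))
    have h6 := (measurePreserving_step hn hπ).comp (h5.comp (h4.comp h3))
    convert h6 using 1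
    funext z
    change step α β (run α β z.1 (extendSeq ω₀ z.2) T) (extendSeq ω₀ z.2 T) =
      step α β (run α β z.1 (extendSeq ω₀ fun j => z.2 ((Fin.last T).succAbove j)) T)
        (z.2 (Fin.last T))
    have e1 : extendSeq ω₀ z.2 T = z.2 (Fin.last T) := extendSeq_of_lt _ _ (Nat.lt_succ_self T)
    rw [e1]
    congr 1
    refine run_congr _ fun t ht => ?_
    rw [extendSeq_of_lt _ _ (ht.trans (Nat.lt_succ_self T)), extendSeq_of_lt _ _ ht,
      Fin.succAbove_last]
    rfl

/-- Restricting independent coordinates along an injection. -/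
theorem measurePreserving_comp_injective {ι κ X : Type*} [Fintype ι] [Fintype κ]
    [MeasurableSpace X] (ν : Measure X) [IsProbabilityMeasure ν] {f : ι → κ}
    (hf : Function.Injective f) :
    MeasurePreserving (fun (x : κ → X) (i : ι) => x (f i)) (Measure.pi fun _ => ν)
      (Measure.pi fun _ => ν) := by
  have h1 : iIndepFun (fun (k : κ) (x : κ → X) => x k) (Measure.pi fun _ => ν) :=
    iIndepFun_pi (X := fun _ x => x) fun _ => aemeasurable_id
  have h2 := h1.precomp hf
  refine ⟨by fun_prop, ?_⟩
  rw [(iIndepFun_iff_map_fun_eq_pi_map fun i =>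
    (measurable_pi_apply (X := fun _ : κ => X) (f i)).aemeasurable).1 h2]
  congr 1
  funext i
  exact (measurePreserving_eval (fun _ : κ => ν) (f i)).map_eq

/-- Conditioning on the rank part of the innovations: if along every good sequence of deletions and
initial ranks the schedule graph is rarely bad, the graph of the chain is rarely bad. -/
theorem measureReal_run_graph_le (α β : ℝ) (p : unitInterval) (hn : 0 < n)
    (ω₀ : Innovation n m) (s : State n m) (T : ℕ) (bad : Set (SimpleGraph (Fin n)))
    (good : Set (Fin T → Fin n × Fin n)) {b : ℝ} (hb : 0 ≤ b)
    (hgood : ∀ d ∈ good, (∀ i, ∃ t < T, (extendSeq (ω₀.1, ω₀.2.2.1) d t).1 = i) ∧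
      (Measure.pi fun _ : Fin n => nodeLaw p n m).real
        {Z | scheduleGraph (lastTime (fun t => (extendSeq (ω₀.1, ω₀.2.2.1) d t).1) T)
          (fun i j => influenceSide α β n m (rankAt s.2.1 (extendSeq (ω₀.1, ω₀.2.2.1) d)
            (lastTime (fun t => (extendSeq (ω₀.1, ω₀.2.2.1) d t).1) T j) i + 1)) Z ∈ bad} ≤ b) :
    (Measure.pi fun _ : Fin T => innovationLaw p n m).real
      {ω | (run α β s (extendSeq ω₀ ω) T).2.2 ∈ bad} ≤
      (Measure.pi fun _ : Fin T => rankLaw n).real goodᶜ + b := by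
  have := isProbabilityMeasure_innovationLaw p m hn
  have := isProbabilityMeasure_rankLaw hn
  have h1 := measurePreserving_pi (fun _ : Fin T => (rankLaw n).prod (nodeLaw p n m))
    (fun _ : Fin T => innovationLaw p n m) (fun _ => measurePreserving_joinInnovation p m hn)
  have h2 := (measurePreserving_arrowProdEquivProdArrow (Fin n × Fin n)
    (Torus m × (Fin n → Bool)) (Fin T) (fun _ => rankLaw n) (fun _ => nodeLaw p n m)).symm
  have h3 := h1.comp h2
  have hrun : Measurable fun ω : Fin T → Innovation n m =>
      (run α β s (extendSeq ω₀ ω) T).2.2 := by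
    have : ∀ t, Measurable fun ω : Fin T → Innovation n m => run α β s (extendSeq ω₀ ω) t := by
      intro t
      induction t with
      | zero => exact measurable_const
      | succ t ih =>
        have hext : Measurable fun ω : Fin T → Innovation n m => extendSeq ω₀ ω t := by
          by_cases h : t < T
          · simp only [extendSeq_of_lt _ _ h]
            exact measurable_pi_apply (X := fun _ : Fin T => Innovation n m) ⟨t, h⟩
          · simp only [extendSeq, dif_neg h]
            exact measurable_const
        exact (measurable_step α β n m).comp (ih.prodMk hext)
    exact measurable_snd.comp (measurable_snd.comp (this T))
  have hbad : MeasurableSet {ω : Fin T → Innovation n m |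
      (run α β s (extendSeq ω₀ ω) T).2.2 ∈ bad} := hrun (Set.toFinite bad).measurableSet
  rw [measureReal_def, ← h3.measure_preimage hbad.nullMeasurableSet, ← measureReal_def]
  refine measureReal_prod_le (h3.measurable hbad) (Set.toFinite good).measurableSet hb ?_
  intro d hd
  obtain ⟨hD, hle⟩ := hgood d hd
  set d' := extendSeq (ω₀.1, ω₀.2.2.1) d with hd'
  set τ := lastTime (fun t => (d' t).1) T with hτ
  have hτT : ∀ i, τ i < T := fun i => (lastTime_spec hD i).1
  -- The birth steps of the nodes are distinct and fixed by d, so the geometric parts of the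
  -- innovations at these steps are n independent samples of `nodeLaw`.
  let f : Fin n → Fin T := fun i => ⟨τ i, hτT i⟩
  have hf : Function.Injective f := fun i j h => injective_lastTime hD (congrArg Fin.val h)
  refine le_trans (le_of_eq ?_) hle
  have hm : MeasurableSet {Z : Fin n → Torus m × (Fin n → Bool) | scheduleGraph τ
      (fun i j => influenceSide α β n m (rankAt s.2.1 d' (τ j) i + 1)) Z ∈ bad} :=
    measurable_scheduleGraph τ _ (Set.toFinite bad).measurableSet
  rw [measureReal_def, measureReal_def,
    ← (measurePreserving_comp_injective (nodeLaw p n m) hf).measure_preimage hm.nullMeasurableSet]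
  congr 2
  ext z
  let ω : Fin T → Innovation n m := fun t => joinInnovation (d t, z t)
  have e1 : ∀ t, (extendSeq ω₀ ω t).1 = (d' t).1 := fun t => by
    rw [hd']; unfold extendSeq; split_ifs <;> rfl
  have e2 : (fun t => ((extendSeq ω₀ ω t).1, (extendSeq ω₀ ω t).2.2.1)) = d' := by
    funext t
    rw [hd']; unfold extendSeq; split_ifs <;> rfl
  have e3 : ∀ i, ((extendSeq ω₀ ω (τ i)).2.1, (extendSeq ω₀ ω (τ i)).2.2.2) = z (f i) := by
    intro i
    rw [extendSeq_of_lt _ _ (hτT i)]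
    rfl
  have e := run_graph_eq (α := α) (β := β) (s := s) (ω := extendSeq ω₀ ω) (T := T)
    (fun i => by simpa only [e1] using hD i)
  rw [e2] at e
  simp only [e1] at e
  rw [← hτ] at e
  simp only [e3] at e
  change (run α β s (extendSeq ω₀ ω) T).2.2 ∈ bad ↔ _
  rw [e]
  rfl

end RunLaw

end GeoP

/-- Two-sided concentration of a sum of independent `[0, k]`-valued variables. -/
theorem measureReal_abs_sum_sub_le {ι Ω : Type*} [Fintype ι] [DecidableEq ι] [MeasurableSpace Ω]
    {ν : Measure Ω} [IsProbabilityMeasure ν] {W : ι → Ω → ℝ} (hW : ∀ i, Measurable (W i)) {k e : ℝ}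
    (h0 : ∀ i x, 0 ≤ W i x) (h1 : ∀ i x, W i x ≤ k) (he : 0 < e) (hek : e ≤ k) :
    (Measure.pi fun _ : ι => ν).real
      {x | e * (Fintype.card ι : ℝ) < |∑ i, W i (x i) - ∑ i, ∫ y, W i y ∂ν|} ≤
      2 * Real.exp (-(e ^ 2 / (4 * k ^ 2) * (Fintype.card ι : ℝ))) := by
  have hk : 0 < k := he.trans_le hek
  set N : ℝ := (Fintype.card ι : ℝ)
  have hN : 0 ≤ N := Nat.cast_nonneg _
  set J := ∑ i, ∫ y, W i y ∂ν
  have hJ0 : 0 ≤ J := Finset.sum_nonneg fun i _ => integral_nonneg (h0 i)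
  have hJ1 : J ≤ N * k := by
    calc J ≤ ∑ _i : ι, k := Finset.sum_le_sum fun i _ => by
          calc ∫ y, W i y ∂ν ≤ ∫ _, k ∂ν := by
                refine integral_mono_of_nonneg (ae_of_all _ (h0 i)) (integrable_const k)
                  (ae_of_all _ (h1 i))
            _ = k := by simp
      _ = N * k := by simp [N]
  -- With |θ| = e/(2k²) the exponent is |θ|eN - θ²k²N = e²N/(4k²), since the sum of the means is at
  -- most Nk. The quadratic bound on the exponential applies because |θ|k ≤ 1, which is where e ≤ k
  -- is used.
  have key : ∀ θ : ℝ, |θ| = e / (2 * k ^ 2) → ∀ S : Set (ι → Ω),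
      (∀ x ∈ S, |θ| * (e * N) ≤ θ * (∑ i, W i (x i) - J)) →
      (Measure.pi fun _ : ι => ν).real S ≤ Real.exp (-(e ^ 2 / (4 * k ^ 2) * N)) := by
    intro θ hθ S hS
    refine measureReal_le_exp_of_independent hW θ hk h0 h1 _ fun x hx => ?_
    have a1 : |θ * k| ≤ 1 := by
      rw [abs_mul, hθ, abs_of_pos hk, div_mul_eq_mul_div, div_le_one (by positivity)]
      nlinarith
    have a2 : Real.exp (θ * k) - 1 ≤ θ * k + (θ * k) ^ 2 := by
      have := Real.abs_exp_sub_one_sub_id_le a1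
      linarith [le_abs_self (Real.exp (θ * k) - 1 - θ * k)]
    have a3 : (Real.exp (θ * k) - 1) / k ≤ θ + θ ^ 2 * k := by
      rw [div_le_iff₀ hk]; linarith
    have a4 : (Real.exp (θ * k) - 1) / k * J ≤ (θ + θ ^ 2 * k) * J := by gcongr
    have a5 : θ ^ 2 * k * J ≤ θ ^ 2 * k * (N * k) := by gcongr
    have a6 : |θ| * (e * N) - θ ^ 2 * k * (N * k) = e ^ 2 / (4 * k ^ 2) * N := by
      rw [← sq_abs, hθ]; field_simp; ring
    have a7 := hS x hx
    change _ ≤ θ * ∑ i, W i (x i) - (Real.exp (θ * k) - 1) / k * J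
    linarith
  have hpos : 0 < e / (2 * k ^ 2) := by positivity
  have k1 := key (e / (2 * k ^ 2)) (abs_of_pos hpos)
    {x | e * N < ∑ i, W i (x i) - J} fun x hx => by
      rw [abs_of_pos hpos]; exact mul_le_mul_of_nonneg_left (le_of_lt hx) hpos.le
  have k2 := key (-(e / (2 * k ^ 2))) (by rw [abs_neg, abs_of_pos hpos])
    {x | e * N < -(∑ i, W i (x i) - J)} fun x hx => by
      rw [abs_neg, abs_of_pos hpos, neg_mul, ← mul_neg]
      exact mul_le_mul_of_nonneg_left (le_of_lt hx) hpos.le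
  refine le_trans (measureReal_mono (fun x hx => ?_) (measure_ne_top _ _))
    ((measureReal_union_le _ _).trans ((add_le_add k1 k2).trans (two_mul _).ge))
  have hx' : e * N < |∑ i, W i (x i) - J| := hx
  exact lt_abs.1 hx'

/-! ### Uniform draws: all nodes are replaced, and ranks drift slowly -/

namespace GeoP

section Uniform

variable {n : ℕ}

theorem uniformOn_univ_real (S : Set (Fin n)) :
    (uniformOn (Set.univ : Set (Fin n))).real S = (S.ncard : ℝ) / n := by
  rw [measureReal_def, uniformOn_univ, Measure.count_apply (Set.toFinite S).measurableSet,
    ENNReal.toReal_div, ← (Set.toFinite S).cast_ncard_eq, ENat.toENNReal_coe,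
    ENNReal.toReal_natCast]
  simp

theorem integral_uniformOn_univ (hn : 0 < n) (f : Fin n → ℝ) :
    ∫ x, f x ∂(uniformOn (Set.univ : Set (Fin n))) = (∑ x, f x) / n := by
  have := isProbabilityMeasure_uniformOn_univ hn
  rw [integral_fintype (Integrable.of_finite), Finset.sum_div]
  refine Finset.sum_congr rfl fun x _ => ?_
  rw [uniformOn_univ_real, Set.ncard_singleton, smul_eq_mul]
  simp; ring

theorem ncard_lt (r : ℕ) (hr : r ≤ n) : {x : Fin n | (x : ℕ) < r}.ncard = r := by
  have h : {x : Fin n | (x : ℕ) < r} = Fin.castLE hr '' Set.univ := by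
    ext x
    simp only [Set.mem_ofPred_eq, Set.image_univ, Set.mem_range]
    exact ⟨fun h => ⟨⟨x, h⟩, rfl⟩, by rintro ⟨y, rfl⟩; exact y.2⟩
  rw [h, Set.ncard_image_of_injective _ (Fin.castLE_injective hr), Set.ncard_univ]
  simp

theorem ncard_perm_lt (σ : Equiv.Perm (Fin n)) (r : ℕ) (hr : r ≤ n) :
    {x : Fin n | (σ x : ℕ) < r}.ncard = r := by
  rw [← Set.ncard_image_of_injective _ σ.injective]
  refine Eq.trans (congrArg Set.ncard ?_) (ncard_lt r hr)
  ext x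
  simp only [Set.mem_image, Set.mem_ofPred_eq]
  exact ⟨by rintro ⟨y, hy, rfl⟩; exact hy, fun h => ⟨σ.symm x, by simpa using h, by simp⟩⟩

end Uniform

section Refresh

variable {n : ℕ}

theorem measureReal_not_refreshed_le (hn : 0 < n) (T : ℕ) :
    (Measure.pi fun _ : Fin T => rankLaw n).real {d | ∃ i, ∀ t, (d t).1 ≠ i} ≤
      n * Real.exp (-((T : ℝ) / n)) := by
  have := isProbabilityMeasure_rankLaw hn
  have := isProbabilityMeasure_uniformOn_univ hn
  have hn' : (0 : ℝ) < n := by exact_mod_cast hn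
  have h1 : ∀ i : Fin n, (rankLaw n).real {z | z.1 ≠ i} ≤ Real.exp (-(1 / n)) := by
    intro i
    have e : {z : Fin n × Fin n | z.1 ≠ i} = {i}ᶜ ×ˢ Set.univ := by ext z; simp
    rw [e, rankLaw, measureReal_prod_prod, measureReal_compl (measurableSet_singleton i),
      uniformOn_univ_real {i}, Set.ncard_singleton]
    simp only [probReal_univ, mul_one, Nat.cast_one]
    linarith [Real.add_one_le_exp (-(1 / (n : ℝ)))]
  have h2 : ∀ i : Fin n, (Measure.pi fun _ : Fin T => rankLaw n).real {d | ∀ t, (d t).1 ≠ i} ≤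
      Real.exp (-((T : ℝ) / n)) := by
    intro i
    have e : {d : Fin T → Fin n × Fin n | ∀ t, (d t).1 ≠ i} =
        Set.univ.pi fun _ => {z | z.1 ≠ i} := by ext d; simp
    rw [e, measureReal_def, Measure.pi_pi, ENNReal.toReal_prod]
    simp only [← measureReal_def, Finset.prod_const, Finset.card_univ, Fintype.card_fin]
    calc _ ≤ Real.exp (-(1 / n)) ^ T := by gcongr; exact h1 i
      _ = _ := by rw [← Real.exp_nat_mul]; congr 1; ring
  calc _ ≤ ∑ i : Fin n, (Measure.pi fun _ : Fin T => rankLaw n).real {d | ∀ t, (d t).1 ≠ i} := by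
        rw [show {d : Fin T → Fin n × Fin n | ∃ i, ∀ t, (d t).1 ≠ i} =
          ⋃ i, {d | ∀ t, (d t).1 ≠ i} by ext d; simp]
        exact measureReal_iUnion_fintype_le _
    _ ≤ ∑ _i : Fin n, Real.exp (-((T : ℝ) / n)) := Finset.sum_le_sum fun i _ => h2 i
    _ = _ := by simp

end Refresh

section Drift

variable {n : ℕ}

theorem rankAt_congr {σ : Equiv.Perm (Fin n)} {d d' : ℕ → Fin n × Fin n} {T : ℕ}
    (h : ∀ t < T, d t = d' t) : rankAt σ d T = rankAt σ d' T := by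
  induction T with
  | zero => rfl
  | succ T ih => rw [rankAt, rankAt, ih fun t ht => h t (by omega), h T (by omega)]

/-- The insertion is compared with the intermediate rank, r - 1 or r, which depends on D. Replacing
this comparison by R < r + 1 or R < r makes the insertion and deletion terms independent; the two
versions differ only for R = r. -/
theorem rankUpdate_bounds {D R r : Fin n} (h : r ≠ D) :
    ((rankUpdate D R r : ℕ) : ℝ) - (r : ℕ) ≤
      (if (R : ℕ) < (r : ℕ) + 1 then (1 : ℝ) else 0) - (if (D : ℕ) < r then 1 else 0) ∧
    (if (R : ℕ) < r then (1 : ℝ) else 0) - (if (D : ℕ) < r then 1 else 0) ≤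
      ((rankUpdate D R r : ℕ) : ℝ) - (r : ℕ) := by
  have h' : (r : ℕ) ≠ D := fun e => h (Fin.ext e)
  have e : ((rankUpdate D R r : Fin n) : ℕ) = newRank D R r := rfl
  rw [e, newRank, if_neg h']
  by_cases h1 : (D : ℕ) < r
  · have hr : 1 ≤ (r : ℕ) := by omega
    simp only [h1, if_true]
    by_cases h2 : (R : ℕ) ≤ r - 1
    · have a : (R : ℕ) < (r : ℕ) + 1 := by omega
      have b : (R : ℕ) < (r : ℕ) := by omega
      rw [if_pos h2, if_pos a, if_pos b]
      push_cast [hr]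
      constructor <;> linarith
    · have b : ¬ (R : ℕ) < (r : ℕ) := by omega
      rw [if_neg h2, if_neg b]
      push_cast [hr]
      constructor
      · split_ifs <;> linarith
      · linarith
  · simp only [h1, if_false]
    by_cases h2 : (R : ℕ) ≤ r
    · have a : (R : ℕ) < (r : ℕ) + 1 := by omega
      rw [if_pos h2, if_pos a]
      push_cast
      constructor
      · linarith
      · split_ifs <;> linarith
    · have a : ¬ (R : ℕ) < (r : ℕ) + 1 := by omega
      have b : ¬ (R : ℕ) < (r : ℕ) := by omega
      rw [if_neg h2, if_neg a, if_neg b]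
      constructor <;> linarith

/-- One step of the exponential supermartingale for the rank of a node. -/
theorem lintegral_rank_step_le_one (hn : 0 < n) (σ : Equiv.Perm (Fin n)) {r c : ℕ} (hr : r ≤ n)
    (hc : c ≤ n) (θ : ℝ) :
    ∫⁻ z, ENNReal.ofReal (Real.exp (θ * ((if (z.2 : ℕ) < c then (1 : ℝ) else 0) -
      (if (σ z.1 : ℕ) < r then 1 else 0)) -
      ((Real.exp θ - 1) * (c / n) + (Real.exp (-θ) - 1) * (r / n)))) ∂(rankLaw n) ≤ 1 := by
  have := isProbabilityMeasure_uniformOn_univ hn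
  set ν := uniformOn (Set.univ : Set (Fin n))
  let f : Fin n → ℝ := {x : Fin n | (x : ℕ) < c}.indicator 1
  let g : Fin n → ℝ := {x : Fin n | (σ x : ℕ) < r}.indicator 1
  have hf : ∫ x, f x ∂ν = c / n := by
    rw [integral_indicator_one (Set.toFinite _).measurableSet, uniformOn_univ_real, ncard_lt c hc]
  have hg : ∫ x, g x ∂ν = r / n := by
    rw [integral_indicator_one (Set.toFinite _).measurableSet, uniformOn_univ_real,
      ncard_perm_lt σ r hr]
  have h01 : ∀ (A : Set (Fin n)) x, (0 : ℝ) ≤ A.indicator 1 x ∧ A.indicator 1 x ≤ (1 : ℝ) :=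
    fun A x => ⟨Set.indicator_nonneg (fun _ _ => zero_le_one) _,
      Set.indicator_le' (fun _ _ => le_rfl) (fun _ _ => zero_le_one) _⟩
  have hF := lintegral_exp_le_one (ν := ν) (W := f) (Measurable.of_discrete) θ one_pos
    (fun x => (h01 _ x).1) (fun x => (h01 _ x).2)
  have hG := lintegral_exp_le_one (ν := ν) (W := g) (Measurable.of_discrete) (-θ) one_pos
    (fun x => (h01 _ x).1) (fun x => (h01 _ x).2)
  rw [hf] at hF
  rw [hg] at hG
  simp only [mul_one, div_one] at hF hG
  have e : ∀ z : Fin n × Fin n, ENNReal.ofReal (Real.exp (θ * ((if (z.2 : ℕ) < c then (1 : ℝ) else 0) -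
      (if (σ z.1 : ℕ) < r then 1 else 0)) -
      ((Real.exp θ - 1) * (c / n) + (Real.exp (-θ) - 1) * (r / n)))) =
      ENNReal.ofReal (Real.exp (-θ * g z.1 - (Real.exp (-θ) - 1) * (r / n))) *
      ENNReal.ofReal (Real.exp (θ * f z.2 - (Real.exp θ - 1) * (c / n))) := fun z => by
    rw [← ENNReal.ofReal_mul (Real.exp_pos _).le, ← Real.exp_add]
    congr 2
    simp only [f, g, Set.indicator_apply, Set.mem_ofPred_eq, Pi.one_apply]
    ring
  simp only [e]
  rw [rankLaw, lintegral_prod_mul (f := fun x => ENNReal.ofReal (Real.exp (-θ * g x -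
    (Real.exp (-θ) - 1) * (r / n)))) (g := fun x => ENNReal.ofReal (Real.exp (θ * f x -
    (Real.exp θ - 1) * (c / n)))) (Measurable.of_discrete).aemeasurable
    (Measurable.of_discrete).aemeasurable]
  exact mul_le_one' hG hF

end Drift

end GeoP

namespace GeoP

section Drift

variable {n : ℕ}

/-- Up and down moves both have probability about r/N, so the terms linear in θ cancel. A second
order term 2θ² remains, and 2|θ|/N from using r + 1 in place of r. -/
theorem rank_compensator_le {θ r c N κ : ℝ} (hθ : |θ| ≤ 1) (hr : 0 ≤ r) (hrN : r ≤ N) (hN : 0 < N)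
    (hc : (0 ≤ θ ∧ c = r + 1) ∨ (θ ≤ 0 ∧ c = r)) (hκ : 2 * θ ^ 2 + 2 * |θ| / N ≤ κ) :
    (Real.exp θ - 1) * (c / N) + (Real.exp (-θ) - 1) * (r / N) ≤ κ := by
  have e1 : Real.exp θ - 1 ≤ θ + θ ^ 2 := by
    have := Real.abs_exp_sub_one_sub_id_le hθ
    linarith [le_abs_self (Real.exp θ - 1 - θ)]
  have e2 : Real.exp (-θ) - 1 ≤ -θ + θ ^ 2 := by
    have := Real.abs_exp_sub_one_sub_id_le (x := -θ) (by rwa [abs_neg])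
    have h := le_abs_self (Real.exp (-θ) - 1 - -θ)
    nlinarith
  have hrN0 : 0 ≤ r / N := by positivity
  have hrN1 : r / N ≤ 1 := (div_le_one hN).2 hrN
  have e3 : (Real.exp θ - 1) * (r / N) + (Real.exp (-θ) - 1) * (r / N) ≤ 2 * θ ^ 2 := by
    nlinarith [sq_nonneg θ]
  refine le_trans ?_ hκ
  rcases hc with ⟨h0, rfl⟩ | ⟨h0, rfl⟩
  · rw [add_div, mul_add, abs_of_nonneg h0]
    have e4 : (Real.exp θ - 1) * (1 / N) ≤ 2 * θ / N := by
      rw [mul_one_div]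
      gcongr
      rw [abs_of_nonneg h0] at hθ
      nlinarith
    linarith
  · have : 0 ≤ 2 * |θ| / N := by positivity
    linarith

/-- The rank of a node that is not replaced rarely moves far. -/
theorem measureReal_rank_drift_le (hn : 0 < n) (σ : Equiv.Perm (Fin n)) (d₀ : Fin n × Fin n)
    {T : ℕ} (i : Fin n) {a b : ℕ} (hab : a ≤ b) (hb : b ≤ T) {κ L θ : ℝ} (hθ : |θ| ≤ 1)
    (hκ : 2 * θ ^ 2 + 2 * |θ| / n ≤ κ) :
    (Measure.pi fun _ : Fin T => rankLaw n).real
      {d | (∀ s, a ≤ s → s < b → (extendSeq d₀ d s).1 ≠ i) ∧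
        L ≤ θ * ((rankAt σ (extendSeq d₀ d) b i : ℕ) - (rankAt σ (extendSeq d₀ d) a i : ℕ) : ℝ)} ≤
      Real.exp (-(L - κ * T)) := by
  have := isProbabilityMeasure_rankLaw hn
  have hn' : (0 : ℝ) < n := by exact_mod_cast hn
  have hκ0 : 0 ≤ κ := le_trans (by positivity) hκ
  -- Upward drift (θ ≥ 0) uses the upper bound R < r + 1 on an increment, downward drift the lower
  -- bound R < r.
  let q : ℕ := if 0 ≤ θ then 1 else 0
  let ψ : (ℕ → Fin n × Fin n) → Fin n × Fin n → ℕ → ℝ := fun d z t =>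
    θ * ((if (z.2 : ℕ) < (rankAt σ d t i : ℕ) + q then (1 : ℝ) else 0) -
      (if (rankAt σ d t z.1 : ℕ) < (rankAt σ d t i : ℕ) then 1 else 0)) -
      ((Real.exp θ - 1) * (((rankAt σ d t i : ℕ) + q : ℕ) / n) +
        (Real.exp (-θ) - 1) * ((rankAt σ d t i : ℕ) / n))
  -- The window [a, b) is deterministic, and φ ignores whether i is replaced inside it. That i
  -- survives is imposed on the event only, where the increments of its rank obey
  -- `rankUpdate_bounds`.
  let φ : Fin T → (Fin T → Fin n × Fin n) → ℝ := fun s d =>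
    if a ≤ (s : ℕ) ∧ (s : ℕ) < b then ψ (extendSeq d₀ d) (d s) s else 0
  have hψ : ∀ d d' z t, (∀ t' < t, d t' = d' t') → ψ d z t = ψ d' z t := fun d d' z t h => by
    simp only [ψ, rankAt_congr (σ := σ) h]
  have hext : ∀ (s : Fin T) d y, ∀ t' < (s : ℕ),
      extendSeq d₀ (Function.update d s y) t' = extendSeq d₀ d t' := fun s d y t' h => by
    rw [extendSeq_of_lt _ _ (h.trans s.2), extendSeq_of_lt _ _ (h.trans s.2),
      Function.update_of_ne]
    exact fun e => absurd (congrArg Fin.val e) h.ne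
  have hq : ∀ r : Fin n, (r : ℕ) + q ≤ n := fun r => by
    have : q ≤ 1 := by simp only [q]; split_ifs <;> omega
    omega
  refine measureReal_le_exp_of_sequential (μ := fun _ : Fin T => rankLaw n) (τ := Fin.val)
    Fin.val_injective (φ := φ) (fun _ => Measurable.of_discrete) ?_ ?_ (L - κ * T) ?_
  · intro t s hst x y
    simp only [φ]
    split_ifs with h
    · rw [Function.update_of_ne (fun e => absurd (congrArg Fin.val e) (ne_of_lt hst))]
      exact hψ _ _ _ _ fun t' ht' => hext t x y t' (ht'.trans hst)
    · rfl
  · intro s x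
    simp only [φ]
    split_ifs with h
    · simp only [Function.update_self, hψ _ _ _ _ (hext s x _)]
      exact lintegral_rank_step_le_one hn _ (Fin.is_lt _).le (hq _) θ
    · simp
  · intro d hd
    obtain ⟨h1, h2⟩ := hd
    let G : ℕ → ℝ := fun t => (rankAt σ (extendSeq d₀ d) t i : ℕ)
    have hstep : ∀ s : Fin T, (if a ≤ (s : ℕ) ∧ (s : ℕ) < b then
        θ * (G ((s : ℕ) + 1) - G s) else 0) - κ ≤ φ s d := by
      intro s
      simp only [φ]
      split_ifs with h
      · have hs := h1 s h.1 h.2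
        rw [extendSeq_of_lt _ _ s.2] at hs
        have hne : rankAt σ (extendSeq d₀ d) s i ≠ rankAt σ (extendSeq d₀ d) s (d s).1 :=
          fun e => hs ((rankAt σ (extendSeq d₀ d) s).injective e).symm
        have hb := rankUpdate_bounds (R := (d s).2) hne
        have eG : G ((s : ℕ) + 1) = (rankUpdate (rankAt σ (extendSeq d₀ d) s (d s).1) (d s).2
            (rankAt σ (extendSeq d₀ d) s i) : ℕ) := by
          simp only [G, rankAt, Equiv.trans_apply, extendSeq_of_lt _ _ s.2, Fin.eta]
        have hcomp : (Real.exp θ - 1) * ((((rankAt σ (extendSeq d₀ d) s i : ℕ) + q : ℕ) : ℝ) / n) +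
            (Real.exp (-θ) - 1) * ((rankAt σ (extendSeq d₀ d) s i : ℕ) / n) ≤ κ := by
          refine rank_compensator_le hθ (Nat.cast_nonneg _) (by exact_mod_cast (Fin.is_lt _).le)
            hn' ?_ hκ
          by_cases h0 : 0 ≤ θ
          · left; simp [q, h0]
          · right; simp [q, h0, (not_le.1 h0).le]
        have hΔ : θ * (G ((s : ℕ) + 1) - G s) ≤
            θ * ((if ((d s).2 : ℕ) < (rankAt σ (extendSeq d₀ d) s i : ℕ) + q then (1 : ℝ) else 0) -
              (if (rankAt σ (extendSeq d₀ d) s (d s).1 : ℕ) <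
                (rankAt σ (extendSeq d₀ d) s i : ℕ) then 1 else 0)) := by
          rw [eG]
          by_cases h0 : 0 ≤ θ
          · have hq1 : q = 1 := by simp [q, h0]
            rw [hq1]
            exact mul_le_mul_of_nonneg_left hb.1 h0
          · have hq0 : q = 0 := by simp [q, h0]
            rw [hq0]
            exact mul_le_mul_of_nonpos_left hb.2 (not_le.1 h0).le
        simp only [ψ]
        linarith
      · linarith
    have htel : ∑ s : Fin T, (if a ≤ (s : ℕ) ∧ (s : ℕ) < b then
        θ * (G ((s : ℕ) + 1) - G s) else 0) = θ * (G b - G a) := by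
      rw [Fin.sum_univ_eq_sum_range (fun t => if a ≤ t ∧ t < b then θ * (G (t + 1) - G t) else 0),
        ← Finset.sum_filter]
      have : (Finset.range T).filter (fun t => a ≤ t ∧ t < b) = Finset.Ico a b := by
        ext t; simp only [Finset.mem_filter, Finset.mem_range, Finset.mem_Ico]; omega
      rw [this, ← Finset.mul_sum, Finset.sum_Ico_sub _ hab]
    calc L - κ * T ≤ ∑ s : Fin T, ((if a ≤ (s : ℕ) ∧ (s : ℕ) < b then
          θ * (G ((s : ℕ) + 1) - G s) else 0) - κ) := by
          rw [Finset.sum_sub_distrib, htel]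
          simp only [Finset.sum_const, Finset.card_univ, Fintype.card_fin, nsmul_eq_mul]
          simp only [G]
          linarith
      _ ≤ _ := Finset.sum_le_sum fun s _ => hstep s

/-- Simultaneously for all nodes and all periods without replacement, ranks move little. -/
theorem measureReal_exists_rank_drift_le (hn : 0 < n) (σ : Equiv.Perm (Fin n))
    (d₀ : Fin n × Fin n) (T : ℕ) {κ L θ : ℝ} (hθ0 : 0 ≤ θ) (hθ : θ ≤ 1)
    (hκ : 2 * θ ^ 2 + 2 * θ / n ≤ κ) :
    (Measure.pi fun _ : Fin T => rankLaw n).real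
      {d | ∃ i a b, a ≤ b ∧ b ≤ T ∧ (∀ s, a ≤ s → s < b → (extendSeq d₀ d s).1 ≠ i) ∧
        L ≤ |((rankAt σ (extendSeq d₀ d) b i : ℕ) - (rankAt σ (extendSeq d₀ d) a i : ℕ) : ℝ)|} ≤
      n * (T + 1) ^ 2 * (2 * Real.exp (-(θ * L - κ * T))) := by
  have := isProbabilityMeasure_rankLaw hn
  let Δ : Fin n → ℕ → ℕ → (Fin T → Fin n × Fin n) → ℝ := fun i a b d =>
    (rankAt σ (extendSeq d₀ d) b i : ℕ) - (rankAt σ (extendSeq d₀ d) a i : ℕ)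
  let B : Fin n × Fin (T + 1) × Fin (T + 1) → Set (Fin T → Fin n × Fin n) := fun z =>
    {d | (z.2.1 : ℕ) ≤ z.2.2 ∧ (∀ s, (z.2.1 : ℕ) ≤ s → s < (z.2.2 : ℕ) →
      (extendSeq d₀ d s).1 ≠ z.1) ∧ L ≤ |Δ z.1 z.2.1 z.2.2 d|}
  have hB : ∀ z, (Measure.pi fun _ : Fin T => rankLaw n).real (B z) ≤
      2 * Real.exp (-(θ * L - κ * T)) := by
    rintro ⟨i, a, b⟩
    by_cases hab : (a : ℕ) ≤ b
    · have hbT : (b : ℕ) ≤ T := Nat.lt_succ_iff.1 b.2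
      have k1 := measureReal_rank_drift_le hn σ d₀ i hab hbT (κ := κ) (L := θ * L) (θ := θ)
        (by rwa [abs_of_nonneg hθ0]) (by rwa [abs_of_nonneg hθ0])
      have k2 := measureReal_rank_drift_le hn σ d₀ i hab hbT (κ := κ) (L := θ * L) (θ := -θ)
        (by rwa [abs_neg, abs_of_nonneg hθ0]) (by rwa [abs_neg, abs_of_nonneg hθ0, neg_sq])
      refine le_trans (measureReal_mono (fun d hd => ?_) (measure_ne_top _ _))
        ((measureReal_union_le _ _).trans ((add_le_add k1 k2).trans (two_mul _).ge))
      obtain ⟨-, h1, h2⟩ := hd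
      rcases le_abs.1 h2 with h | h
      · exact Or.inl ⟨h1, mul_le_mul_of_nonneg_left h hθ0⟩
      · refine Or.inr ⟨h1, ?_⟩
        have := mul_le_mul_of_nonneg_left h hθ0
        simp only [Δ] at this
        linarith
    · have : B (i, a, b) = ∅ := Set.eq_empty_of_forall_notMem fun d hd => hab hd.1
      rw [this, measureReal_empty]
      positivity
  calc _ ≤ (Measure.pi fun _ : Fin T => rankLaw n).real (⋃ z, B z) := by
        refine measureReal_mono ?_ (measure_ne_top _ _)
        rintro d ⟨i, a, b, hab, hb, h1, h2⟩
        exact Set.mem_iUnion.2 ⟨(i, ⟨a, by omega⟩, ⟨b, by omega⟩), hab, h1, h2⟩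
    _ ≤ ∑ z, (Measure.pi fun _ : Fin T => rankLaw n).real (B z) :=
        measureReal_iUnion_fintype_le _
    _ ≤ ∑ _z : Fin n × Fin (T + 1) × Fin (T + 1), 2 * Real.exp (-(θ * L - κ * T)) :=
        Finset.sum_le_sum fun z _ => hB z
    _ = _ := by
        rw [Finset.sum_const, Finset.card_univ]
        simp only [Fintype.card_prod, Fintype.card_fin, nsmul_eq_mul]
        push_cast
        ring

end Drift

end GeoP

/-! ### Means and concentration over uniformly random birth ranks -/

namespace GeoP

section Means

variable {α δ : ℝ} {n : ℕ}

theorem sum_fin_add_one (f : ℕ → ℝ) (n : ℕ) :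
    ∑ x : Fin n, f ((x : ℕ) + 1) = ∑ r ∈ Finset.Icc 1 n, f r := by
  rw [Fin.sum_univ_eq_sum_range (fun t => f (t + 1))]
  induction n with
  | zero => simp
  | succ n ih => rw [Finset.sum_range_succ, ih, Finset.sum_Icc_succ_top (by omega)]

theorem sum_div_rpow (q : ℝ) (n : ℕ) :
    ∑ r ∈ Finset.Icc 1 n, ((r : ℝ) / n) ^ q = (∑ r ∈ Finset.Icc 1 n, (r : ℝ) ^ q) / (n : ℝ) ^ q := by
  rw [Finset.sum_div]
  exact Finset.sum_congr rfl fun r _ => Real.div_rpow (Nat.cast_nonneg _) (Nat.cast_nonneg _) _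

/-- The mean truncated influence of a uniformly random rank. -/
theorem abs_sum_truncInfluence_sub_le (hα : 0 < α) (hα1 : α < 1) (hδ : 0 < δ) (hn : 0 < n) :
    |∑ x : Fin n, truncInfluence α δ (((x : ℕ) + 1 : ℕ) / n) - 1 / (1 - α) * n| ≤
      1 / (1 - α) * (δ ^ (1 - α) + (n : ℝ) ^ (-(1 - α))) * n := by
  have hn' : (0 : ℝ) < n := by exact_mod_cast hn
  have h1a : 0 < 1 - α := by linarith
  have hpow : (n : ℝ) ^ (1 - α) / (n : ℝ) ^ (-α) = n := by
    rw [← Real.rpow_sub hn']; simp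
  have hpos : ∀ x : Fin n, (0 : ℝ) < (((x : ℕ) + 1 : ℕ) : ℝ) / n := fun x => by positivity
  have hfull : ∑ x : Fin n, ((((x : ℕ) + 1 : ℕ) : ℝ) / n) ^ (-α) =
      (∑ r ∈ Finset.Icc 1 n, (r : ℝ) ^ (-α)) / (n : ℝ) ^ (-α) := by
    rw [← sum_div_rpow, ← sum_fin_add_one fun r => ((r : ℝ) / n) ^ (-α)]
  have hup : ∑ x : Fin n, truncInfluence α δ (((x : ℕ) + 1 : ℕ) / n) ≤ 1 / (1 - α) * n := by
    calc _ ≤ ∑ x : Fin n, ((((x : ℕ) + 1 : ℕ) : ℝ) / n) ^ (-α) :=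
          Finset.sum_le_sum fun x _ => truncInfluence_le_rpow hα (hpos x)
      _ = (∑ r ∈ Finset.Icc 1 n, (r : ℝ) ^ (-α)) / (n : ℝ) ^ (-α) := hfull
      _ ≤ ((n : ℝ) ^ (1 - α) / (1 - α)) / (n : ℝ) ^ (-α) := by
          gcongr; exact sum_rpow_neg_le hα hα1 n
      _ = 1 / (1 - α) * ((n : ℝ) ^ (1 - α) / (n : ℝ) ^ (-α)) := by ring
      _ = _ := by rw [hpow]
  have hlow : 1 / (1 - α) * n - 1 / (1 - α) * (δ ^ (1 - α) + (n : ℝ) ^ (-(1 - α))) * n ≤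
      ∑ x : Fin n, truncInfluence α δ (((x : ℕ) + 1 : ℕ) / n) := by
    have hsmall := sum_small_rank_le (f := fun x : Fin n => (x : ℕ) + 1) hα hα1 hδ hn
      (fun x y h => Fin.ext (by simpa using h)) (fun x => Nat.le_add_left 1 _)
    have hge : ∑ x : Fin n, ((((x : ℕ) + 1 : ℕ) : ℝ) / n) ^ (-α) ≤
        ∑ x : Fin n, truncInfluence α δ (((x : ℕ) + 1 : ℕ) / n) +
        ∑ x : Fin n, (if (((x : ℕ) + 1 : ℕ) : ℝ) / n < δ then
          ((((x : ℕ) + 1 : ℕ) : ℝ) / n) ^ (-α) else 0) := by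
      rw [← Finset.sum_add_distrib]
      refine Finset.sum_le_sum fun x _ => ?_
      split_ifs with h
      · linarith [truncInfluence_pos (α := α) hδ ((((x : ℕ) + 1 : ℕ) : ℝ) / n)]
      · rw [truncInfluence_eq (not_lt.1 h), add_zero]
    have hsum : 1 / (1 - α) * n - 1 / (1 - α) * (n : ℝ) ^ (-(1 - α)) * n ≤
        ∑ x : Fin n, ((((x : ℕ) + 1 : ℕ) : ℝ) / n) ^ (-α) := by
      rw [hfull, le_div_iff₀ (by positivity)]
      refine le_trans (b := ((n : ℝ) ^ (1 - α) - 1) / (1 - α)) (le_of_eq ?_)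
        (le_trans ?_ (le_sum_rpow_neg hα hα1 n))
      · have e1 : (n : ℝ) * (n : ℝ) ^ (-α) = (n : ℝ) ^ (1 - α) := by
          rw [sub_eq_add_neg, Real.rpow_add hn', Real.rpow_one]
        have e2 : (n : ℝ) ^ (-(1 - α)) * (n : ℝ) ^ (1 - α) = 1 := by
          rw [← Real.rpow_add hn']; simp
        calc _ = 1 / (1 - α) * (n * (n : ℝ) ^ (-α)) -
              1 / (1 - α) * ((n : ℝ) ^ (-(1 - α)) * (n * (n : ℝ) ^ (-α))) := by ring
          _ = _ := by rw [e1, e2]; ring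
      · gcongr
        linarith
    nlinarith
  have hb : 0 ≤ 1 / (1 - α) * (δ ^ (1 - α) + (n : ℝ) ^ (-(1 - α))) * n := by positivity
  rw [abs_le]
  constructor <;> linarith

/-- With t = y^α the term (1-α)t alone averages to (1-α)/(1+α); the quadratic term is the strict
gain that later absorbs all errors. Both inequalities hold by factoring the differences as αt(1 -
(1-α)(1-t)) and (1-α)(1-t)(1-αt). -/
theorem le_min_one_sub {t : ℝ} (hα : 0 < α) (hα1 : α < 1) (h0 : 0 ≤ t) (h1 : t ≤ 1) :
    (1 - α) * t + α * (1 - α) * (t * (1 - t)) ≤ min t (1 - α) := by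
  refine le_min ?_ ?_
  · have : 0 ≤ α * t * (1 - (1 - α) * (1 - t)) := by
      have : (1 - α) * (1 - t) ≤ 1 := mul_le_one₀ (by linarith) (by linarith) (by linarith)
      exact mul_nonneg (by positivity) (by linarith)
    linarith
  · have : 0 ≤ (1 - α) * ((1 - t) * (1 - α * t)) := by
      have : α * t ≤ 1 := mul_le_one₀ hα1.le h0 h1
      exact mul_nonneg (by linarith) (mul_nonneg (by linarith) (by linarith))
    linarith

/-- The mean of the clustering profile at a uniformly random rank. -/
theorem le_sum_min_rpow (hα : 0 < α) (hα1 : α < 1) (hn : 0 < n) :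
    ((1 - α) - α * (1 - α) * (((n : ℝ) + 1) / n) ^ (2 * α + 1) / (2 * α + 1)) * n ≤
      ∑ x : Fin n, min (((((x : ℕ) + 1 : ℕ) : ℝ) / n) ^ α) (1 - α) := by
  have hn' : (0 : ℝ) < n := by exact_mod_cast hn
  have hle : ∀ x : Fin n, (1 - α) * (1 + α) * ((((x : ℕ) + 1 : ℕ) : ℝ) / n) ^ α -
      α * (1 - α) * ((((x : ℕ) + 1 : ℕ) : ℝ) / n) ^ (2 * α) ≤
      min (((((x : ℕ) + 1 : ℕ) : ℝ) / n) ^ α) (1 - α) := fun x => by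
    have h0 : (0 : ℝ) ≤ (((x : ℕ) + 1 : ℕ) : ℝ) / n := by positivity
    have h1 : (((x : ℕ) + 1 : ℕ) : ℝ) / n ≤ 1 :=
      (div_le_one hn').2 (by exact_mod_cast x.2)
    refine le_trans (le_of_eq ?_) (le_min_one_sub hα hα1 (by positivity)
      (Real.rpow_le_one h0 h1 hα.le))
    rw [mul_comm 2 α, Real.rpow_mul h0, Real.rpow_two]
    ring
  refine le_trans ?_ (Finset.sum_le_sum fun x _ => hle x)
  rw [Finset.sum_sub_distrib, ← Finset.mul_sum, ← Finset.mul_sum,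
    sum_fin_add_one fun r => ((r : ℝ) / n) ^ α, sum_fin_add_one fun r => ((r : ℝ) / n) ^ (2 * α),
    sum_div_rpow, sum_div_rpow]
  have h1 : (n : ℝ) / (α + 1) ≤ (∑ r ∈ Finset.Icc 1 n, (r : ℝ) ^ α) / (n : ℝ) ^ α := by
    rw [le_div_iff₀ (by positivity)]
    refine le_trans (le_of_eq ?_) (le_sum_rpow hα n)
    rw [Real.rpow_add hn', Real.rpow_one]
    ring
  have h2 : (∑ r ∈ Finset.Icc 1 n, (r : ℝ) ^ (2 * α)) / (n : ℝ) ^ (2 * α) ≤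
      (((n : ℝ) + 1) / n) ^ (2 * α + 1) / (2 * α + 1) * n := by
    rw [div_le_iff₀ (by positivity)]
    refine (sum_rpow_le (by linarith : 0 < 2 * α) n).trans (le_of_eq ?_)
    rw [Real.div_rpow (by positivity) hn'.le, Real.rpow_add hn', Real.rpow_one]
    field_simp
  have h3 : (1 - α) * (1 + α) * ((n : ℝ) / (α + 1)) = (1 - α) * n := by
    field_simp; ring
  have h4 : 0 ≤ (1 - α) * (1 + α) := mul_nonneg (by linarith) (by linarith)
  have h5 : 0 ≤ α * (1 - α) := mul_nonneg hα.le (by linarith)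
  have h6 := mul_le_mul_of_nonneg_left h1 h4
  have h7 := mul_le_mul_of_nonneg_left h2 h5
  calc _ = (1 - α) * n - α * (1 - α) *
        ((((n : ℝ) + 1) / n) ^ (2 * α + 1) / (2 * α + 1) * n) := by ring
    _ ≤ _ := by linarith

end Means

section BirthRanks

variable {n : ℕ}

/-- Given the deletions, the birth ranks of the nodes are independent and uniform. -/
theorem measureReal_birthRanks_le (hn : 0 < n) (d₀ : Fin n × Fin n) (T : ℕ)
    (P : (Fin n → ℕ) → (Fin n → Fin n) → Prop) {b : ℝ} (hb : 0 ≤ b)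
    (h : ∀ τ, Function.Injective τ →
      (Measure.pi fun _ : Fin n => uniformOn (Set.univ : Set (Fin n))).real {x | P τ x} ≤ b) :
    (Measure.pi fun _ : Fin T => rankLaw n).real
      {d | (∀ i, ∃ t < T, (extendSeq d₀ d t).1 = i) ∧
        P (lastTime (fun t => (extendSeq d₀ d t).1) T)
          (fun i => (extendSeq d₀ d (lastTime (fun t => (extendSeq d₀ d t).1) T i)).2)} ≤ b := by
  have := isProbabilityMeasure_uniformOn_univ hn
  set ν := uniformOn (Set.univ : Set (Fin n)) with hν
  have h2 := (measurePreserving_arrowProdEquivProdArrow (Fin n) (Fin n) (Fin T)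
    (fun _ => ν) (fun _ => ν)).symm
  set S := {d : Fin T → Fin n × Fin n | (∀ i, ∃ t < T, (extendSeq d₀ d t).1 = i) ∧
        P (lastTime (fun t => (extendSeq d₀ d t).1) T)
          (fun i => (extendSeq d₀ d (lastTime (fun t => (extendSeq d₀ d t).1) T i)).2)}
  have hS : MeasurableSet S := (Set.toFinite S).measurableSet
  change (Measure.pi fun _ : Fin T => ν.prod ν).real S ≤ b
  rw [measureReal_def, ← h2.measure_preimage hS.nullMeasurableSet, ← measureReal_def]
  have key := measureReal_prod_le (μ := Measure.pi fun _ : Fin T => ν)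
    (ν := Measure.pi fun _ : Fin T => ν) (h2.measurable hS) MeasurableSet.univ hb ?_
  · simpa using key
  intro D _
  -- The deletions alone determine the birth times. With them fixed, the birth ranks are the initial
  -- ranks drawn at n distinct steps.
  set D' : ℕ → Fin n := extendSeq d₀.1 D with hD'
  by_cases hD : ∀ i, ∃ t < T, D' t = i
  · set τ := lastTime D' T with hτ
    have hτT : ∀ i, τ i < T := fun i => (lastTime_spec hD i).1
    let f : Fin n → Fin T := fun i => ⟨τ i, hτT i⟩
    have hf : Function.Injective f := fun i j h => injective_lastTime hD (congrArg Fin.val h)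
    refine le_trans (le_of_eq ?_) (h τ (injective_lastTime hD))
    rw [measureReal_def, measureReal_def, ← (measurePreserving_comp_injective ν
      hf).measure_preimage (Set.toFinite {x | P τ x}).measurableSet.nullMeasurableSet]
    congr 2
    ext R
    let d : Fin T → Fin n × Fin n := fun t => (D t, R t)
    have e1 : ∀ t, (extendSeq d₀ d t).1 = D' t := fun t => by
      rw [hD']; unfold extendSeq; split_ifs <;> rfl
    have e2 : ∀ i, (extendSeq d₀ d (τ i)).2 = R (f i) := fun i => by
      rw [extendSeq_of_lt _ _ (hτT i)]
    change ((∀ i, ∃ t < T, (extendSeq d₀ d t).1 = i) ∧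
        P (lastTime (fun t => (extendSeq d₀ d t).1) T)
          (fun i => (extendSeq d₀ d (lastTime (fun t => (extendSeq d₀ d t).1) T i)).2)) ↔ _
    simp only [e1]
    change ((∀ i, ∃ t < T, D' t = i) ∧ P τ (fun i => (extendSeq d₀ d (τ i)).2)) ↔ _
    simp only [e2]
    exact ⟨fun h => h.2, fun h => ⟨hD, h⟩⟩
  · refine le_of_eq_of_le ?_ hb
    convert measureReal_empty
    refine Set.eq_empty_of_forall_notMem fun R hR => hD ?_
    let d : Fin T → Fin n × Fin n := fun t => (D t, R t)
    have e1 : ∀ t, (extendSeq d₀ d t).1 = D' t := fun t => by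
      rw [hD']; unfold extendSeq; split_ifs <;> rfl
    have := hR.1
    change ∀ i, ∃ t < T, (extendSeq d₀ d t).1 = i at this
    simpa only [e1] using this

variable {α δ ε : ℝ}

/-- Truncation bounds each summand by δ^(-α), so the two-sided Chernoff bound applies for each v.
Half of ε pays for the error in the mean, half for the fluctuation. -/
theorem measureReal_older_le (hα : 0 < α) (hα1 : α < 1) (hδ : 0 < δ) (hδ1 : δ ≤ 1) (hε : 0 < ε)
    (hε1 : ε ≤ 1) (hn : 0 < n)
    (hmean : 1 / (1 - α) * (δ ^ (1 - α) + (n : ℝ) ^ (-(1 - α))) ≤ ε / 2) (τ : Fin n → ℕ) :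
    (Measure.pi fun _ : Fin n => uniformOn (Set.univ : Set (Fin n))).real
      {x | ∃ v, ε * n < |∑ i, (if τ i < τ v then
          truncInfluence α δ (((x i : ℕ) + 1 : ℕ) / n) else 0) -
        1 / (1 - α) * ∑ i, (if τ i < τ v then (1 : ℝ) else 0)|} ≤
      n * (2 * Real.exp (-((ε / 2) ^ 2 / (4 * (δ ^ (-α)) ^ 2) * n))) := by
  have := isProbabilityMeasure_uniformOn_univ hn
  have hn' : (0 : ℝ) < n := by exact_mod_cast hn
  set ν := uniformOn (Set.univ : Set (Fin n)) with hν
  have hk : 1 ≤ δ ^ (-α) := Real.one_le_rpow_of_pos_of_le_one_of_nonpos hδ hδ1 (by linarith)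
  set Q := 1 / (1 - α) with hQ
  let B : Fin n → Set (Fin n → Fin n) := fun v => {x | ε * n < |∑ i, (if τ i < τ v then
          truncInfluence α δ (((x i : ℕ) + 1 : ℕ) / n) else 0) -
        Q * ∑ i, (if τ i < τ v then (1 : ℝ) else 0)|}
  have hB : ∀ v, (Measure.pi fun _ : Fin n => ν).real (B v) ≤
      2 * Real.exp (-((ε / 2) ^ 2 / (4 * (δ ^ (-α)) ^ 2) * n)) := by
    intro v
    let W : Fin n → Fin n → ℝ := fun i y =>
      if τ i < τ v then truncInfluence α δ (((y : ℕ) + 1 : ℕ) / n) else 0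
    have hW0 : ∀ i y, 0 ≤ W i y := fun i y => by
      simp only [W]; split_ifs
      · exact (truncInfluence_pos hδ _).le
      · exact le_rfl
    have hW1 : ∀ i y, W i y ≤ δ ^ (-α) := fun i y => by
      simp only [W]; split_ifs
      · exact truncInfluence_le hα hδ _
      · linarith
    have key := measureReal_abs_sum_sub_le (ν := ν) (W := W) (fun _ => Measurable.of_discrete)
      hW0 hW1 (by linarith : 0 < ε / 2) (by linarith)
    rw [Fintype.card_fin] at key
    refine le_trans (measureReal_mono (fun x hx => ?_) (measure_ne_top _ _)) key
    have hx' : ε * n < |∑ i, W i (x i) - Q * ∑ i, (if τ i < τ v then (1 : ℝ) else 0)| := hx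
    change ε / 2 * n < |∑ i, W i (x i) - ∑ i, ∫ y, W i y ∂ν|
    have hd : |∑ i, ∫ y, W i y ∂ν - Q * ∑ i, (if τ i < τ v then (1 : ℝ) else 0)| ≤ ε / 2 * n := by
      rw [Finset.mul_sum, ← Finset.sum_sub_distrib]
      refine (Finset.abs_sum_le_sum_abs _ _).trans ?_
      calc _ ≤ ∑ _i : Fin n, ε / 2 := Finset.sum_le_sum fun i _ => ?_
        _ = ε / 2 * n := by simp [mul_comm]
      rw [integral_uniformOn_univ hn]
      simp only [W]
      split_ifs with h
      · have h1 := abs_sum_truncInfluence_sub_le hα hα1 hδ hn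
        rw [mul_one]
        have e : (∑ x : Fin n, truncInfluence α δ (((x : ℕ) + 1 : ℕ) / n)) / n - Q =
            (∑ x : Fin n, truncInfluence α δ (((x : ℕ) + 1 : ℕ) / n) - Q * n) / n := by
          field_simp
        rw [e, abs_div, abs_of_pos hn', div_le_iff₀ hn']
        exact h1.trans (mul_le_mul_of_nonneg_right hmean hn'.le)
      · simp; linarith
    have := abs_sub_le (∑ i, W i (x i)) (∑ i, ∫ y, W i y ∂ν)
      (Q * ∑ i, (if τ i < τ v then (1 : ℝ) else 0))
    linarith
  calc _ ≤ (Measure.pi fun _ : Fin n => ν).real (⋃ v, B v) := by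
        refine measureReal_mono ?_ (measure_ne_top _ _)
        rintro x ⟨v, hv⟩
        exact Set.mem_iUnion.2 ⟨v, hv⟩
    _ ≤ ∑ v, (Measure.pi fun _ : Fin n => ν).real (B v) := measureReal_iUnion_fintype_le _
    _ ≤ ∑ _v : Fin n, 2 * Real.exp (-((ε / 2) ^ 2 / (4 * (δ ^ (-α)) ^ 2) * n)) :=
        Finset.sum_le_sum fun v _ => hB v
    _ = _ := by rw [Finset.sum_const, Finset.card_univ, Fintype.card_fin, nsmul_eq_mul]

theorem measureReal_profile_le (hα : 0 < α) (hα1 : α < 1) (hε : 0 < ε) (hε1 : ε ≤ 1) (hn : 0 < n)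
    {I : ℝ} (hmean : I - ε / 2 ≤
      (1 - α) - α * (1 - α) * (((n : ℝ) + 1) / n) ^ (2 * α + 1) / (2 * α + 1)) :
    (Measure.pi fun _ : Fin n => uniformOn (Set.univ : Set (Fin n))).real
      {x | ¬ ((I - ε) * n ≤ ∑ v, min (((((x v : ℕ) + 1 : ℕ) : ℝ) / n) ^ α) (1 - α))} ≤
      2 * Real.exp (-((ε / 2) ^ 2 / 4 * n)) := by
  have := isProbabilityMeasure_uniformOn_univ hn
  have hn' : (0 : ℝ) < n := by exact_mod_cast hn
  set ν := uniformOn (Set.univ : Set (Fin n)) with hν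
  let W : Fin n → Fin n → ℝ := fun _ y => min (((((y : ℕ) + 1 : ℕ) : ℝ) / n) ^ α) (1 - α)
  have hW0 : ∀ i y, 0 ≤ W i y := fun i y => le_min (by positivity) (by linarith)
  have hW1 : ∀ i y, W i y ≤ 1 := fun i y => (min_le_right _ _).trans (by linarith)
  have key := measureReal_abs_sum_sub_le (ν := ν) (W := W) (fun _ => Measurable.of_discrete)
    hW0 hW1 (by linarith : 0 < ε / 2) (by linarith)
  rw [Fintype.card_fin] at key
  rw [one_pow, mul_one] at key
  refine le_trans (measureReal_mono (fun x hx => ?_) (measure_ne_top _ _)) key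
  have hx' : ∑ i, W i (x i) < (I - ε) * n := not_le.1 hx
  change ε / 2 * n < |∑ i, W i (x i) - ∑ i, ∫ y, W i y ∂ν|
  have hd : (I - ε / 2) * n ≤ ∑ i, ∫ y, W i y ∂ν := by
    have e : ∑ i : Fin n, ∫ y, W i y ∂ν =
        ∑ x : Fin n, min (((((x : ℕ) + 1 : ℕ) : ℝ) / n) ^ α) (1 - α) := by
      have ei : ∀ i, ∫ y, W i y ∂ν = (∑ x, W i x) / n := fun i => integral_uniformOn_univ hn _
      rw [Finset.sum_congr rfl fun i _ => ei i]
      simp only [W]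
      rw [Finset.sum_const, Finset.card_univ, Fintype.card_fin, nsmul_eq_mul]
      field_simp
    rw [e]
    exact (mul_le_mul_of_nonneg_right hmean hn'.le).trans (le_sum_min_rpow hα hα1 hn)
  rw [abs_sub_comm]
  exact lt_of_lt_of_le (by linarith) (le_abs_self _)

end BirthRanks

end GeoP

/-! ### The clustering coefficient at the end of a run -/

namespace GeoP

section RunClustering

variable {n m : ℕ} {α β δ ε I : ℝ}

theorem regularSchedule_of_not_drift (σ : Equiv.Perm (Fin n)) {d : ℕ → Fin n × Fin n} {T : ℕ}
    (hD : ∀ i, ∃ t < T, (d t).1 = i)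
    (hdrift : ∀ i a b, a ≤ b → b ≤ T → (∀ s, a ≤ s → s < b → (d s).1 ≠ i) →
      |((rankAt σ d b i : ℕ) - (rankAt σ d a i : ℕ) : ℝ)| ≤ ε * δ * n)
    (holder : ∀ v, |∑ i, (if lastTime (fun t => (d t).1) T i < lastTime (fun t => (d t).1) T v then
        truncInfluence α δ ((((d (lastTime (fun t => (d t).1) T i)).2 : ℕ) + 1 : ℕ) / n) else 0) -
      1 / (1 - α) * ∑ i, (if lastTime (fun t => (d t).1) T i < lastTime (fun t => (d t).1) T v then
        (1 : ℝ) else 0)| ≤ ε * n) :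
    RegularSchedule α δ ε (lastTime (fun t => (d t).1) T)
      (fun i j => rankAt σ d (lastTime (fun t => (d t).1) T j) i + 1)
      (fun i => (d (lastTime (fun t => (d t).1) T i)).2 + 1) where
  injective_time := injective_lastTime hD
  one_le_rk _ _ := Nat.le_add_left _ _
  rk_le _ _ := Fin.is_lt _
  injective_rk j a b h := (rankAt σ d _).injective (Fin.ext (by simpa using h))
  birth_le _ := Fin.is_lt _
  drift i j hij := by
    have h1 := lastTime_spec hD i
    have h2 := lastTime_spec hD j
    -- The window starts one step after the last replacement of i, when its rank equals the initial
    -- rank drawn, and ends just before the birth of j. The shifts by 1 from zero-based ranks cancel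
    -- in the difference.
    have h3 := hdrift i (lastTime (fun t => (d t).1) T i + 1) (lastTime (fun t => (d t).1) T j)
      hij h2.1.le fun s ha hb => ne_of_lastTime_lt (D := fun t => (d t).1) ha (hb.trans h2.1)
    have h4 := rankAt_succ_self σ d (lastTime (fun t => (d t).1) T i)
    have h5 : (d (lastTime (fun t => (d t).1) T i)).1 = i := h1.2
    rw [h5] at h4
    rw [h4] at h3
    push_cast
    rwa [add_sub_add_right_eq_sub]
  older := holder

/-- The clustering coefficient after a long run of the chain. -/
theorem measureReal_run_clustering_lt_le (hα : 0 < α) (hα1 : α < 1) (hβ : 0 < β)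
    (p : unitInterval) (hp : 0 < p) (hδ : 0 < δ) (hδ1 : δ ≤ 1) (hε : 0 < ε) (hε1 : ε ≤ 1 / 40)
    (hδε : 2 * (1 / (1 - α) * δ ^ (1 - α)) ≤ ε) (hn : 2 ≤ n) (hm : 1 ≤ m)
    (hbig : 1 / (1 - α) + δ ^ (-α) ≤ ε * n)
    (hmean : 1 / (1 - α) * (δ ^ (1 - α) + (n : ℝ) ^ (-(1 - α))) ≤ ε / 2)
    (hprofile : I - ε / 2 ≤
      (1 - α) - α * (1 - α) * (((n : ℝ) + 1) / n) ^ (2 * α + 1) / (2 * α + 1))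
    (ω₀ : Innovation n m) (s : State n m) (T : ℕ) {κ θ : ℝ} (hθ0 : 0 ≤ θ) (hθ : θ ≤ 1)
    (hκ : 2 * θ ^ 2 + 2 * θ / n ≤ κ) :
    (Measure.pi fun _ : Fin T => innovationLaw p n m).real
      {ω | (run α β s (extendSeq ω₀ ω) T).2.2 ∈ {G | ¬ ((1 - 40 * ε) *
        (p * (3 / 4) ^ m * ((I - ε) - (2 * δ) ^ α)) ≤ clusteringCoeff G)}} ≤
      n * Real.exp (-((T : ℝ) / n)) +
      n * (T + 1) ^ 2 * (2 * Real.exp (-(θ * (ε * δ * n) - κ * T))) +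
      n * (2 * Real.exp (-((ε / 2) ^ 2 / (4 * (δ ^ (-α)) ^ 2) * n))) +
      2 * Real.exp (-((ε / 2) ^ 2 / 4 * n)) +
      n * (3 * Real.exp (-(ε ^ 2 * (p : ℝ) ^ 2 * (δ ^ α * (1 - α)) / 128 *
        ((n : ℝ) ^ (1 - α - β) * (3 / 4) ^ m)))) := by
  have hn0 : 0 < n := by omega
  have := isProbabilityMeasure_rankLaw hn0
  set d₀ : Fin n × Fin n := (ω₀.1, ω₀.2.2.1) with hd₀
  let B1 : Set (Fin T → Fin n × Fin n) := {d | ∃ i, ∀ t, (d t).1 ≠ i}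
  let B2 : Set (Fin T → Fin n × Fin n) := {d | ∃ i a b, a ≤ b ∧ b ≤ T ∧
    (∀ s, a ≤ s → s < b → (extendSeq d₀ d s).1 ≠ i) ∧ ε * δ * n ≤
      |((rankAt s.2.1 (extendSeq d₀ d) b i : ℕ) - (rankAt s.2.1 (extendSeq d₀ d) a i : ℕ) : ℝ)|}
  let P3 : (Fin n → ℕ) → (Fin n → Fin n) → Prop := fun τ x =>
    ∃ v, ε * n < |∑ i, (if τ i < τ v then truncInfluence α δ (((x i : ℕ) + 1 : ℕ) / n) else 0) -
        1 / (1 - α) * ∑ i, (if τ i < τ v then (1 : ℝ) else 0)|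
  let P4 : (Fin n → ℕ) → (Fin n → Fin n) → Prop := fun _ x =>
    ¬ ((I - ε) * n ≤ ∑ v, min (((((x v : ℕ) + 1 : ℕ) : ℝ) / n) ^ α) (1 - α))
  let B : ((Fin n → ℕ) → (Fin n → Fin n) → Prop) → Set (Fin T → Fin n × Fin n) := fun P =>
    {d | (∀ i, ∃ t < T, (extendSeq d₀ d t).1 = i) ∧ P (lastTime (fun t => (extendSeq d₀ d t).1) T)
          (fun i => (extendSeq d₀ d (lastTime (fun t => (extendSeq d₀ d t).1) T i)).2)}
  have k1 : (Measure.pi fun _ : Fin T => rankLaw n).real B1 ≤ _ :=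
    measureReal_not_refreshed_le hn0 T
  have k2 : (Measure.pi fun _ : Fin T => rankLaw n).real B2 ≤ _ :=
    measureReal_exists_rank_drift_le hn0 s.2.1 d₀ T hθ0 hθ hκ
  have k3 : (Measure.pi fun _ : Fin T => rankLaw n).real (B P3) ≤ _ :=
    measureReal_birthRanks_le hn0 d₀ T P3 (by positivity) fun τ _ =>
      measureReal_older_le hα hα1 hδ hδ1 hε (by linarith) hn0 hmean τ
  have k4 : (Measure.pi fun _ : Fin T => rankLaw n).real (B P4) ≤ _ :=
    measureReal_birthRanks_le hn0 d₀ T P4 (by positivity) fun τ _ =>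
      measureReal_profile_le hα hα1 hε (by linarith) hn0 hprofile
  refine (measureReal_run_graph_le α β p hn0 ω₀ s T _ (B1 ∪ B2 ∪ B P3 ∪ B P4)ᶜ
    (b := n * (3 * Real.exp (-(ε ^ 2 * (p : ℝ) ^ 2 * (δ ^ α * (1 - α)) / 128 *
        ((n : ℝ) ^ (1 - α - β) * (3 / 4) ^ m))))) (by positivity) ?_).trans ?_
  · intro d hd
    have h1 : d ∉ B1 := fun h => hd (Or.inl (Or.inl (Or.inl h)))
    have h2 : d ∉ B2 := fun h => hd (Or.inl (Or.inl (Or.inr h)))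
    have h3 : d ∉ B P3 := fun h => hd (Or.inl (Or.inr h))
    have h4 : d ∉ B P4 := fun h => hd (Or.inr h)
    have hD : ∀ i, ∃ t < T, (extendSeq d₀ d t).1 = i := by
      intro i
      by_contra hcon
      refine h1 ⟨i, fun t ht => hcon ⟨t, t.2, ?_⟩⟩
      rw [extendSeq_of_lt _ _ t.2]
      exact ht
    refine ⟨hD, ?_⟩
    have hreg := regularSchedule_of_not_drift (α := α) (δ := δ) (ε := ε) s.2.1 hD
      (fun i a b hab hb hne => (not_le.1 fun hle => h2 ⟨i, a, b, hab, hb, hne, hle⟩).le)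
      (fun v => not_lt.1 fun hlt => h3 ⟨hD, v, hlt⟩)
    exact hreg.clustering_tail hα hα1 hβ p hp hδ hδ1 hε hε1 hδε hn hm hbig
      (not_not.1 fun hcon => h4 ⟨hD, hcon⟩)
  · rw [compl_compl]
    have u1 := measureReal_union_le (μ := Measure.pi fun _ : Fin T => rankLaw n)
      (B1 ∪ B2 ∪ B P3) (B P4)
    have u2 := measureReal_union_le (μ := Measure.pi fun _ : Fin T => rankLaw n)
      (B1 ∪ B2) (B P3)
    have u3 := measureReal_union_le (μ := Measure.pi fun _ : Fin T => rankLaw n) B1 B2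
    linarith

end RunClustering

end GeoP

/-- A stretched exponential beats polynomial factors and `exp (log² n)`. -/
theorem eventually_mul_rpow_mul_exp_le (C : ℝ) {k c q : ℝ} (hk : 0 ≤ k) (hc : 0 < c) (hq : 0 < q) :
    ∀ᶠ n : ℕ in atTop, C * (n : ℝ) ^ k * Real.exp (-(c * (n : ℝ) ^ q)) ≤
      Real.exp (-(Real.log n ^ 2)) := by
  have h1 := (isLittleO_log_rpow_rpow_atTop (s := q) 2 hq).def
    (div_pos hc (by linarith : 0 < k + 2))
  have h2 : Tendsto (fun n : ℕ => (n : ℝ)) atTop atTop := tendsto_natCast_atTop_atTop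
  filter_upwards [h2.eventually h1, h2.eventually (eventually_ge_atTop C),
    h2.eventually (eventually_ge_atTop (Real.exp 1))] with n h3 h4 h5
  have hn : (0 : ℝ) < n := (Real.exp_pos 1).trans_le h5
  have hl : 1 ≤ Real.log n := by rwa [Real.le_log_iff_exp_le hn]
  rw [Real.norm_of_nonneg (by positivity), Real.norm_of_nonneg (by positivity),
    div_mul_eq_mul_div, le_div_iff₀ (by linarith), Real.rpow_two] at h3
  calc C * (n : ℝ) ^ k * Real.exp (-(c * (n : ℝ) ^ q))
      ≤ n * (n : ℝ) ^ k * Real.exp (-(c * (n : ℝ) ^ q)) := by gcongr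
    _ = Real.exp (Real.log n + Real.log n * k + -(c * (n : ℝ) ^ q)) := by
        rw [Real.exp_add, Real.exp_add, Real.exp_log hn, Real.rpow_def_of_pos hn]
    _ ≤ _ := by
        have h6 : Real.log n ≤ Real.log n ^ 2 := le_self_pow₀ hl two_ne_zero
        have h7 := mul_le_mul_of_nonneg_right h6 hk
        exact Real.exp_le_exp.2 (by linarith)

/-! ### Choice of parameters and the bound with extreme probability -/

namespace GeoP

section Wep

variable {n m : ℕ} {α β : ℝ}

theorem IsGeoP.isProbabilityMeasure {p : unitInterval} {μ : Measure (SimpleGraph (Fin n))}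
    (h : IsGeoP α β p n m μ) : IsProbabilityMeasure μ := by
  obtain ⟨π, hπ, -, rfl⟩ := h
  have hg : Measurable fun s : State n m => s.2.2 := by fun_prop
  exact Measure.isProbabilityMeasure_map hg.aemeasurable

/-- A bound on the run from every initial state transfers to the stationary law. -/
theorem IsGeoP.one_sub_le_measureReal {p : unitInterval} {μ : Measure (SimpleGraph (Fin n))}
    (h : IsGeoP α β p n m μ) (hn : 0 < n) (ω₀ : Innovation n m) (T : ℕ)
    {E : Set (SimpleGraph (Fin n))} {b : ℝ} (hb : 0 ≤ b)
    (hE : ∀ s, (Measure.pi fun _ : Fin T => innovationLaw p n m).real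
      {ω | (run α β s (extendSeq ω₀ ω) T).2.2 ∈ Eᶜ} ≤ b) : 1 - b ≤ μ.real E := by
  have := h.isProbabilityMeasure
  have := isProbabilityMeasure_innovationLaw p m hn
  have hEm : MeasurableSet E := (Set.toFinite E).measurableSet
  suffices μ.real Eᶜ ≤ b by
    rw [probReal_compl_eq_one_sub hEm] at this
    linarith
  obtain ⟨π, hπ, hinv, rfl⟩ := h
  have hg : Measurable fun s : State n m => s.2.2 := by fun_prop
  have hrun := measurePreserving_run hn hinv ω₀ T
  rw [map_measureReal_apply hg hEm.compl, measureReal_def,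
    ← hrun.measure_preimage (hg hEm.compl).nullMeasurableSet, ← measureReal_def]
  have key := measureReal_prod_le (μ := π)
    (ν := Measure.pi fun _ : Fin T => innovationLaw p n m) (hrun.measurable (hg hEm.compl)) MeasurableSet.univ hb
    fun s _ => hE s
  simpa using key

theorem two_pow_le_of_two_le_gridSize (hn : 1 ≤ n) (hm : 1 ≤ m) (h : 2 ≤ gridSize α β n m) :
    (2 : ℝ) ^ m ≤ (n : ℝ) ^ (1 - α - β) / Real.log n ^ 3 := by
  have hlog : 0 ≤ Real.log n := Real.log_nonneg (by exact_mod_cast hn)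
  set y := (n : ℝ) ^ (1 - α - β) / Real.log n ^ 3 with hy
  have hy0 : 0 ≤ y := by positivity
  have hx : (2 : ℝ) ≤ y ^ (1 / (m : ℝ)) := by
    unfold gridSize floorEven at h
    rw [← hy] at h
    have h1 : 1 ≤ ⌊y ^ (1 / (m : ℝ)) / 2⌋₊ := by omega
    rw [Nat.one_le_floor_iff] at h1
    linarith
  calc (2 : ℝ) ^ m ≤ (y ^ (1 / (m : ℝ))) ^ m := by gcongr
    _ = y := by
      rw [← Real.rpow_natCast, ← Real.rpow_mul hy0, one_div_mul_cancel (by positivity),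
        Real.rpow_one]

/-- From K ≥ 2 one gets 2^m ≤ n^(1-α-β); as 9/16 ≥ 1/2, the square of (3/4)^m is then at least
n^(-(1-α-β)). -/
theorem rpow_half_le_of_two_le_gridSize (hm : 1 ≤ m) (hlog : 1 ≤ Real.log n)
    (h : 2 ≤ gridSize α β n m) :
    (n : ℝ) ^ ((1 - α - β) / 2) ≤ (n : ℝ) ^ (1 - α - β) * (3 / 4) ^ m := by
  have hn : 1 ≤ n := by
    rcases Nat.eq_zero_or_pos n with rfl | h
    · simp at hlog; linarith
    · exact h
  have hn' : (0 : ℝ) < n := by exact_mod_cast hn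
  have h1 := two_pow_le_of_two_le_gridSize hn hm h
  have h2 : (2 : ℝ) ^ m ≤ (n : ℝ) ^ (1 - α - β) :=
    h1.trans (div_le_self (by positivity) (one_le_pow₀ hlog))
  have e : (n : ℝ) ^ (1 - α - β) = (n : ℝ) ^ ((1 - α - β) / 2) * (n : ℝ) ^ ((1 - α - β) / 2) := by
    rw [← Real.rpow_add hn', add_halves]
  set z := (n : ℝ) ^ ((1 - α - β) / 2)
  have hz : 0 < z := Real.rpow_pos_of_pos hn' _
  have h3 : 1 ≤ z * (3 / 4) ^ m := by
    have : 1 ≤ (z * (3 / 4) ^ m) ^ 2 := by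
      calc (1 : ℝ) = (2 : ℝ) ^ m * (1 / 2) ^ m := by rw [← mul_pow]; norm_num
        _ ≤ (z * z) * (9 / 16) ^ m := by
            rw [← e]
            exact mul_le_mul h2 (pow_le_pow_left₀ (by norm_num) (by norm_num) m) (by positivity)
              (by positivity)
        _ = _ := by rw [show (9 / 16 : ℝ) = (3 / 4) ^ 2 by norm_num, ← pow_mul, mul_comm 2 m, pow_mul]; ring
    exact (one_le_sq_iff₀ (by positivity)).1 this
  rw [e]
  nlinarith

/-- Parameters for which the losses are absorbed by the convexity of the rank profile. -/
theorem exists_clustering_parameters (hα : 0 < α) (hα1 : α < 1) :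
    ∃ ε δ : ℝ, 0 < ε ∧ ε ≤ 1 / 40 ∧ 0 < δ ∧ δ ≤ 1 ∧ 1 / (1 - α) * δ ^ (1 - α) ≤ ε / 4 ∧
      (1 - α) / (1 + α) ≤ (1 - 40 * ε) *
        (((1 - α) - α * (1 - α) / (2 * α + 1) - ε) - (2 * δ) ^ α) := by
  set I := (1 - α) - α * (1 - α) / (2 * α + 1) with hI
  -- The strict slack behind the whole argument; it reduces to 1 + α < 2α + 1.
  have hlt : (1 - α) / (1 + α) < I := by
    rw [hI, div_lt_iff₀ (by linarith)]
    have h1 : α / (2 * α + 1) * (1 + α) < α := by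
      rw [div_mul_eq_mul_div, div_lt_iff₀ (by linarith)]
      nlinarith
    have : ((1 - α) - α * (1 - α) / (2 * α + 1)) * (1 + α) =
      (1 - α) * ((1 + α) - α / (2 * α + 1) * (1 + α)) := by ring
    rw [this]
    nlinarith
  have h1 : Tendsto (fun ε : ℝ => (1 - 40 * ε) * (I - ε - ε)) (𝓝 0)
      (𝓝 ((1 - 40 * 0) * (I - 0 - 0))) := by
    apply Continuous.tendsto; fun_prop
  -- ε is fixed first, with a second -ε held in reserve for the loss (2δ)^α; then δ is chosen in
  -- terms of ε.
  have h1' : ∀ᶠ ε : ℝ in 𝓝[>] 0, (1 - α) / (1 + α) < (1 - 40 * ε) * (I - ε - ε) :=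
    (h1.mono_left nhdsWithin_le_nhds).eventually (lt_mem_nhds (by simpa using hlt))
  have h2 : ∀ᶠ ε : ℝ in 𝓝[>] 0, ε ≤ 1 / 40 :=
    nhdsWithin_le_nhds (Iic_mem_nhds (by norm_num))
  obtain ⟨ε, hε1, hε2, hε0⟩ := (h1'.and (h2.and self_mem_nhdsWithin)).exists
  have hε0 : 0 < ε := hε0
  have h3 : Tendsto (fun δ : ℝ => 1 / (1 - α) * δ ^ (1 - α)) (𝓝 0)
      (𝓝 (1 / (1 - α) * (0 : ℝ) ^ (1 - α))) :=
    ((Real.continuousAt_rpow_const 0 (1 - α) (Or.inr (by linarith))).const_mul _).tendsto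
  have h4 : Tendsto (fun δ : ℝ => (2 * δ) ^ α) (𝓝 0) (𝓝 ((2 * 0 : ℝ) ^ α)) := by
    have : ContinuousAt (fun δ : ℝ => (2 * δ) ^ α) 0 :=
      ContinuousAt.rpow_const (by fun_prop) (Or.inr hα.le)
    exact this.tendsto
  rw [Real.zero_rpow (by linarith), mul_zero] at h3
  rw [mul_zero, Real.zero_rpow (by linarith)] at h4
  have h5 : ∀ᶠ δ : ℝ in 𝓝[>] 0, 1 / (1 - α) * δ ^ (1 - α) ≤ ε / 4 :=
    (h3.mono_left nhdsWithin_le_nhds).eventually (Iic_mem_nhds (by linarith))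
  have h6 : ∀ᶠ δ : ℝ in 𝓝[>] 0, (2 * δ) ^ α ≤ ε :=
    (h4.mono_left nhdsWithin_le_nhds).eventually (Iic_mem_nhds hε0)
  have h7 : ∀ᶠ δ : ℝ in 𝓝[>] 0, δ ≤ 1 := nhdsWithin_le_nhds (Iic_mem_nhds (by norm_num))
  obtain ⟨δ, hδ1, hδ2, hδ3, hδ0⟩ := (h5.and (h6.and (h7.and self_mem_nhdsWithin))).exists
  refine ⟨ε, δ, hε0, hε2, hδ0, hδ3, hδ1, hε1.le.trans ?_⟩
  refine mul_le_mul_of_nonneg_left ?_ ?_ <;> linarith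

/-- The choice θ = η/(4√N) for T = Nt ≤ N^(3/2) steps and a drift ηN: the gain is η²√N/4 and the
compensator costs at most η²√N/8 + η/2. -/
theorem drift_exponent_le {η N t : ℝ} (hN : 1 ≤ N) (hη : 0 ≤ η) (ht : t ≤ N ^ (1 / 2 : ℝ)) :
    -(η / (4 * N ^ (1 / 2 : ℝ)) * (η * N) - (2 * (η / (4 * N ^ (1 / 2 : ℝ))) ^ 2 +
      2 * (η / (4 * N ^ (1 / 2 : ℝ))) / N) * (N * t)) ≤ η / 2 + -(η ^ 2 / 8 * N ^ (1 / 2 : ℝ)) := by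
  have hN0 : 0 < N := by linarith
  set w := N ^ (1 / 2 : ℝ) with hw
  have hw0 : 0 < w := Real.rpow_pos_of_pos hN0 _
  have e : N = w * w := by rw [hw, ← Real.rpow_add hN0]; norm_num
  have e1 : η / (4 * w) * (η * N) = η ^ 2 / 4 * w := by rw [e]; field_simp
  have e2 : (2 * (η / (4 * w)) ^ 2 + 2 * (η / (4 * w)) / N) * (N * t) ≤
      (2 * (η / (4 * w)) ^ 2 + 2 * (η / (4 * w)) / N) * (N * w) := by gcongr
  have e3 : (2 * (η / (4 * w)) ^ 2 + 2 * (η / (4 * w)) / N) * (N * w) =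
      η ^ 2 / 8 * w + η / 2 := by
    rw [e]; field_simp; ring
  rw [e1]
  linarith

/-- The run length n⌊√n⌋ is long enough to replace all nodes, with error about n·exp(-√n), and short
enough that ranks move by o(n). Each of the five errors is a power of n times a stretched
exponential and gets a fifth of the budget. -/
theorem eventually_errors_le {η a b c γ : ℝ} (hη0 : 0 < η) (ha : 0 < a)
    (hb : 0 < b) (hc : 0 < c) (hγ : 0 < γ) :
    ∀ᶠ n : ℕ in atTop, n * Real.exp (-(((n * Nat.sqrt n : ℕ) : ℝ) / n)) +
      n * (((n * Nat.sqrt n : ℕ) : ℝ) + 1) ^ 2 *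
        (2 * Real.exp (-(η / (4 * (n : ℝ) ^ (1 / 2 : ℝ)) * (η * n) -
          (2 * (η / (4 * (n : ℝ) ^ (1 / 2 : ℝ))) ^ 2 +
            2 * (η / (4 * (n : ℝ) ^ (1 / 2 : ℝ))) / n) * ((n * Nat.sqrt n : ℕ) : ℝ)))) +
      n * (2 * Real.exp (-(a * n))) + 2 * Real.exp (-(b * n)) +
      n * (3 * Real.exp (-(c * (n : ℝ) ^ γ))) ≤ Real.exp (-(Real.log n ^ 2)) := by
  have w1 := eventually_mul_rpow_mul_exp_le (5 * Real.exp 1) zero_le_one one_pos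
    (by norm_num : (0 : ℝ) < 1 / 2)
  have w2 := eventually_mul_rpow_mul_exp_le (40 * Real.exp (η / 2)) (by norm_num : (0 : ℝ) ≤ 5)
    (by positivity : 0 < η ^ 2 / 8) (by norm_num : (0 : ℝ) < 1 / 2)
  have w3 := eventually_mul_rpow_mul_exp_le 10 zero_le_one ha one_pos
  have w4 := eventually_mul_rpow_mul_exp_le 10 le_rfl hb one_pos
  have w5 := eventually_mul_rpow_mul_exp_le 15 zero_le_one hc hγ
  filter_upwards [w1, w2, w3, w4, w5, eventually_ge_atTop 2] with n w1 w2 w3 w4 w5 hn2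
  have hn1 : (1 : ℝ) ≤ n := by exact_mod_cast (by omega : 1 ≤ n)
  set t := Nat.sqrt n with ht
  have hsq : Real.sqrt n = (n : ℝ) ^ (1 / 2 : ℝ) := Real.sqrt_eq_rpow _
  have ht1 : (t : ℝ) ≤ (n : ℝ) ^ (1 / 2 : ℝ) := by rw [← hsq]; exact Real.nat_sqrt_le_real_sqrt
  have ht2 : (n : ℝ) ^ (1 / 2 : ℝ) ≤ t + 1 := by
    rw [← hsq]; exact Real.real_sqrt_le_nat_sqrt_succ
  rw [Real.rpow_one] at w1 w3 w5
  rw [Real.rpow_one, Real.rpow_zero] at w4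
  set F := Real.exp (-(Real.log n ^ 2))
  have e1 : n * Real.exp (-(((n * t : ℕ) : ℝ) / n)) ≤ F / 5 := by
    have h1 : -(((n * t : ℕ) : ℝ) / n) ≤ 1 + -(1 * (n : ℝ) ^ (1 / 2 : ℝ)) := by
      push_cast
      rw [mul_div_cancel_left₀ _ (by positivity)]
      linarith
    have h2 := Real.exp_le_exp.2 h1
    rw [Real.exp_add] at h2
    have h3 := mul_le_mul_of_nonneg_left h2 (by linarith : (0 : ℝ) ≤ n)
    linarith
  have e2 : n * (((n * t : ℕ) : ℝ) + 1) ^ 2 * (2 * Real.exp (-(η / (4 * (n : ℝ) ^ (1 / 2 : ℝ)) *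
      (η * n) - (2 * (η / (4 * (n : ℝ) ^ (1 / 2 : ℝ))) ^ 2 +
      2 * (η / (4 * (n : ℝ) ^ (1 / 2 : ℝ))) / n) * ((n * t : ℕ) : ℝ)))) ≤ F / 5 := by
    have h1 := drift_exponent_le hn1 hη0.le ht1
    have h2 : ((n * t : ℕ) : ℝ) + 1 ≤ 2 * n ^ 2 := by
      have : (t : ℝ) ≤ n := by exact_mod_cast Nat.sqrt_le_self n
      push_cast
      nlinarith
    have h3 := Real.exp_le_exp.2 h1
    rw [Real.exp_add, ← Nat.cast_mul] at h3
    calc _ ≤ n * (2 * (n : ℝ) ^ 2) ^ 2 * (2 * (Real.exp (η / 2) *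
          Real.exp (-(η ^ 2 / 8 * (n : ℝ) ^ (1 / 2 : ℝ))))) := by gcongr
      _ = (40 * Real.exp (η / 2) * (n : ℝ) ^ (5 : ℝ) *
          Real.exp (-(η ^ 2 / 8 * (n : ℝ) ^ (1 / 2 : ℝ)))) / 5 := by
          rw [show (5 : ℝ) = ((5 : ℕ) : ℝ) by norm_num, Real.rpow_natCast]
          push_cast
          ring
      _ ≤ _ := by gcongr
  linarith

theorem eventually_means_close (hα1 : α < 1) {δ ε : ℝ} (hε : 0 < ε)
    (hδε : 1 / (1 - α) * δ ^ (1 - α) ≤ ε / 4) :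
    ∀ᶠ n : ℕ in atTop, 1 / (1 - α) + δ ^ (-α) ≤ ε * n ∧
      1 / (1 - α) * (δ ^ (1 - α) + (n : ℝ) ^ (-(1 - α))) ≤ ε / 2 ∧
      (1 - α) - α * (1 - α) / (2 * α + 1) - ε / 2 ≤
        (1 - α) - α * (1 - α) * (((n : ℝ) + 1) / n) ^ (2 * α + 1) / (2 * α + 1) := by
  have h1a : 0 < 1 - α := by linarith
  have hN : Tendsto (fun n : ℕ => (n : ℝ)) atTop atTop := tendsto_natCast_atTop_atTop
  refine ((hN.const_mul_atTop hε).eventually_ge_atTop _).and (Eventually.and ?_ ?_)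
  · have h := ((tendsto_rpow_neg_atTop h1a).comp hN).const_mul (1 / (1 - α))
    rw [mul_zero] at h
    filter_upwards [h.eventually (Iic_mem_nhds (by linarith : (0 : ℝ) < ε / 4))] with n hn
    have hn : 1 / (1 - α) * (n : ℝ) ^ (-(1 - α)) ≤ ε / 4 := hn
    rw [mul_add]
    linarith
  · have h0 : Tendsto (fun n : ℕ => ((n : ℝ) + 1) / n) atTop (𝓝 1) := by
      have := (tendsto_const_nhds (x := (1 : ℝ))).add tendsto_one_div_atTop_nhds_zero_nat
      rw [add_zero] at this
      refine this.congr' ?_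
      filter_upwards [eventually_ge_atTop 1] with n hn
      have : (n : ℝ) ≠ 0 := by positivity
      field_simp
    have h1 := ((((h0.rpow_const (p := 2 * α + 1) (Or.inl one_ne_zero)).const_mul
      (α * (1 - α))).div_const (2 * α + 1)).const_sub (1 - α))
    rw [Real.one_rpow, mul_one] at h1
    exact h1.eventually (Ici_mem_nhds (by linarith))

/-- The clean bound that implies both clustering statements of the theorem; the slack in
`exists_clustering_parameters` makes any 1+o(1) unnecessary. -/
theorem withExtremeProbability_le_clusteringCoeff (hα : 0 < α) (hα1 : α < 1) (hβ : 0 < β)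
    (hβ1 : β < 1 - α) (p : unitInterval) (hp : 0 < p) (m : ℕ → ℕ) (hm : ∀ n, 1 ≤ m n)
    (hK : ∀ᶠ n : ℕ in atTop, 2 ≤ gridSize α β n (m n)) :
    WithExtremeProbability α β p m fun n => {G |
      (3 / 4 : ℝ) ^ m n * ((1 - α) / (1 + α)) * (p : ℝ) ≤ clusteringCoeff G} := by
  obtain ⟨ε, δ, hε, hε1, hδ, hδ1, hδε, hslack⟩ := exists_clustering_parameters hα hα1
  have hp0 : (0 : ℝ) < p := hp
  have h1a : 0 < 1 - α := by linarith
  have hη1 : ε * δ ≤ 1 := mul_le_one₀ (by linarith) hδ.le hδ1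
  set c := ε ^ 2 * (p : ℝ) ^ 2 * (δ ^ α * (1 - α)) / 128 with hc
  have hc0 : 0 < c := by positivity
  refine ⟨1, one_pos, ?_⟩
  filter_upwards [eventually_means_close hα1 hε hδε, eventually_errors_le (mul_pos hε hδ)
    (by positivity : 0 < (ε / 2) ^ 2 / (4 * (δ ^ (-α)) ^ 2)) (by positivity : 0 < (ε / 2) ^ 2 / 4)
    hc0 (by linarith : 0 < (1 - α - β) / 2), eventually_ge_atTop 2, hK,
    tendsto_natCast_atTop_atTop.eventually_ge_atTop (Real.exp 1)] with n hmeans herr hn2 hK hne μ hμ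
  have hn0 : 0 < n := by omega
  have hn1 : (1 : ℝ) ≤ n := by exact_mod_cast hn0
  have hlog : 1 ≤ Real.log n := by rwa [Real.le_log_iff_exp_le (by linarith)]
  have hgrid : Real.exp (-(c * ((n : ℝ) ^ (1 - α - β) * (3 / 4) ^ m n))) ≤
      Real.exp (-(c * (n : ℝ) ^ ((1 - α - β) / 2))) :=
    Real.exp_le_exp.2 (neg_le_neg (mul_le_mul_of_nonneg_left
      (rpow_half_le_of_two_le_gridSize (hm n) hlog hK) hc0.le))
  have hgrid' := mul_le_mul_of_nonneg_left hgrid (by positivity : (0 : ℝ) ≤ n * 3)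
  have hw : 1 ≤ (n : ℝ) ^ (1 / 2 : ℝ) := Real.one_le_rpow hn1 (by norm_num)
  have hθ : ε * δ / (4 * (n : ℝ) ^ (1 / 2 : ℝ)) ≤ 1 := by
    rw [div_le_one (by positivity)]
    linarith
  let ω₀ : Innovation n (m n) := (⟨0, hn0⟩, 0, ⟨0, hn0⟩, fun _ => true)
  have key := fun s => measureReal_run_clustering_lt_le hα hα1 hβ p hp hδ hδ1 hε hε1
    (by linarith) hn2 (hm n) hmeans.1 hmeans.2.1 hmeans.2.2 ω₀ s (n * Nat.sqrt n)
    (by positivity : 0 ≤ ε * δ / (4 * (n : ℝ) ^ (1 / 2 : ℝ))) hθ le_rfl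
  rw [← hc] at key
  have key2 := hμ.one_sub_le_measureReal hn0 ω₀ (n * Nat.sqrt n)
    (b := Real.exp (-(Real.log n ^ 2))) (Real.exp_pos _).le
    (fun s => (key s).trans (by linarith))
  rw [one_mul]
  have := hμ.isProbabilityMeasure
  refine key2.trans (measureReal_mono (fun G hG => ?_) (measure_ne_top _ _))
  refine le_trans ?_ (show _ ≤ clusteringCoeff G from hG)
  have hq : 0 ≤ (p : ℝ) * (3 / 4) ^ m n := by positivity
  have := mul_le_mul_of_nonneg_left hslack hq
  linarith

end Wep

end GeoP

/-! ### The clustering coefficient of the binomial random graph -/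

section Binomial

variable {V : Type*} [Fintype V]

open Classical in
theorem binomialRandom_real_singleton (q : unitInterval) (G : SimpleGraph V) :
    (SimpleGraph.binomialRandom V q).real {G} =
      (q : ℝ) ^ G.edgeSet.ncard * (1 - q) ^ ((Fintype.card V).choose 2 - G.edgeSet.ncard) := by
  rw [measureReal_def, SimpleGraph.binomialRandom_singleton, Nat.card_eq_fintype_card]
  simp

open Classical in
/-- Resampling one edge: in the binomial random graph, the presence of `e` is independent of
quantities that do not depend on `e`. -/
theorem integral_binomialRandom_edge (q : unitInterval) {e : Sym2 V} (he : ¬ e.IsDiag)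
    {h : SimpleGraph V → ℝ} (hh : ∀ G, h (G.deleteEdges {e}) = h G) :
    ∫ G, (if e ∈ G.edgeSet then h G else 0) ∂(SimpleGraph.binomialRandom V q) =
      q * ∫ G, h G ∂(SimpleGraph.binomialRandom V q) := by
  rw [integral_fintype Integrable.of_finite, integral_fintype Integrable.of_finite]
  simp only [smul_eq_mul]
  -- Adding e multiplies the weight of a graph by q/(1-q). The relation is used in cross-multiplied
  -- form, so q = 0 and q = 1 need no separate treatment. Pairing graphs with and without e gives
  -- (1-q)S₁ = qS₀, hence S₁ = q(S₀ + S₁).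
  set w : SimpleGraph V → ℝ := fun G => (SimpleGraph.binomialRandom V q).real {G} with hw
  have hstep : ∀ G : SimpleGraph V, e ∈ G.edgeSet →
      (1 - (q : ℝ)) * w G = q * w (G.deleteEdges {e}) := by
    intro G heG
    have hcard : (G.deleteEdges {e}).edgeSet.ncard + 1 = G.edgeSet.ncard := by
      rw [SimpleGraph.edgeSet_deleteEdges]
      exact Set.ncard_sdiff_singleton_add_one heG (Set.toFinite _)
    have hle : G.edgeSet.ncard ≤ (Fintype.card V).choose 2 := by
      rw [Set.ncard_eq_toFinset_card']
      exact G.card_edgeFinset_le_card_choose_two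
    simp only [hw, binomialRandom_real_singleton]
    rw [← hcard] at hle ⊢
    obtain ⟨N, hN⟩ := Nat.exists_eq_add_of_le hle
    set k := (G.deleteEdges {e}).edgeSet.ncard
    rw [hN, show k + 1 + N - (k + 1) = N by omega, show k + 1 + N - k = N + 1 by omega]
    ring
  have hbij : ∑ G with e ∈ G.edgeSet, w (G.deleteEdges {e}) * h G =
      ∑ G with ¬ e ∈ G.edgeSet, w G * h G := by
    refine Finset.sum_bij' (fun G _ => G.deleteEdges {e})
      (fun G _ => G ⊔ SimpleGraph.fromEdgeSet {e}) ?_ ?_ ?_ ?_ ?_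
    · intro G _
      simp [SimpleGraph.edgeSet_deleteEdges]
    · intro G _
      simp [SimpleGraph.edgeSet_sup, SimpleGraph.edgeSet_fromEdgeSet, he]
    · intro G hG
      have hG : e ∈ G.edgeSet := (Finset.mem_filter.1 hG).2
      rw [← SimpleGraph.edgeSet_inj, SimpleGraph.edgeSet_sup, SimpleGraph.edgeSet_fromEdgeSet,
        SimpleGraph.edgeSet_deleteEdges]
      ext f
      simp only [Set.mem_union, Set.mem_sdiff, Set.mem_singleton_iff]
      constructor
      · rintro (⟨h1, -⟩ | ⟨rfl, -⟩) <;> assumption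
      · intro hf
        by_cases hfe : f = e
        · right; subst hfe; exact ⟨rfl, he⟩
        · left; exact ⟨hf, hfe⟩
    · intro G hG
      have hG : e ∉ G.edgeSet := (Finset.mem_filter.1 hG).2
      rw [← SimpleGraph.edgeSet_inj, SimpleGraph.edgeSet_deleteEdges, SimpleGraph.edgeSet_sup,
        SimpleGraph.edgeSet_fromEdgeSet]
      ext f
      simp only [Set.mem_union, Set.mem_sdiff, Set.mem_singleton_iff]
      constructor
      · rintro ⟨h1 | ⟨h1, -⟩, h2⟩
        · exact h1
        · exact absurd h1 h2
      · intro hf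
        exact ⟨Or.inl hf, by rintro rfl; exact hG hf⟩
    · intro G _
      rw [hh]
  have h1 : (1 - (q : ℝ)) * ∑ G with e ∈ G.edgeSet, w G * h G =
      q * ∑ G with ¬ e ∈ G.edgeSet, w G * h G := by
    rw [← hbij, Finset.mul_sum, Finset.mul_sum]
    refine Finset.sum_congr rfl fun G hG => ?_
    rw [← mul_assoc, hstep G (Finset.mem_filter.1 hG).2, mul_assoc]
  have h2 := Finset.sum_filter_add_sum_filter_not Finset.univ
    (fun G : SimpleGraph V => e ∈ G.edgeSet) (fun G => w G * h G)
  have h3 : ∑ G, w G * (if e ∈ G.edgeSet then h G else 0) =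
      ∑ G with e ∈ G.edgeSet, w G * h G := by
    rw [Finset.sum_filter]
    exact Finset.sum_congr rfl fun G _ => by split_ifs <;> simp
  rw [h3, ← h2]
  linarith

open Classical in
theorem card_nondiag_subset (N : Set V) :
    ∑ e : Sym2 V, (if ¬ e.IsDiag ∧ ∀ w ∈ e, w ∈ N then (1 : ℝ) else 0) = (N.ncard.choose 2 : ℕ) := by
  rw [Finset.sum_boole, Set.ncard_eq_toFinset_card', ← Sym2.card_image_offDiag]
  congr 2
  ext e
  induction e with
  | _ a b =>
    simp only [Finset.mem_filter, Finset.mem_univ, true_and, Sym2.mk_isDiag_iff, Sym2.mem_iff,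
      Finset.mem_image, Finset.mem_offDiag, Set.mem_toFinset, Prod.exists]
    constructor
    · rintro ⟨h1, h2⟩
      exact ⟨a, b, ⟨h2 a (Or.inl rfl), h2 b (Or.inr rfl), h1⟩, rfl⟩
    · rintro ⟨x, y, ⟨h1, h2, h3⟩, h⟩
      rcases Sym2.eq_iff.1 h with ⟨rfl, rfl⟩ | ⟨rfl, rfl⟩
      · exact ⟨h3, by rintro w (rfl | rfl) <;> assumption⟩
      · exact ⟨Ne.symm h3, by rintro w (rfl | rfl) <;> assumption⟩

-- For e avoiding v, the neighbourhood of v does not depend on the presence of e, so each pair of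
-- neighbours is joined with conditional probability q. The resulting ratio of `deg v` choose 2 with
-- itself is 1, or 0 when the degree is at most 1.
open Classical in
theorem integral_localClustering_binomialRandom_le (q : unitInterval) (v : V) :
    ∫ G, localClustering G v ∂(SimpleGraph.binomialRandom V q) ≤ q := by
  let h : Sym2 V → SimpleGraph V → ℝ := fun e G =>
    if ¬ e.IsDiag ∧ ∀ w ∈ e, w ∈ G.neighborSet v then
      (1 : ℝ) / (((G.neighborSet v).ncard.choose 2 : ℕ) : ℝ) else 0
  have h1 : ∀ G : SimpleGraph V, localClustering G v =
      ∑ e : Sym2 V, if e ∈ G.edgeSet then h e G else 0 := by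
    intro G
    have : ({e ∈ G.edgeSet | ∀ w ∈ e, w ∈ G.neighborSet v}.ncard : ℝ) =
        ∑ e : Sym2 V, if e ∈ G.edgeSet ∧ ∀ w ∈ e, w ∈ G.neighborSet v then (1 : ℝ) else 0 := by
      rw [Finset.sum_boole, Set.ncard_eq_toFinset_card']
      congr 2
      ext e
      simp
    rw [localClustering, this, Finset.sum_div]
    refine Finset.sum_congr rfl fun e _ => ?_
    by_cases he : e ∈ G.edgeSet
    · have hd := G.not_isDiag_of_mem_edgeSet he
      simp only [h, he, hd, true_and, not_false_eq_true, if_true]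
      split_ifs <;> simp
    · simp [he]
  have h2 : ∀ e, ∫ G, (if e ∈ G.edgeSet then h e G else 0) ∂(SimpleGraph.binomialRandom V q) =
      q * ∫ G, h e G ∂(SimpleGraph.binomialRandom V q) := by
    intro e
    by_cases he : e.IsDiag
    · simp [h, he]
    · refine integral_binomialRandom_edge q he fun G => ?_
      -- An edge through v never lies inside the neighbourhood of v, since v is not its own
      -- neighbour.
      by_cases hv : v ∈ e
      · simp only [h]
        rw [if_neg, if_neg]
        · exact fun hc => (G.irrefl (hc.2 v hv))
        · exact fun hc => ((G.deleteEdges {e}).irrefl (hc.2 v hv))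
      · have : (G.deleteEdges {e}).neighborSet v = G.neighborSet v := by
          ext w
          simp only [SimpleGraph.mem_neighborSet, SimpleGraph.deleteEdges_adj,
            Set.mem_singleton_iff, and_iff_left_iff_imp]
          rintro - rfl
          exact hv (Sym2.mem_mk_left _ _)
        simp only [h, this]
  have h3 : ∀ G, ∑ e, h e G ≤ 1 := by
    intro G
    have : ∑ e, h e G = (∑ e : Sym2 V, (if ¬ e.IsDiag ∧ ∀ w ∈ e, w ∈ G.neighborSet v then
        (1 : ℝ) else 0)) / (((G.neighborSet v).ncard.choose 2 : ℕ) : ℝ) := by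
      rw [Finset.sum_div]
      exact Finset.sum_congr rfl fun e _ => by simp only [h]; split_ifs <;> simp
    have hc : ∑ e : Sym2 V, (if ¬ e.IsDiag ∧ ∀ w ∈ e, w ∈ G.neighborSet v then (1 : ℝ) else 0) =
        ((G.neighborSet v).ncard.choose 2 : ℕ) := by
      convert card_nondiag_subset (G.neighborSet v)
    rw [this, hc]
    exact div_self_le_one _
  calc ∫ G, localClustering G v ∂(SimpleGraph.binomialRandom V q)
      = ∑ e, ∫ G, (if e ∈ G.edgeSet then h e G else 0) ∂(SimpleGraph.binomialRandom V q) := by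
        simp only [h1]
        exact integral_finsetSum _ fun e _ => Integrable.of_finite
    _ = q * ∫ G, ∑ e, h e G ∂(SimpleGraph.binomialRandom V q) := by
        rw [integral_finsetSum _ fun e _ => Integrable.of_finite, Finset.mul_sum]
        exact Finset.sum_congr rfl fun e _ => h2 e
    _ ≤ q * ∫ _G, (1 : ℝ) ∂(SimpleGraph.binomialRandom V q) := by
        refine mul_le_mul_of_nonneg_left ?_ q.2.1
        exact integral_mono Integrable.of_finite (integrable_const _) h3
    _ = q := by simp

theorem integral_clusteringCoeff_binomialRandom_le (q : unitInterval) :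
    ∫ G, clusteringCoeff G ∂(SimpleGraph.binomialRandom V q) ≤ q := by
  simp only [clusteringCoeff]
  rw [integral_div, integral_finsetSum _ fun v _ => Integrable.of_finite]
  refine div_le_of_le_mul₀ (Nat.cast_nonneg _) q.2.1 ?_
  calc _ ≤ ∑ _v : V, (q : ℝ) :=
        Finset.sum_le_sum fun v _ => integral_localClustering_binomialRandom_le q v
    _ = _ := by simp [mul_comm]

end Binomial

namespace GeoP

/-! ### The expected average degree -/

section Degree

variable {n m : ℕ} {α β : ℝ}

open Classical in
theorem sum_degree_eq (G : SimpleGraph (Fin n)) :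
    ∑ u, (G.degree u : ℝ) = 2 * G.edgeSet.ncard := by
  rw [Set.ncard_eq_toFinset_card']
  exact_mod_cast G.sum_degrees_eq_twice_card_edges

open Classical in
/-- One step removes the edges of the deleted node and adds at most one edge per linked node. -/
theorem ncard_edgeSet_nextGraph_le (s : State n m) (ω : Innovation n m) :
    ((nextGraph α β s ω).edgeSet.ncard : ℝ) ≤ s.2.2.edgeSet.ncard - s.2.2.degree ω.1 +
      ∑ w, (if Linked α β s ω w then (1 : ℝ) else 0) := by
  have hsub : (nextGraph α β s ω).edgeSet ⊆ (s.2.2.edgeSet \ s.2.2.incidenceSet ω.1) ∪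
      (fun w => s(ω.1, w)) '' {w | Linked α β s ω w} := by
    intro e he
    induction e with
    | _ a b =>
      rw [SimpleGraph.mem_edgeSet] at he
      obtain ⟨-, ⟨h1, h2, h3⟩ | ⟨rfl, h⟩ | ⟨rfl, h⟩⟩ := he
      · refine Or.inl ⟨h3, fun h => ?_⟩
        rcases Sym2.mem_iff.1 h.2 with h | h
        · exact h1 h.symm
        · exact h2 h.symm
      · exact Or.inr ⟨b, h, rfl⟩
      · exact Or.inr ⟨a, h, Sym2.eq_swap⟩
  have h1 := Set.ncard_le_ncard hsub (Set.toFinite _)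
  have h2 := Set.ncard_union_le (s.2.2.edgeSet \ s.2.2.incidenceSet ω.1)
    ((fun w => s(ω.1, w)) '' {w | Linked α β s ω w})
  have h3 := Set.ncard_image_le (f := fun w => s(ω.1, w)) (Set.toFinite {w | Linked α β s ω w})
  have h4 := Set.ncard_sdiff_add_ncard_of_subset (s.2.2.incidenceSet_subset ω.1) (Set.toFinite _)
  have h5 : (s.2.2.incidenceSet ω.1).ncard = s.2.2.degree ω.1 := by
    rw [Set.ncard_eq_toFinset_card', ← SimpleGraph.card_incidenceFinset_eq_degree]
    rfl
  have h6 : ({w | Linked α β s ω w}.ncard : ℝ) =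
      ∑ w, (if Linked α β s ω w then (1 : ℝ) else 0) := by
    rw [Finset.sum_boole, Set.ncard_eq_toFinset_card']
    congr 2
    ext w; simp
  rw [← h6]
  rw [h5] at h4
  have h7 : ((s.2.2.edgeSet \ s.2.2.incidenceSet ω.1).ncard : ℝ) + s.2.2.degree ω.1 =
    s.2.2.edgeSet.ncard := by exact_mod_cast h4
  have h8 : ((nextGraph α β s ω).edgeSet.ncard : ℝ) ≤
      (s.2.2.edgeSet \ s.2.2.incidenceSet ω.1).ncard + ({w | Linked α β s ω w}.ncard : ℝ) := by
    exact_mod_cast h1.trans (h2.trans (by omega))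
  linarith

theorem innovationLaw_real_linked_le (p : unitInterval) (hn : 0 < n) (hα : 0 < α) (hβ : 0 < β)
    (hm : 1 ≤ m) (s : State n m) (w : Fin n) :
    (innovationLaw p n m).real {ω | Linked α β s ω w} ≤
      influenceVolume α β n ((s.2.1 w : ℕ) + 1) := by
  have := isProbabilityMeasure_uniformOn_univ hn
  have := isProbabilityMeasure_innovationLaw p m hn
  have hmp : MeasurePreserving (fun ω : Innovation n m => ω.2.1) (innovationLaw p n m)
      (volume : Measure (Torus m)) := measurePreserving_fst.comp measurePreserving_snd
  have hball : MeasurableSet (influenceRegion α β n m ((s.2.1 w : ℕ) + 1) (s.1 w)) :=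
    Metric.isClosed_closedBall.measurableSet
  calc _ ≤ (innovationLaw p n m).real ((fun ω : Innovation n m => ω.2.1) ⁻¹'
        influenceRegion α β n m ((s.2.1 w : ℕ) + 1) (s.1 w)) :=
        measureReal_mono (fun ω hω => hω.1) (measure_ne_top _ _)
    _ = influenceVolume α β n ((s.2.1 w : ℕ) + 1) := by
        rw [measureReal_def, hmp.measure_preimage hball.nullMeasurableSet,
          volume_influenceRegion hα.le hβ.le hn hm (Nat.le_add_left 1 _),
          ENNReal.toReal_ofReal (by unfold influenceVolume; positivity)]

theorem sum_influenceVolume_le (hn : 0 < n) (hα : 0 < α) (hα1 : α < 1)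
    (σ : Equiv.Perm (Fin n)) :
    ∑ w, influenceVolume α β n ((σ w : ℕ) + 1) ≤ 1 / (1 - α) * (n : ℝ) ^ (1 - α - β) := by
  have hn' : (0 : ℝ) < n := by exact_mod_cast hn
  rw [Equiv.sum_comp σ (fun x : Fin n => influenceVolume α β n ((x : ℕ) + 1)),
    sum_fin_add_one (fun r => influenceVolume α β n r)]
  simp only [influenceVolume]
  rw [← Finset.sum_mul]
  calc _ ≤ (n : ℝ) ^ (1 - α) / (1 - α) * (n : ℝ) ^ (-β) := by
        gcongr; exact sum_rpow_neg_le hα hα1 n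
    _ = _ := by
        rw [show (1 : ℝ) - α - β = (1 - α) + -β by ring, Real.rpow_add hn']; ring

/-- In the stationary law, deletions and insertions of edges balance. -/
theorem IsGeoP.integral_averageDegree_le {p : unitInterval} {μ : Measure (SimpleGraph (Fin n))}
    (h : IsGeoP α β p n m μ) (hn : 0 < n) (hm : 1 ≤ m) (hα : 0 < α) (hα1 : α < 1) (hβ : 0 < β) :
    ∫ G, averageDegree G ∂μ ≤ 1 / (1 - α) * (n : ℝ) ^ (1 - α - β) := by
  classical
  have := h.isProbabilityMeasure
  have := isProbabilityMeasure_uniformOn_univ hn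
  have := isProbabilityMeasure_innovationLaw p m hn
  have hn' : (0 : ℝ) < n := by exact_mod_cast hn
  obtain ⟨π, hπ, hinv, rfl⟩ := h
  have hg : Measurable fun s : State n m => s.2.2 := by fun_prop
  have hgm : MeasurePreserving (fun s : State n m => s.2.2) π (π.map fun s => s.2.2) :=
    hg.measurePreserving π
  set μ := π.map fun s => s.2.2
  let e : SimpleGraph (Fin n) → ℝ := fun G => G.edgeSet.ncard
  have hemeas : ∀ f : SimpleGraph (Fin n) → ℝ, Measurable f := fun f => measurable_of_finite f
  have hcomp : ∀ f : SimpleGraph (Fin n) → ℝ, ∫ G, f G ∂μ = ∫ s, f s.2.2 ∂π := fun f =>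
    integral_map hg.aemeasurable (hemeas f).aestronglyMeasurable
  have hint : ∀ f : SimpleGraph (Fin n) → ℝ, Integrable (fun s : State n m => f s.2.2) π :=
    fun f => hgm.integrable_comp_of_integrable Integrable.of_finite
  have hstep := measurePreserving_step hn hinv
  have hintstep : Integrable (fun z : State n m × Innovation n m => e (nextGraph α β z.1 z.2))
      (π.prod (innovationLaw p n m)) := hstep.integrable_comp_of_integrable (hint e)
  -- The expected number of edges is the same before and after a step. The expected loss is the
  -- average degree, as the deleted node is uniform; the expected gain is at most the total
  -- influence volume.
  have hbal : ∫ s, ∫ ω, e (nextGraph α β s ω) ∂(innovationLaw p n m) ∂π = ∫ s, e s.2.2 ∂π := by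
    rw [← integral_prod _ hintstep]
    have hee : Measurable fun s : State n m => e s.2.2 := (hemeas e).comp hg
    conv_rhs => rw [← hstep.map_eq]
    rw [integral_map hstep.measurable.aemeasurable hee.aestronglyMeasurable]
    rfl
  have hinner : ∀ s, ∫ ω, e (nextGraph α β s ω) ∂(innovationLaw p n m) ≤
      e s.2.2 - averageDegree s.2.2 + 1 / (1 - α) * (n : ℝ) ^ (1 - α - β) := by
    intro s
    have hlm : ∀ w, MeasurableSet {ω : Innovation n m | Linked α β s ω w} := by
      intro w
      refine MeasurableSet.inter ?_ ?_
      · have hy : Measurable fun ω : Innovation n m => ω.2.1 := by fun_prop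
        exact hy Metric.isClosed_closedBall.measurableSet
      · have hc : Measurable fun ω : Innovation n m => ω.2.2.2 w := by fun_prop
        exact hc (MeasurableSet.singleton true)
    have hlint : ∀ w, Integrable (fun ω : Innovation n m =>
        if Linked α β s ω w then (1 : ℝ) else 0) (innovationLaw p n m) := fun w =>
      (integrable_const (1 : ℝ)).indicator (hlm w)
    have hlval : ∀ w, ∫ ω, (if Linked α β s ω w then (1 : ℝ) else 0) ∂(innovationLaw p n m) =
        (innovationLaw p n m).real {ω | Linked α β s ω w} := fun w =>
      integral_indicator_one (hlm w)
    have hfst : MeasurePreserving (fun ω : Innovation n m => ω.1) (innovationLaw p n m)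
        (uniformOn Set.univ) := measurePreserving_fst
    have hdint : Integrable (fun ω : Innovation n m => (s.2.2.degree ω.1 : ℝ))
        (innovationLaw p n m) :=
      hfst.integrable_comp_of_integrable (g := fun u => (s.2.2.degree u : ℝ)) Integrable.of_finite
    have hdval : ∫ ω, (s.2.2.degree ω.1 : ℝ) ∂(innovationLaw p n m) = averageDegree s.2.2 := by
      have h1 : ∫ u, (s.2.2.degree u : ℝ) ∂(uniformOn (Set.univ : Set (Fin n))) =
          ∫ ω, (s.2.2.degree ω.1 : ℝ) ∂(innovationLaw p n m) := by
        rw [← hfst.map_eq, integral_map hfst.measurable.aemeasurable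
          (measurable_of_finite _).aestronglyMeasurable]
      rw [← h1, integral_uniformOn_univ hn, sum_degree_eq, averageDegree, Fintype.card_fin]
    have hdiff : Integrable (fun ω : Innovation n m => e s.2.2 - (s.2.2.degree ω.1 : ℝ))
        (innovationLaw p n m) := (integrable_const _).sub hdint
    calc ∫ ω, e (nextGraph α β s ω) ∂(innovationLaw p n m)
        ≤ ∫ ω, (e s.2.2 - s.2.2.degree ω.1 + ∑ w, (if Linked α β s ω w then (1 : ℝ) else 0))
            ∂(innovationLaw p n m) := by
          refine integral_mono_of_nonneg (ae_of_all _ fun _ => Nat.cast_nonneg _) ?_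
            (ae_of_all _ fun ω => ncard_edgeSet_nextGraph_le s ω)
          exact hdiff.add (integrable_finsetSum _ fun w _ => hlint w)
      _ = e s.2.2 - averageDegree s.2.2 +
            ∑ w, (innovationLaw p n m).real {ω | Linked α β s ω w} := by
          rw [integral_add hdiff
            (integrable_finsetSum _ fun w _ => hlint w), integral_sub (integrable_const _) hdint,
            hdval, integral_finsetSum _ fun w _ => hlint w, integral_const, probReal_univ,
            one_smul, Finset.sum_congr rfl fun w _ => hlval w]
      _ ≤ _ := by
          have h1 := Finset.sum_le_sum fun w (_ : w ∈ Finset.univ) =>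
            innovationLaw_real_linked_le (α := α) (β := β) p hn hα hβ hm s w
          have h2 := sum_influenceVolume_le (β := β) hn hα hα1 s.2.1
          linarith
  have hdiff : Integrable (fun s : State n m => e s.2.2 - averageDegree s.2.2) π :=
    (hint e).sub (hint averageDegree)
  have hfinal : ∫ s, e s.2.2 ∂π ≤ ∫ s, (e s.2.2 - averageDegree s.2.2 +
      1 / (1 - α) * (n : ℝ) ^ (1 - α - β)) ∂π := by
    rw [← hbal]
    exact integral_mono hintstep.integral_prod_left
      (hdiff.add (integrable_const _)) hinner
  rw [integral_add hdiff (integrable_const _),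
    integral_sub (hint e) (hint averageDegree), integral_const, probReal_univ, one_smul] at hfinal
  rw [hcomp averageDegree]
  linarith

end Degree

end GeoP

/-! ### Asymptotics in the dimension and the comparison with the binomial graph -/

namespace GeoP

section Asymptotics

variable {α β : ℝ} {p : unitInterval} {m : ℕ → ℕ}

theorem WithExtremeProbability.mono {E E' : (n : ℕ) → Set (SimpleGraph (Fin n))}
    (h : WithExtremeProbability α β p m E) (hE : ∀ᶠ n in atTop, E n ⊆ E' n) :
    WithExtremeProbability α β p m E' := by
  obtain ⟨c, hc, h⟩ := h
  refine ⟨c, hc, ?_⟩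
  filter_upwards [h, hE] with n hn hsub μ hμ
  have := hμ.isProbabilityMeasure
  exact (hn μ hμ).trans (measureReal_mono hsub (measure_ne_top _ _))

theorem two_div_three_mul_mem {K : ℕ} (hK : 2 ≤ K) :
    0 < 2 / (3 * (K : ℝ)) ∧ 2 / (3 * (K : ℝ)) ≤ 1 / 3 := by
  have : (2 : ℝ) ≤ K := by exact_mod_cast hK
  refine ⟨by positivity, ?_⟩
  rw [div_le_iff₀ (by linarith)]
  linarith

/-- For x = 2/(3K) ≤ 1/3 one has x ≤ -log(1-x) ≤ 3x/2, which gives the constants 2/3 and 1. -/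
theorem isTheta_neg_mul_log {K : ℕ → ℕ} (hK : ∀ᶠ n in atTop, 2 ≤ K n) :
    (fun n => -((m n : ℝ) * Real.log (1 - 2 / (3 * (K n : ℝ))))) =Θ[atTop]
      fun n => (m n : ℝ) / (K n : ℝ) := by
  have key : ∀ n, 2 ≤ K n → 2 / 3 * ((m n : ℝ) / K n) ≤
      -((m n : ℝ) * Real.log (1 - 2 / (3 * (K n : ℝ)))) ∧
      -((m n : ℝ) * Real.log (1 - 2 / (3 * (K n : ℝ)))) ≤ 1 * ((m n : ℝ) / K n) := by
    intro n hn
    obtain ⟨h0, h1⟩ := two_div_three_mul_mem hn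
    have hk : (0 : ℝ) < K n := by positivity
    set x := 2 / (3 * (K n : ℝ)) with hx
    have hx' : x = 2 / 3 * (1 / K n) := by rw [hx]; field_simp
    have hm : (0 : ℝ) ≤ m n := Nat.cast_nonneg _
    have hup : Real.log (1 - x) ≤ -x := by
      have := Real.log_le_sub_one_of_pos (by linarith : 0 < 1 - x)
      linarith
    have hlow : -(3 / 2 * x) ≤ Real.log (1 - x) := by
      have h2 := Real.one_sub_inv_le_log_of_pos (by linarith : 0 < 1 - x)
      have h3 : (1 - x)⁻¹ ≤ 1 + 3 / 2 * x := by
        rw [inv_le_iff_one_le_mul₀ (by linarith)]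
        nlinarith
      linarith
    constructor
    · have := mul_le_mul_of_nonneg_left hup hm
      have e : 2 / 3 * ((m n : ℝ) / K n) = m n * x := by rw [hx']; ring
      linarith
    · have := mul_le_mul_of_nonneg_left hlow hm
      have e : 1 * ((m n : ℝ) / K n) = m n * (3 / 2 * x) := by rw [hx']; ring
      linarith
  constructor
  · refine Asymptotics.IsBigO.of_bound 1 ?_
    filter_upwards [hK] with n hn
    have h0 : 0 ≤ (m n : ℝ) / K n := by positivity
    obtain ⟨h1, h2⟩ := key n hn
    rw [Real.norm_of_nonneg h0, Real.norm_of_nonneg (by linarith)]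
    exact h2
  · refine Asymptotics.IsBigO.of_bound (3 / 2) ?_
    filter_upwards [hK] with n hn
    have h0 : 0 ≤ (m n : ℝ) / K n := by positivity
    obtain ⟨h1, h2⟩ := key n hn
    rw [Real.norm_of_nonneg h0, Real.norm_of_nonneg (by linarith)]
    linarith

theorem sub_two_le_floorEven (x : ℝ) : x - 2 ≤ (floorEven x : ℝ) := by
  have := Nat.lt_floor_add_one (x / 2)
  unfold floorEven
  push_cast
  linarith

theorem tendsto_log_natCast : Tendsto (fun n : ℕ => Real.log n) atTop atTop :=
  Real.tendsto_log_atTop.comp tendsto_natCast_atTop_atTop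

theorem tendsto_log_log_natCast : Tendsto (fun n : ℕ => Real.log (Real.log n)) atTop atTop :=
  Real.tendsto_log_atTop.comp tendsto_log_natCast

/-- After taking logarithms the claim is d·l ≤ γL - 3l. The factor 1 - 1/l in the bound on d frees
γL/l, which pays for the 3l coming from log³ n. -/
theorem log_le_rpow_of_dim_le {γ L l d : ℝ} {n : ℕ} (hn : 0 < n) (hL : L = Real.log n)
    (hl : l = Real.log L) (hL0 : 0 < L) (hl0 : 0 < l) (hd : 0 < d)
    (h : d ≤ γ * (L / l) * (1 - 1 / l)) (hlarge : 3 * l ^ 2 ≤ γ * L) :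
    L ≤ ((n : ℝ) ^ γ / L ^ 3) ^ (1 / d) := by
  have hn' : (0 : ℝ) < n := by exact_mod_cast hn
  have hy : 0 < (n : ℝ) ^ γ / L ^ 3 := by positivity
  rw [Real.le_rpow_iff_log_le hL0 hy, Real.log_div (by positivity) (by positivity),
    Real.log_rpow hn', Real.log_pow, ← hL, ← hl, one_div_mul_eq_div, le_div_iff₀ hd]
  have h1 := mul_le_mul_of_nonneg_left h hl0.le
  have h2 : l * (γ * (L / l) * (1 - 1 / l)) = γ * L - γ * L / l := by field_simp
  have h3 : 3 * l ≤ γ * L / l := by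
    rw [le_div_iff₀ hl0]; linarith
  push_cast
  linarith

theorem eventually_dim_le (hγ : 0 < 1 - α - β)
    (h : ∀ᶠ n : ℕ in atTop, (m n : ℝ) ≤ (1 - α - β) * (Real.log n / Real.log (Real.log n)) *
      (1 - 1 / Real.log (Real.log n))) :
    ∀ᶠ n : ℕ in atTop, (m n : ℝ) ≤ (1 - α - β) * (Real.log n / Real.log (Real.log n)) := by
  filter_upwards [h, tendsto_log_natCast.eventually_ge_atTop 0,
    tendsto_log_log_natCast.eventually_ge_atTop 1] with n h1 h2 h3
  refine h1.trans (mul_le_of_le_one_right (by positivity) ?_)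
  have : 0 ≤ 1 / Real.log (Real.log n) := by positivity
  linarith

/-- K is at least log n - 2 ≥ (log n)/2 while m is at most (1-α-β) log n / log log n, so the
quotient is at least a constant times log log n. -/
theorem tendsto_gridSize_div (hγ : 0 < 1 - α - β) (hm : ∀ n, 1 ≤ m n)
    (h : ∀ᶠ n : ℕ in atTop, (m n : ℝ) ≤ (1 - α - β) * (Real.log n / Real.log (Real.log n)) *
      (1 - 1 / Real.log (Real.log n))) :
    Tendsto (fun n : ℕ => (gridSize α β n (m n) : ℝ) / (m n : ℝ)) atTop atTop := by
  have hlarge : ∀ᶠ n : ℕ in atTop,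
      3 * Real.log (Real.log n) ^ 2 ≤ (1 - α - β) * Real.log n := by
    have h1 := ((isLittleO_log_rpow_rpow_atTop 2 one_pos).def
      (div_pos hγ (by norm_num : (0 : ℝ) < 3)))
    filter_upwards [tendsto_log_natCast.eventually h1,
      tendsto_log_natCast.eventually_ge_atTop 0] with n hn hL
    rw [Real.rpow_one, Real.rpow_two, Real.norm_of_nonneg (sq_nonneg _),
      Real.norm_of_nonneg hL] at hn
    linarith
  refine tendsto_atTop_mono' atTop ?_
    (tendsto_log_log_natCast.const_mul_atTop (by positivity : 0 < 1 / (2 * (1 - α - β))))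
  filter_upwards [h, eventually_dim_le hγ h, hlarge, tendsto_log_natCast.eventually_ge_atTop 4,
    tendsto_log_log_natCast.eventually_ge_atTop 1, eventually_ge_atTop 1] with n h1 h2 h3 h4 h5 h6
  have hm0 : (0 : ℝ) < m n := by exact_mod_cast hm n
  have hx := log_le_rpow_of_dim_le h6 rfl rfl (by linarith) (by linarith) hm0 h1 h3
  have hK : Real.log n - 2 ≤ gridSize α β n (m n) :=
    (sub_le_sub_right hx 2).trans (sub_two_le_floorEven _)
  set L := Real.log n
  set l := Real.log L
  rw [le_div_iff₀ hm0]
  have h7 : 1 / (2 * (1 - α - β)) * l * m n ≤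
      1 / (2 * (1 - α - β)) * l * ((1 - α - β) * (L / l)) := by gcongr
  have h8 : 1 / (2 * (1 - α - β)) * l * ((1 - α - β) * (L / l)) = L / 2 := by field_simp
  linarith

theorem eventually_rpow_neg_le_pow {s : ℝ} (hs : 0 < s) (hγ : 0 < 1 - α - β)
    (h : ∀ᶠ n : ℕ in atTop, (m n : ℝ) ≤ (1 - α - β) * (Real.log n / Real.log (Real.log n)) *
      (1 - 1 / Real.log (Real.log n))) :
    ∀ᶠ n : ℕ in atTop, (n : ℝ) ^ (-s) ≤ (3 / 4 : ℝ) ^ m n := by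
  filter_upwards [eventually_dim_le hγ h, tendsto_log_natCast.eventually_ge_atTop 0,
    tendsto_log_log_natCast.eventually_ge_atTop ((1 - α - β) / s),
    tendsto_log_log_natCast.eventually_gt_atTop 0, eventually_ge_atTop 1] with n h1 h2 h3 h4 h5
  have hn' : (0 : ℝ) < n := by exact_mod_cast h5
  rw [← Real.rpow_natCast, Real.rpow_def_of_pos hn', Real.rpow_def_of_pos (by norm_num)]
  refine Real.exp_le_exp.2 ?_
  have hlog : -1 ≤ Real.log (3 / 4) := by
    have := Real.one_sub_inv_le_log_of_pos (by norm_num : (0 : ℝ) < 3 / 4)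
    norm_num at this
    linarith
  have h6 : (m n : ℝ) ≤ s * Real.log n := by
    refine h1.trans ?_
    rw [← mul_div_assoc, div_le_iff₀ h4]
    rw [div_le_iff₀ hs] at h3
    nlinarith
  have h7 := mul_le_mul_of_nonneg_right hlog (Nat.cast_nonneg (α := ℝ) (m n))
  linarith

/-- The edge probability is O(n^(-α-β)). Half of this exponent beats M and the constants, the other
half is below (3/4)^m because m = o(log n). -/
theorem eventually_binomialRandom_le (hα : 0 < α) (hα1 : α < 1) (hβ : 0 < β) (hβ1 : β < 1 - α)
    (hp : 0 < p) (hm : ∀ n, 1 ≤ m n)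
    (h : ∀ᶠ n : ℕ in atTop, (m n : ℝ) ≤ (1 - α - β) * (Real.log n / Real.log (Real.log n)) *
      (1 - 1 / Real.log (Real.log n))) (M : ℝ) :
    ∀ᶠ n : ℕ in atTop, ∀ μ : Measure (SimpleGraph (Fin n)), IsGeoP α β p n (m n) μ →
      M * (∫ H, clusteringCoeff H ∂(SimpleGraph.binomialRandom (Fin n)
          (Set.projIcc 0 1 zero_le_one ((∫ G, averageDegree G ∂μ) / n)))) ≤
        (3 / 4 : ℝ) ^ m n * ((1 - α) / (1 + α)) * (p : ℝ) := by
  have hs : 0 < (α + β) / 2 := by linarith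
  have hp0 : (0 : ℝ) < p := hp
  have h1a : 0 < 1 - α := by linarith
  have hc0 : 0 < (1 - α) / (1 + α) * (p : ℝ) := by positivity
  have hlim : ∀ᶠ n : ℕ in atTop,
      |M| * (1 / (1 - α)) / ((1 - α) / (1 + α) * (p : ℝ)) ≤ (n : ℝ) ^ ((α + β) / 2) :=
    ((tendsto_rpow_atTop hs).comp tendsto_natCast_atTop_atTop).eventually_ge_atTop _
  filter_upwards [eventually_rpow_neg_le_pow hs (by linarith) h, hlim, eventually_ge_atTop 1]
    with n h1 h2 h3 μ hμ
  have hn' : (0 : ℝ) < n := by exact_mod_cast h3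
  have hdeg := hμ.integral_averageDegree_le h3 (hm n) hα hα1 hβ
  set q := Set.projIcc (0 : ℝ) 1 zero_le_one ((∫ G, averageDegree G ∂μ) / n) with hq
  have hqle : (q : ℝ) ≤ 1 / (1 - α) * (n : ℝ) ^ (-(α + β)) := by
    rw [hq, Set.coe_projIcc]
    refine max_le (by positivity) ((min_le_right _ _).trans ?_)
    rw [div_le_iff₀ hn']
    refine hdeg.trans (le_of_eq ?_)
    rw [show (1 : ℝ) - α - β = -(α + β) + 1 by ring, Real.rpow_add hn', Real.rpow_one]
    ring
  have hcl := (integral_clusteringCoeff_binomialRandom_le (V := Fin n) q).trans hqle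
  have hcl0 : 0 ≤ ∫ H, clusteringCoeff H ∂(SimpleGraph.binomialRandom (Fin n) q) := by
    refine integral_nonneg fun H => ?_
    exact div_nonneg (Finset.sum_nonneg fun v _ => localClustering_nonneg H v) (Nat.cast_nonneg _)
  rw [div_le_iff₀ hc0] at h2
  have hsplit : (n : ℝ) ^ (-(α + β)) = (n : ℝ) ^ (-((α + β) / 2)) * (n : ℝ) ^ (-((α + β) / 2)) := by
    rw [← Real.rpow_add hn']; congr 1; ring
  have hinv : (n : ℝ) ^ ((α + β) / 2) * (n : ℝ) ^ (-((α + β) / 2)) = 1 := by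
    rw [← Real.rpow_add hn']; simp
  have hz : 0 < (n : ℝ) ^ (-((α + β) / 2)) := Real.rpow_pos_of_pos hn' _
  set z := (n : ℝ) ^ (-((α + β) / 2))
  calc M * (∫ H, clusteringCoeff H ∂(SimpleGraph.binomialRandom (Fin n) q))
      ≤ |M| * (1 / (1 - α) * (n : ℝ) ^ (-(α + β))) :=
        mul_le_mul (le_abs_self M) hcl hcl0 (abs_nonneg M)
    _ = |M| * (1 / (1 - α)) * (z * z) := by rw [hsplit]; ring
    _ ≤ (n : ℝ) ^ ((α + β) / 2) * ((1 - α) / (1 + α) * p) * (z * z) := by gcongr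
    _ = ((n : ℝ) ^ ((α + β) / 2) * z) * (z * ((1 - α) / (1 + α) * p)) := by ring
    _ = z * ((1 - α) / (1 + α) * p) := by rw [hinv, one_mul]
    _ ≤ (3 / 4 : ℝ) ^ m n * ((1 - α) / (1 + α) * p) := by gcongr
    _ = _ := by ring

end Asymptotics

end GeoP

theorem theorem3p4 (α β : ℝ) (hα0 : 0 < α) (hα1 : α < 1) (hβ0 : 0 < β) (hβ1 : β < 1 - α)
    (p : unitInterval) (hp : 0 < p) (m : ℕ → ℕ) (hm : ∀ n, 1 ≤ m n)
    (hK : ∀ᶠ n : ℕ in atTop, 2 ≤ GeoP.gridSize α β n (m n)) :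
    (∃ ε : ℕ → ℝ, Tendsto ε atTop (𝓝 0) ∧
      GeoP.WithExtremeProbability α β p m fun n => {G |
        (1 + ε n) * (3 / 4 * (1 - 2 / (3 * (GeoP.gridSize α β n (m n) : ℝ)))) ^ m n *
          ((1 - α) / (1 + α)) * (p : ℝ) ≤ clusteringCoeff G}) ∧
    (∃ f : ℕ → ℝ,
      f =Θ[atTop] (fun n : ℕ => (m n : ℝ) / (GeoP.gridSize α β n (m n) : ℝ)) ∧
      ∀ᶠ n : ℕ in atTop,
        (3 / 4 * (1 - 2 / (3 * (GeoP.gridSize α β n (m n) : ℝ)))) ^ m n =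
          Real.exp (-f n) * (3 / 4 : ℝ) ^ m n) ∧
    ((∀ᶠ n : ℕ in atTop, (m n : ℝ) ≤ (1 - α - β) * (Real.log n / Real.log (Real.log n)) *
        (1 - 1 / Real.log (Real.log n))) →
      Tendsto (fun n : ℕ => (GeoP.gridSize α β n (m n) : ℝ) / (m n : ℝ)) atTop atTop ∧
      (∃ ε : ℕ → ℝ, Tendsto ε atTop (𝓝 0) ∧
        GeoP.WithExtremeProbability α β p m fun n => {G |
          (1 + ε n) * (3 / 4 : ℝ) ^ m n * ((1 - α) / (1 + α)) * (p : ℝ) ≤ clusteringCoeff G}) ∧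
      ∀ M : ℝ, ∀ᶠ n : ℕ in atTop, ∀ μ : Measure (SimpleGraph (Fin n)),
        GeoP.IsGeoP α β p n (m n) μ →
          M * (∫ H, clusteringCoeff H ∂(SimpleGraph.binomialRandom (Fin n)
              (Set.projIcc 0 1 zero_le_one ((∫ G, averageDegree G ∂μ) / n)))) ≤
            (3 / 4 : ℝ) ^ m n * ((1 - α) / (1 + α)) * (p : ℝ)) := by
  have hwep := GeoP.withExtremeProbability_le_clusteringCoeff hα0 hα1 hβ0 hβ1 p hp m hm hK
  have hp0 : (0 : ℝ) < p := hp
  have h1a : 0 < 1 - α := by linarith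
  -- Both error sequences are identically 0. In the first bound the factor with K only weakens the
  -- claim, being at most 1; f is -m log(1 - 2/(3K)).
  refine ⟨⟨0, tendsto_const_nhds, hwep.mono ?_⟩, ⟨_, GeoP.isTheta_neg_mul_log hK, ?_⟩, fun h =>
    ⟨GeoP.tendsto_gridSize_div (by linarith) hm h, ⟨0, tendsto_const_nhds, ?_⟩,
      GeoP.eventually_binomialRandom_le hα0 hα1 hβ0 hβ1 hp hm h⟩⟩
  · filter_upwards [hK] with n hn G hG
    obtain ⟨h0, h1⟩ := GeoP.two_div_three_mul_mem hn
    refine le_trans ?_ (show _ ≤ clusteringCoeff G from hG)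
    rw [Pi.zero_apply, add_zero, one_mul]
    have : (3 / 4 * (1 - 2 / (3 * (GeoP.gridSize α β n (m n) : ℝ)))) ^ m n ≤ (3 / 4 : ℝ) ^ m n :=
      pow_le_pow_left₀ (by linarith) (by linarith) _
    gcongr
  · filter_upwards [hK] with n hn
    obtain ⟨h0, h1⟩ := GeoP.two_div_three_mul_mem hn
    rw [neg_neg, mul_comm (m n : ℝ), ← Real.rpow_def_of_pos (by linarith), Real.rpow_natCast,
      mul_pow, mul_comm]
  · simpa using hwep
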